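/- Throughout, a graph $G$ is finite, with finite vertex set $V(G)$ and finite edge set $E(G)$; multiple edges between two vertices are allowed, loops are not. For $v\in V(G)$ let $E(v)\subseteq E(G)$ be the set of edges incident to $v$. The graph incidence group $\Gamma(G)$ is the group generated by $\{x_e : e\in E(G)\}$ subject to the relations 1. $x_e^2=1$ for all $e\in E(G)$; 2. $x_ex_{e'}=x_{e'}x_e$ for all $v\in V(G)$ and $e,e'\in E(v)$; 3. $\prod_{e\in E(v)}x_e=1$ for all $v\in V(G)$. A graph $H$ is a minor of $G$ if a graph isomorphic to $H$ can be obtained from $G$ by a finite (possibly empty) sequence of the following operations: deleting an edge; deleting a vertex together with all edges incident to it; and contracting an edge $e$ with endpoints $v_1,v_2$, that is, replacing $v_1$ and $v_2$ by a single new vertex $u$, removing all edges between $v_1$ and $v_2$, and making every other edge incident to $v_1$ or $v_2$ incident to $u$ instead. The graph $G$ avoids $H$ if $H$ is not a minor of $G$. Let $C_2$ be the graph with two vertices and two edges between them, $C_2\sqcup C_2$ the disjoint union of two copies of $C_2$, and $K_{3,4}$ the complete bipartite graph with parts of sizes $3$ and $4$. **Proposition 5.2.** For every graph $G$, the group $\Gamma(G)$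 is abelian if and only if $G$ avoids both $C_2\sqcup C_2$ and $K_{3,4}$. -/

import Mathlib

open scoped Graph

namespace Graph

section IncidenceGroup

variable {α β : Type*}

/-- The relators of the graph incidence group of an (uncoloured) graph `G`, as words in the free
group on the edges of `G`.  In `prod`, the product over the edges at `v` is required to be trivial
for every enumeration `l` (without repetition) of the edges at `v`; because these edges commute by
`comm`, one may as well fix a single enumeration for every vertex. -/
inductive IncidenceRelator (G : Graph α β) : FreeGroup E(G) → Prop
  | sq (e : E(G)) : IncidenceRelator G (FreeGroup.of e ^ 2)
  | comm (v : α) (hv : v ∈ V(G)) (e e' : E(G)) (he : G.Inc e v) (he' : G.Inc e' v) :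
      IncidenceRelator G
        (FreeGroup.of e * FreeGroup.of e' * (FreeGroup.of e)⁻¹ * (FreeGroup.of e')⁻¹)
  | prod (v : α) (hv : v ∈ V(G)) (l : List E(G)) (hl : l.Nodup)
      (hlv : ∀ e : E(G), e ∈ l ↔ G.Inc e v) :
      IncidenceRelator G (l.map FreeGroup.of).prod

/-- The graph incidence group `Γ(G)`: generated by the edges of `G`, subject to the relations that
every generator squares to `1`, that any two edges at a common vertex commute, and that for each
vertex the product of the edges at that vertex is `1`. -/
abbrev IncidenceGroup (G : Graph α β) : Type _ :=
  PresentedGroup {r : FreeGroup E(G) | IncidenceRelator G r}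

end IncidenceGroup

section Minor

variable {α β α' β' : Type*}

open Classical in
/-- Contraction of the two vertices `v₁`, `v₂` to one vertex `u`: all edges incident to both `v₁`
and `v₂` are removed, and the edges incident to `v₁` or `v₂` become incident to `u`.  Used when
`v₁`, `v₂` are the endpoints of an edge of a loopless graph and `u` is not one of the
remaining vertices. -/
noncomputable def contractPair (G : Graph α β) (v₁ v₂ u : α) : Graph α β :=
  (G.deleteEdges (G.incidenceSet v₁ ∩ G.incidenceSet v₂)).map
    (fun x ↦ if x = v₁ ∨ x = v₂ then u else x)

/-- `MinorStep G H`: the graph `H` is the result of one minor operation on `G`. -/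
inductive MinorStep : Graph α β → Graph α β → Prop
  | deleteEdge (G : Graph α β) (e : β) (he : e ∈ E(G)) : MinorStep G (G.deleteEdges {e})
  | contractEdge (G : Graph α β) (e : β) (v₁ v₂ u : α) (he : G.IsLink e v₁ v₂)
      (hu : u ∉ V(G) \ {v₁, v₂}) : MinorStep G (G.contractPair v₁ v₂ u)
  | deleteVertex (G : Graph α β) (v : α) (hv : v ∈ V(G)) : MinorStep G (G.deleteVerts {v})

/-- Isomorphisms of multigraphs: bijections between the vertices and between the edges which
respect the endpoints of every edge. -/
structure Iso (G : Graph α β) (H : Graph α' β') where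
  vertexEquiv : V(G) ≃ V(H)
  edgeEquiv : E(G) ≃ E(H)
  isLink_iff : ∀ (e : E(G)) (x y : V(G)),
    H.IsLink (edgeEquiv e) (vertexEquiv x) (vertexEquiv y) ↔ G.IsLink e x y

/-- `H` is a minor of `G`: up to isomorphism, `H` is obtained from `G` by a finite (possibly empty)
sequence of edge deletions, edge contractions and vertex deletions. -/
def IsMinor (H : Graph α' β') (G : Graph α β) : Prop :=
  ∃ G' : Graph α β, Relation.ReflTransGen MinorStep G G' ∧ Nonempty (Iso G' H)

/-- The disjoint union of two graphs. -/
def disjUnion (G : Graph α β) (H : Graph α' β') : Graph (α ⊕ α') (β ⊕ β') where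
  vertexSet := Sum.inl '' V(G) ∪ Sum.inr '' V(H)
  IsLink e x y :=
    (∃ e' x' y', e = .inl e' ∧ x = .inl x' ∧ y = .inl y' ∧ G.IsLink e' x' y') ∨
    (∃ e' x' y', e = .inr e' ∧ x = .inr x' ∧ y = .inr y' ∧ H.IsLink e' x' y')
  isLink_symm := by
    intro e _
    refine ⟨?_⟩
    rintro x y (⟨e', x', y', rfl, rfl, rfl, h⟩ | ⟨e', x', y', rfl, rfl, rfl, h⟩)
    · exact Or.inl ⟨e', y', x', rfl, rfl, rfl, h.symm⟩
    · exact Or.inr ⟨e', y', x', rfl, rfl, rfl, h.symm⟩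
  eq_or_eq_of_isLink_of_isLink := by
    rintro e x y v w (⟨e', x', y', rfl, rfl, rfl, h⟩ | ⟨e', x', y', rfl, rfl, rfl, h⟩)
      (⟨e'', v', w', he, rfl, rfl, h'⟩ | ⟨e'', v', w', he, rfl, rfl, h'⟩)
    · cases he
      simpa using h.left_eq_or_eq h'
    · cases he
    · cases he
    · cases he
      simpa using h.left_eq_or_eq h'
  left_mem_of_isLink := by
    rintro e x y (⟨e', x', y', rfl, rfl, rfl, h⟩ | ⟨e', x', y', rfl, rfl, rfl, h⟩)
    · exact Or.inl ⟨x', h.left_mem, rfl⟩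
    · exact Or.inr ⟨x', h.left_mem, rfl⟩

/-- The 2-cycle `C₂`: two vertices and two (parallel) edges between them. -/
def twoCycle : Graph (Fin 2) (Fin 2) := Graph.banana 0 1 Set.univ

/-- The complete bipartite graph `K_{m,n}`. -/
def completeBipartite (m n : ℕ) : Graph (Fin m ⊕ Fin n) (Sym2 (Fin m ⊕ Fin n)) :=
  Graph.ofSimpleGraph (completeBipartiteGraph (Fin m) (Fin n))

end Minor

end Graph

/-!
A homomorphism from the incidence group of `G` to a group `K` is a family `x` of elements of `K`
indexed by the edges which satisfies the defining relations (`Graph.IsSol`), and the incidence group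
is abelian if and only if every such family, in every group, consists of commuting elements
(`Graph.CommSols`).  All of the argument is about such solutions.

*If the group is abelian, then neither graph is a minor.*  A solution of a minor extends to a
solution of the graph: it is set to `1` on deleted edges, on the edges parallel to a contracted edge
`e`, and on `e` itself takes the value which the relation at an end of `e` dictates.  So commutativity
passes to minors (`Graph.IsMinor.commSols`).  On `C₂ ⊔ C₂` one may place an involution on each cycle,
and two involutions need not commute; on `K_{3,4}` a `3 × 4` array of Pauli operators is a solution.

*If neither graph is a minor, then the group is abelian.*  Vertices of degree at most
two are removed by induction: an edge at a vertex of degree one has trivial value, and two edges at a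
vertex of degree two have the same value, so that one of them may be contracted unless they are
parallel, when all cycles pass through their other end (`Graph.commSols_of_not_isMinor`).  There remain the graphs of minimum degree at least three
without two disjoint cycles (disjoint cycles contract to `C₂ ⊔ C₂`).  By a theorem of Lovász, proved
here as `EdgeMult.Tame.classification`, such a graph becomes a forest on removing a vertex, or is a
wheel with multiple spokes, or is `K₅`, or is `K_{3,n}` with edges added on the side of size three.
In the last case `n ≤ 3`, as `K_{3,4}` is excluded.

For each family, solutions commute for a different reason.  If `G - u` is a forest, then the relations
at its leaves express all edges through those at `u`, which commute.  In a wheel, each rim edge is one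
fixed rim edge times a product of spokes.  In `K_{3,n}` with extra edges, the extra edges are central,
and the relations at the three special vertices with `n ≤ 3` give the rest.  For `K₅`, two disjoint
edges have a commutator that is the same central element for various pairs of disjoint edges, and the
product of the relations forces this element to be trivial.

The classification works with the multiplicity function of a multigraph.  A *cycle* is replaced by a
nonempty vertex set inside which all degrees are at least two, which contains a cycle and is one for
the purpose of disjointness; acyclic sets then obey the usual bound on the number of edges, and the
proof counts edges between parts of the graph.
-/

/-! ### Multiplicity functions: cyclic and acyclic vertex sets -/

namespace EdgeMult

open Finset

set_option linter.unusedSectionVars false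

variable {α : Type*} [DecidableEq α]

/-- The degree of `v` into `X`, for a multigraph given by its multiplicity function `m`
(`m v w` is the number of edges between `v` and `w`). -/
def degIn (m : α → α → ℕ) (v : α) (X : Finset α) : ℕ := ∑ w ∈ X, m v w

/-- The sum of the degrees in the subgraph induced on `X`, that is, twice its number of edges. -/
def tot (m : α → α → ℕ) (X : Finset α) : ℕ := ∑ v ∈ X, degIn m v X

/-- A set of vertices inducing a nonempty subgraph of minimum degree at least `2`. Vertex sets of
cycles are of this kind, and in a loopless graph every such set contains a cycle, so these sets
stand in for cycles. -/
def IsCyc (m : α → α → ℕ) (S : Finset α) : Prop := S.Nonempty ∧ ∀ v ∈ S, 2 ≤ degIn m v S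

/-- The subgraph induced on `X` is a forest. -/
def Acyclic (m : α → α → ℕ) (X : Finset α) : Prop := ∀ S ⊆ X, ¬ IsCyc m S

variable {m : α → α → ℕ} {X Y S T A B : Finset α} {u v w : α}

lemma degIn_mono (h : X ⊆ Y) : degIn m v X ≤ degIn m v Y :=
  Finset.sum_le_sum_of_subset h

lemma degIn_insert (h : w ∉ X) : degIn m v (insert w X) = m v w + degIn m v X := by
  simp [degIn, sum_insert h]

lemma degIn_erase (h : w ∈ X) : degIn m v (X.erase w) + m v w = degIn m v X := by
  simp [degIn, sum_erase_add _ _ h]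

lemma degIn_union (h : Disjoint X Y) : degIn m v (X ∪ Y) = degIn m v X + degIn m v Y := by
  simp [degIn, sum_union h]

lemma degIn_sdiff_add (h : S ⊆ X) : degIn m v (X \ S) + degIn m v S = degIn m v X := by
  simp [degIn, sum_sdiff h]

lemma le_degIn (h : w ∈ X) : m v w ≤ degIn m v X :=
  single_le_sum (f := fun w ↦ m v w) (fun _ _ ↦ Nat.zero_le _) h

lemma Acyclic.mono (h : Acyclic m Y) (hX : X ⊆ Y) : Acyclic m X :=
  fun S hS ↦ h S (hS.trans hX)

lemma not_acyclic_iff : ¬ Acyclic m X ↔ ∃ S ⊆ X, IsCyc m S := by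
  simp [Acyclic]

lemma sum_degIn_comm (hs : ∀ v w, m v w = m w v)
    (X Y : Finset α) : ∑ v ∈ X, degIn m v Y = ∑ v ∈ Y, degIn m v X := by
  unfold degIn
  rw [sum_comm]
  simp_rw [hs]

lemma tot_insert (hs : ∀ v w, m v w = m w v) (hv : v ∉ X) (hd : ∀ v, m v v = 0) :
    tot m (insert v X) = tot m X + 2 * degIn m v X := by
  unfold tot
  rw [sum_insert hv, degIn_insert hv, hd]
  have : ∑ w ∈ X, degIn m w (insert v X) = degIn m v X + ∑ w ∈ X, degIn m w X := by
    simp_rw [degIn_insert hv, sum_add_distrib]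
    simp [degIn, hs]
  omega

lemma tot_erase (hs : ∀ v w, m v w = m w v) (hd : ∀ v, m v v = 0) (hv : v ∈ X) :
    tot m (X.erase v) + 2 * degIn m v X = tot m X := by
  have := tot_insert hs (notMem_erase v X) hd
  rw [insert_erase hv] at this
  have h2 := degIn_erase (m := m) (v := v) hv
  rw [hd] at h2
  omega

lemma tot_union (hs : ∀ v w, m v w = m w v) (h : Disjoint A B) :
    tot m (A ∪ B) = tot m A + tot m B + 2 * ∑ v ∈ A, degIn m v B := by
  unfold tot
  rw [sum_union h]
  simp_rw [degIn_union h, sum_add_distrib]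
  rw [sum_degIn_comm hs B A]
  omega

/-- In a forest some vertex has degree at most one. -/
lemma Acyclic.exists_degIn_le_one (h : Acyclic m X) (hX : X.Nonempty) :
    ∃ v ∈ X, degIn m v X ≤ 1 := by
  by_contra! hc
  exact h X Subset.rfl ⟨hX, fun v hv ↦ hc v hv⟩

/-- A nonempty forest has fewer edges than vertices. -/
lemma Acyclic.tot_add_two_le (hs : ∀ v w, m v w = m w v)
    (hd : ∀ v, m v v = 0) (h : Acyclic m X) (hX : X.Nonempty) :
    tot m X + 2 ≤ 2 * #X := by
  induction hn : #X generalizing X with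
  | zero => simp_all
  | succ n ih =>
    obtain ⟨v, hv, hv1⟩ := h.exists_degIn_le_one hX
    have h1 := tot_erase hs hd hv
    have h2 := card_erase_of_mem hv
    obtain h0 | h0 := (X.erase v).eq_empty_or_nonempty
    · rw [h0] at h1 h2
      simp [tot] at h1 h2
      have : degIn m v X = 0 := by
        have : X = {v} := by
          rw [← insert_erase hv, h0]; simp
        simp [this, degIn, hd]
      simp only [tot]
      omega
    · have := ih (h.mono (erase_subset v X)) h0 (by omega)
      omega

lemma exists_isCyc_of_card_le (hs : ∀ v w, m v w = m w v)
    (hd : ∀ v, m v v = 0) (hX : X.Nonempty) (h : 2 * #X ≤ tot m X + 1) :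
    ∃ S ⊆ X, IsCyc m S := by
  by_contra hc
  rw [← not_acyclic_iff, not_not] at hc
  have := hc.tot_add_two_le hs hd hX
  omega

lemma Acyclic.insert_bound (hs : ∀ v w, m v w = m w v)
    (hd : ∀ v, m v v = 0) (hv : v ∉ X) (h : Acyclic m (insert v X)) :
    tot m X + 2 * degIn m v X ≤ 2 * #X := by
  have := h.tot_add_two_le hs hd (insert_nonempty _ _)
  rw [tot_insert hs hv hd, card_insert_of_notMem hv] at this
  omega

/-- A forest with at least two vertices has at least two vertices of degree at most one. -/
lemma Acyclic.exists_ne_degIn_le_one (hs : ∀ v w, m v w = m w v)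
    (hd : ∀ v, m v v = 0) (h : Acyclic m X) (hX : 2 ≤ #X)
    (v : α) : ∃ w ∈ X, w ≠ v ∧ degIn m w X ≤ 1 := by
  by_cases hv : v ∈ X
  swap
  · obtain ⟨w, hw, hw1⟩ := h.exists_degIn_le_one (card_pos.mp (by omega))
    exact ⟨w, hw, fun e ↦ hv (e ▸ hw), hw1⟩
  by_contra! hc
  have hne : (X.erase v).Nonempty := card_pos.mp (by rw [card_erase_of_mem hv]; omega)
  have h2 : 2 * #(X.erase v) ≤ ∑ w ∈ X.erase v, degIn m w X := by
    rw [mul_comm, ← smul_eq_mul]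
    exact card_nsmul_le_sum _ _ _ fun w hw ↦ hc w (mem_of_mem_erase hw) (ne_of_mem_erase hw)
  have h3 : tot m X = degIn m v X + ∑ w ∈ X.erase v, degIn m w X := (add_sum_erase _ _ hv).symm
  have h4 := h.tot_add_two_le hs hd ⟨v, hv⟩
  rw [card_erase_of_mem hv] at h2
  have h5 : degIn m v X = 0 := by omega
  refine h _ (erase_subset v X) ⟨hne, fun w hw ↦ ?_⟩
  have h6 := degIn_erase (m := m) (v := w) hv
  have h7 := hc w (mem_of_mem_erase hw) (ne_of_mem_erase hw)
  have h8 := le_degIn (m := m) (v := v) (mem_of_mem_erase hw)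
  rw [hs] at h8
  omega

/-- In a tree with at least two vertices there are no isolated vertices. -/
lemma Acyclic.degIn_pos (hs : ∀ v w, m v w = m w v)
    (hd : ∀ v, m v v = 0) (h : Acyclic m X) (hX : 2 ≤ #X)
    (ht : 2 * #X ≤ tot m X + 2) (hv : v ∈ X) : 1 ≤ degIn m v X := by
  have h1 := tot_erase hs hd hv
  have h2 := card_erase_of_mem hv
  have := (h.mono (erase_subset v X)).tot_add_two_le hs hd (card_pos.mp (by omega))
  omega

/-- A forest which has too few edges to be a tree is disconnected. -/
lemma Acyclic.exists_split (hs : ∀ v w, m v w = m w v)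
    (hd : ∀ v, m v v = 0) (h : Acyclic m X) (hX : X.Nonempty)
    (ht : tot m X + 2 < 2 * #X) : ∃ A B, A.Nonempty ∧ B.Nonempty ∧ Disjoint A B ∧ A ∪ B = X ∧
      ∀ a ∈ A, ∀ b ∈ B, m a b = 0 := by
  induction hn : #X generalizing X with
  | zero => simp_all
  | succ n ih =>
    obtain ⟨v, hv, hv1⟩ := h.exists_degIn_le_one hX
    have h1 := tot_erase hs hd hv
    have h2 := card_erase_of_mem hv
    have hins := insert_erase hv
    have hne : (X.erase v).Nonempty := by
      rw [← card_pos]; omega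
    by_cases h0 : degIn m v X = 0
    · refine ⟨{v}, X.erase v, singleton_nonempty _, hne, by simp, by
        rw [← hins]; ext; simp, ?_⟩
      intro a ha b hb
      rw [mem_singleton.mp ha]
      have := le_degIn (m := m) (v := v) (mem_of_mem_erase hb)
      omega
    · obtain ⟨A, B, hA, hB, hAB, hU, hz⟩ := ih (h.mono (erase_subset v X)) hne (by omega) (by omega)
      have hvA : v ∉ A := fun hh ↦ by
        have : v ∈ X.erase v := hU ▸ mem_union_left _ hh
        simp at this
      have hvB : v ∉ B := fun hh ↦ by
        have : v ∈ X.erase v := hU ▸ mem_union_right _ hh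
        simp at this
      have h5 : degIn m v A + degIn m v B ≤ 1 := by
        rw [← degIn_union hAB, hU]
        exact (degIn_mono (erase_subset v X)).trans hv1
      have key : degIn m v A = 0 ∨ degIn m v B = 0 := by omega
      have z0 : ∀ {C : Finset α}, degIn m v C = 0 → ∀ c ∈ C, m v c = 0 := by
        intro C hC c hc
        have := le_degIn (m := m) (v := v) hc
        omega
      obtain h6 | h6 := key
      · refine ⟨A, insert v B, hA, insert_nonempty _ _, ?_, ?_, ?_⟩
        · simp [disjoint_insert_right, hvA, hAB]
        · rw [union_insert, hU, hins]
        · intro a ha b hb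
          obtain rfl | hb := mem_insert.mp hb
          · rw [hs]; exact z0 h6 a ha
          · exact hz a ha b hb
      · refine ⟨insert v A, B, insert_nonempty _ _, hB, ?_, ?_, ?_⟩
        · simp [disjoint_insert_left, hvB, hAB]
        · rw [insert_union, hU, hins]
        · intro a ha b hb
          obtain rfl | ha := mem_insert.mp ha
          · exact z0 h6 b hb
          · exact hz a ha b hb

/-- Counting the edges at `A` when all of them go to `A` or to `S`. -/
lemma three_mul_card_le (hs : ∀ v w, m v w = m w v) {V : Finset α} (hdeg : ∀ w ∈ A, 3 ≤ degIn m w V)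
    (h : ∀ w ∈ A, degIn m w V = degIn m w A + degIn m w S) :
    3 * #A ≤ tot m A + ∑ s ∈ S, degIn m s A := by
  rw [← sum_degIn_comm hs A S, tot, ← sum_add_distrib, mul_comm, ← smul_eq_mul]
  exact card_nsmul_le_sum _ _ _ fun w hw ↦ (h w hw) ▸ hdeg w hw

lemma isCyc_pair (hd : ∀ v, m v v = 0) (hs : ∀ v w, m v w = m w v) (hne : v ≠ w)
    (h : 2 ≤ m v w) : IsCyc m {v, w} := by
  refine ⟨⟨v, by simp⟩, ?_⟩
  intro x hx
  simp only [mem_insert, mem_singleton] at hx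
  obtain rfl | rfl := hx
  · simp [degIn, sum_pair hne, hd, h]
  · simp [degIn, sum_pair hne, hd, hs x v, h]

/-- Adding to a forest a vertex with at most one edge to it gives a forest. -/
lemma Acyclic.insert_of_degIn_le_one (h : Acyclic m X) (hv : degIn m v (insert v X) ≤ 1) :
    Acyclic m (insert v X) := by
  intro S hS hc
  by_cases hvS : v ∈ S
  · have := hc.2 v hvS
    have := degIn_mono (m := m) (v := v) hS
    omega
  · exact h S (fun x hx ↦ (mem_insert.mp (hS hx)).resolve_left (fun e ↦ hvS (e ▸ hx))) hc

end EdgeMult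

/-! ### Two vertices meeting all cycles -/

namespace EdgeMult

open Finset

set_option linter.unusedSectionVars false

variable {α : Type*} [DecidableEq α]

/-- The multigraph on `V` with multiplicities `m` is loopless, of minimum degree at least `3`, and
without two disjoint cycles. -/
structure Tame (m : α → α → ℕ) (V : Finset α) : Prop where
  symm : ∀ v w, m v w = m w v
  diag : ∀ v, m v v = 0
  three_le : ∀ v ∈ V, 3 ≤ degIn m v V
  meet : ∀ S ⊆ V, ∀ T ⊆ V, IsCyc m S → IsCyc m T → ¬ Disjoint S T

/-- Deleting some vertex leaves a forest. -/
def IsForestPlusVertex (m : α → α → ℕ) (V : Finset α) : Prop :=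
  ∃ u ∈ V, Acyclic m (V.erase u)

/-- Deleting some vertex leaves a `2`-regular graph; without two disjoint cycles, this is a
wheel whose spokes may be multiple. -/
def IsMultiWheel (m : α → α → ℕ) (V : Finset α) : Prop :=
  ∃ u ∈ V, ∀ h ∈ V.erase u, degIn m h (V.erase u) = 2

/-- There are three vertices to which every other vertex is joined by one edge each, these being
the only edges at the other vertices: a graph `K_{3,n}` with edges added on the side of size `3`. -/
def IsThreeCone (m : α → α → ℕ) (V : Finset α) : Prop :=
  ∃ u ∈ V, ∃ v ∈ V, ∃ c ∈ V, u ≠ v ∧ u ≠ c ∧ v ≠ c ∧ ∀ w ∈ V \ {u, v, c},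
    m w u = 1 ∧ m w v = 1 ∧ m w c = 1 ∧ ∀ w' ∈ V \ {u, v, c}, m w w' = 0

/-- The complete graph `K₅`. -/
def IsKFive (m : α → α → ℕ) (V : Finset α) : Prop :=
  #V = 5 ∧ ∀ v ∈ V, ∀ w ∈ V, v ≠ w → m v w = 1

variable {m : α → α → ℕ} {V X Y S T A B F : Finset α} {u v w : α}

lemma Tame.acyclic_or (h : Tame m V) (hX : X ⊆ V) (hY : Y ⊆ V) (hXY : Disjoint X Y) :
    Acyclic m X ∨ Acyclic m Y := by
  by_contra! hc
  obtain ⟨S, hS, hS'⟩ := not_acyclic_iff.mp hc.1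
  obtain ⟨T, hT, hT'⟩ := not_acyclic_iff.mp hc.2
  exact h.meet S (hS.trans hX) T (hT.trans hY) hS' hT' (hXY.mono hS hT)

/-- Two forests sharing only the vertex `v` form a forest. -/
lemma Acyclic.glue (hs : ∀ v w, m v w = m w v) (hd : ∀ v, m v v = 0)
    (hA : Acyclic m (insert v A)) (hB : Acyclic m (insert v B))
    (hvA : v ∉ A) (hvB : v ∉ B) (hz : ∀ a ∈ A, ∀ b ∈ B, m a b = 0) :
    Acyclic m (insert v (A ∪ B)) := by
  have key : ∀ {A B : Finset α}, Acyclic m (insert v A) → v ∉ A → (∀ a ∈ A, ∀ b ∈ B, m a b = 0) →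
      ∀ S ⊆ insert v (A ∪ B), IsCyc m S → S ∩ A = ∅ := by
    intro A B hA hvA hz S hS hc
    by_contra hne
    have hvS : v ∉ S ∩ A := fun h ↦ hvA (mem_inter.mp h).2
    have hac : Acyclic m (insert v (S ∩ A)) :=
      hA.mono (insert_subset_insert _ inter_subset_right)
    obtain ⟨w, hw, hwv, hw1⟩ := hac.exists_ne_degIn_le_one hs hd (by
      rw [card_insert_of_notMem hvS]
      have := card_pos.mpr (nonempty_iff_ne_empty.mpr hne)
      omega) v
    have hwA := (mem_insert.mp hw).resolve_left hwv
    have h2 := hc.2 w (mem_inter.mp hwA).1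
    have h3 : degIn m w S ≤ degIn m w (insert v (S ∩ A)) := by
      unfold degIn
      refine sum_le_sum_of_ne_zero fun x hx hx0 ↦ ?_
      obtain rfl | hx' := mem_insert.mp (hS hx)
      · simp
      · obtain hx' | hx' := mem_union.mp hx'
        · simp [hx, hx']
        · exact absurd (hz w (mem_inter.mp hwA).2 x hx') hx0
    omega
  intro S hS hc
  have h1 := key hA hvA hz S hS hc
  have h2 := key hB hvB (fun b hb a ha ↦ by rw [hs]; exact hz a ha b hb) S (by
    rwa [union_comm]) hc
  refine hA S (fun x hx ↦ ?_) hc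
  obtain rfl | hx' := mem_insert.mp (hS hx)
  · simp
  · obtain hx' | hx' := mem_union.mp hx'
    · have : x ∈ S ∩ A := by simp [hx, hx']
      simp [h1] at this
    · have : x ∈ S ∩ B := by simp [hx, hx']
      simp [h2] at this

lemma degIn_le_one_of_acyclic_insert (hs : ∀ v w, m v w = m w v) (hd : ∀ v, m v v = 0)
    (hv : v ∉ X) (ht : 2 * #X ≤ tot m X + 2) (h : Acyclic m (insert v X)) : degIn m v X ≤ 1 := by
  have := h.insert_bound hs hd hv
  omega

lemma not_acyclic_insert (hs : ∀ v w, m v w = m w v) (hd : ∀ v, m v v = 0)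
    (hv : v ∉ X) (ht : 2 * #X ≤ tot m X + 2) (h : 2 ≤ degIn m v X) : ¬ Acyclic m (insert v X) := by
  intro h'
  have := degIn_le_one_of_acyclic_insert hs hd hv ht h'
  omega

/-- If `v` is joined to a tree `F` by at most two edges, and `u` is the only further vertex, then
deleting `u` leaves at most one cycle, which then has to cover everything. -/
lemma Tame.of_degIn_le_two (h : Tame m V) (hu : u ∈ V) (hv : v ∉ F)
    (hF : V.erase u = insert v F) (hac : Acyclic m F) (hne : F.Nonempty) (h2 : degIn m v F ≤ 2) :
    IsForestPlusVertex m V ∨ IsMultiWheel m V := by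
  by_cases hH : Acyclic m (V.erase u)
  · exact Or.inl ⟨u, hu, hH⟩
  right
  obtain ⟨K, hK, hKc⟩ := not_acyclic_iff.mp hH
  have hs := h.symm
  have hd := h.diag
  have hT := tot_insert hs hv hd
  have hcard := card_insert_of_notMem hv
  rw [← hF] at hT hcard
  have h3 := hac.tot_add_two_le hs hd hne
  have hKtot : 2 * #K ≤ tot m K := by
    rw [mul_comm, ← smul_eq_mul]
    exact card_nsmul_le_sum _ _ _ hKc.2
  set W := V.erase u \ K with hW
  have huW : u ∉ W := by simp [hW]
  have huK : u ∉ K := fun hh ↦ by simpa using hK hh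
  have hdis : Disjoint W K := sdiff_disjoint
  have hWK : W ∪ K = V.erase u := sdiff_union_of_subset hK
  have hWV : W ⊆ V := sdiff_subset.trans (erase_subset _ _)
  have hKV : K ⊆ V := hK.trans (erase_subset _ _)
  have hW0 : W = ∅ := by
    by_contra hWne
    have hKu : ¬ Acyclic m K := not_acyclic_iff.mpr ⟨K, Subset.rfl, hKc⟩
    have hWu : Acyclic m (insert u W) := (h.acyclic_or (insert_subset hu hWV) hKV
      (by simp [disjoint_insert_left, huK, hdis])).resolve_right hKu
    have h4 := hWu.insert_bound hs hd huW
    have h5 := tot_union hs hdis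
    have h5c := card_union_of_disjoint hdis
    rw [hWK] at h5 h5c
    have h6 := three_mul_card_le (S := insert u K) hs (fun w hw ↦ h.three_le w (hWV hw)) (by
      intro w hw
      have hV : V = W ∪ insert u K := by
        rw [union_insert, hWK, insert_erase hu]
      conv_lhs => rw [hV]
      exact degIn_union (by simp [disjoint_insert_right, huW, hdis]))
    rw [sum_insert huK, sum_degIn_comm hs] at h6
    have := card_pos.mpr (nonempty_iff_ne_empty.mpr hWne)
    omega
  rw [hW0, empty_union] at hWK
  refine ⟨u, hu, ?_⟩
  have hle : tot m K ≤ 2 * #K := by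
    rw [hWK]; omega
  rw [← hWK]
  have h7 : ∑ v ∈ K, 2 = ∑ v ∈ K, degIn m v K := by
    simp only [sum_const, smul_eq_mul]
    unfold tot at hle hKtot
    omega
  intro w hw
  exact ((sum_eq_sum_iff_of_le hKc.2).mp h7 w hw).symm

/-- Deleting vertices of degree at most one from a tree leaves a tree. -/
lemma tot_sdiff_leaves (hs : ∀ v w, m v w = m w v) (hd : ∀ v, m v v = 0)
    (ht : 2 * #T ≤ tot m T + 2) {L : Finset α} (hLT : L ⊆ T) (hL : ∀ l ∈ L, degIn m l T ≤ 1) :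
    2 * #(T \ L) ≤ tot m (T \ L) + 2 := by
  induction L using Finset.induction_on with
  | empty => simpa using ht
  | insert l L hl ih =>
    have := ih ((subset_insert _ _).trans hLT) (fun x hx ↦ hL x (mem_insert_of_mem hx))
    have hlT : l ∈ T \ L := mem_sdiff.mpr ⟨hLT (mem_insert_self _ _), hl⟩
    have h1 : T \ insert l L = (T \ L).erase l := by
      ext; simp; tauto
    rw [h1]
    have h2 := tot_erase hs hd hlT
    have h3 := card_erase_of_mem hlT
    have h4 := degIn_mono (m := m) (v := l) (X := T \ L) (Y := T) sdiff_subset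
    have h5 := hL l (mem_insert_self _ _)
    omega

/-- The case of a leaf `l` of the tree `T` that is joined to `u` by a multiple edge. -/
lemma Tame.exists_center_of_double (h : Tame m V) (hu : u ∈ V) (hv : v ∈ V) (huv : u ≠ v)
    (hTV : T ⊆ V) (huT : u ∉ T) (hvT : v ∉ T)
    (hdeg : ∀ w ∈ T, degIn m w V = degIn m w T + m w u + m w v)
    (hac : Acyclic m T) (ht : 2 * #T ≤ tot m T + 2) (hcard : 2 ≤ #T)
    (h3v : 3 ≤ degIn m v T) {l : α} (hl : l ∈ T) (hl1 : degIn m l T ≤ 1) (hlu : 2 ≤ m l u) :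
    ∃ c ∈ T, ∀ w ∈ T.erase c, m w u = 1 ∧ m w v = 1 ∧ degIn m w T ≤ 1 := by
  have hs := h.symm
  have hd := h.diag
  have hlu' : l ≠ u := fun e ↦ huT (e ▸ hl)
  have hlv' : l ≠ v := fun e ↦ hvT (e ▸ hl)
  have htl := tot_erase hs hd hl
  have hcl := card_erase_of_mem hl
  have htl' : 2 * #(T.erase l) ≤ tot m (T.erase l) + 2 := by omega
  have key : ∀ a b, a ∈ V → b ∈ V → a ≠ b → a ∉ T → b ∉ T → 2 ≤ m l a →
      degIn m b (T.erase l) ≤ 1 := by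
    intro a b ha hb hab haT hbT hla
    have hla' : l ≠ a := fun e ↦ haT (e ▸ hl)
    have hlb' : l ≠ b := fun e ↦ hbT (e ▸ hl)
    refine degIn_le_one_of_acyclic_insert hs hd (fun hh ↦ hbT (mem_of_mem_erase hh)) htl' ?_
    refine (h.acyclic_or (X := {l, a}) (Y := insert b (T.erase l)) ?_ ?_ ?_).resolve_left ?_
    · simp [insert_subset_iff, ha, hTV hl]
    · exact insert_subset hb ((erase_subset _ _).trans hTV)
    · simp [disjoint_insert_right, hlb'.symm, hab.symm, haT]
    · exact not_acyclic_iff.mpr ⟨_, Subset.rfl, isCyc_pair hd hs hla' hla⟩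
  have hv1 := key u v hu hv huv huT hvT hlu
  have hvl := degIn_erase (m := m) (v := v) hl
  have hu1 := key v u hv hu huv.symm hvT huT (by rw [hs]; omega)
  obtain ⟨l', hl', hne, hl'1⟩ := hac.exists_ne_degIn_le_one hs hd hcard l
  have hl'e : l' ∈ T.erase l := mem_erase.mpr ⟨hne, hl'⟩
  have e1 := le_degIn (m := m) (v := u) hl'e
  have e2 := le_degIn (m := m) (v := v) hl'e
  rw [hs] at e1 e2
  have e3 := hdeg l' hl'
  have e4 := h.three_le l' (hTV hl')
  refine ⟨l, hl, fun w hw ↦ ?_⟩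
  obtain rfl | hwl' := eq_or_ne w l'
  · exact ⟨by omega, by omega, hl'1⟩
  -- any further vertex has all its edges in `T`, which gives `T` too many edges
  exfalso
  have hz : ∀ x ∈ (T.erase l).erase l', 3 ≤ degIn m x T := by
    intro x hx
    have hxe := mem_of_mem_erase hx
    have hxT := mem_of_mem_erase hxe
    have f3 := hdeg x hxT
    have f4 := h.three_le x (hTV hxT)
    have g : ∀ a, degIn m a (T.erase l) ≤ 1 → m l' a = 1 → m x a = 0 := by
      intro a ha hla
      have g1 := degIn_erase (m := m) (v := a) hl'e
      have g2 := le_degIn (m := m) (v := a) hx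
      rw [hs] at g2
      have g3 := hs l' a
      omega
    have := g u hu1 (by omega)
    have := g v hv1 (by omega)
    omega
  have hsum : 3 * #((T.erase l).erase l') ≤ ∑ x ∈ (T.erase l).erase l', degIn m x T := by
    rw [mul_comm, ← smul_eq_mul]
    exact card_nsmul_le_sum _ _ _ hz
  have q1 : tot m T = degIn m l T + (degIn m l' T + ∑ x ∈ (T.erase l).erase l', degIn m x T) := by
    rw [add_sum_erase _ (fun x ↦ degIn m x T) hl'e, add_sum_erase _ (fun x ↦ degIn m x T) hl]
    rfl
  have q2 := hac.degIn_pos hs hd hcard ht hl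
  have q3 := hac.degIn_pos hs hd hcard ht hl'
  have q4 := hac.tot_add_two_le hs hd ⟨l, hl⟩
  have q5 := card_erase_of_mem hl'e
  have q6 := card_pos.mpr ⟨w, mem_erase.mpr ⟨hwl', hw⟩⟩
  omega

/-- If the tree `T` is joined to each of `u` and `v` by at least three edges, and these are the
only other vertices, then `T` is a star whose leaves are joined to `u` and `v` once each. -/
lemma Tame.exists_center (h : Tame m V) (hu : u ∈ V) (hv : v ∈ V) (huv : u ≠ v)
    (hTV : T ⊆ V) (huT : u ∉ T) (hvT : v ∉ T)
    (hdeg : ∀ w ∈ T, degIn m w V = degIn m w T + m w u + m w v)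
    (hac : Acyclic m T) (ht : 2 * #T ≤ tot m T + 2) (hcard : 2 ≤ #T)
    (h3u : 3 ≤ degIn m u T) (h3v : 3 ≤ degIn m v T) :
    ∃ c ∈ T, ∀ w ∈ T.erase c, m w u = 1 ∧ m w v = 1 ∧ degIn m w T ≤ 1 := by
  have hs := h.symm
  have hd := h.diag
  by_cases hdbl : ∃ l ∈ T, degIn m l T ≤ 1 ∧ (2 ≤ m l u ∨ 2 ≤ m l v)
  · obtain ⟨l, hl, hl1, hl2 | hl2⟩ := hdbl
    · exact h.exists_center_of_double hu hv huv hTV huT hvT hdeg hac ht hcard h3v hl hl1 hl2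
    · obtain ⟨c, hc, H⟩ := h.exists_center_of_double hv hu huv.symm hTV hvT huT
        (fun w hw ↦ by rw [hdeg w hw]; omega) hac ht hcard h3u hl hl1 hl2
      exact ⟨c, hc, fun w hw ↦ ⟨(H w hw).2.1, (H w hw).1, (H w hw).2.2⟩⟩
  push Not at hdbl
  have hleaf : ∀ l ∈ T, degIn m l T ≤ 1 → m l u = 1 ∧ m l v = 1 := by
    intro l hl hl1
    have h1 := hdbl l hl hl1
    have h2 := hdeg l hl
    have h3 := h.three_le l (hTV hl)
    omega
  set L := T.filter (fun l ↦ degIn m l T ≤ 1) with hLdef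
  have hLT : L ⊆ T := filter_subset _ _
  have hL1 : ∀ l ∈ L, degIn m l T ≤ 1 := fun l hl ↦ (mem_filter.mp hl).2
  set T' := T \ L with hT'
  have hT'T : T' ⊆ T := sdiff_subset
  have hsplit : ∀ x, degIn m x T' + degIn m x L = degIn m x T := fun x ↦ degIn_sdiff_add hLT
  obtain hT'1 | hT'2 := Nat.lt_or_ge #T' 2
  · obtain hT'0 | ⟨c, hc⟩ := T'.eq_empty_or_nonempty
    · -- all vertices of `T` are leaves: then there are only two of them
      exfalso
      have hall : ∀ l ∈ T, degIn m l T ≤ 1 := by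
        intro l hl
        by_contra hcon
        have : l ∈ T' := by simp [hT', hLdef, hl]; omega
        simp [hT'0] at this
      have h1 : tot m T ≤ #T * 1 := by
        rw [← smul_eq_mul]; exact sum_le_card_nsmul _ _ _ hall
      have h2 : degIn m u T ≤ #T * 1 := by
        rw [← smul_eq_mul]
        refine sum_le_card_nsmul _ _ _ fun x hx ↦ ?_
        rw [hs]
        exact (hleaf x hx (hall x hx)).1.le
      omega
    · refine ⟨c, hT'T hc, fun w hw ↦ ?_⟩
      have hwT := mem_of_mem_erase hw
      have : degIn m w T ≤ 1 := by
        by_contra hcon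
        have : w ∈ T' := by simp [hT', hLdef, hwT]; omega
        exact ne_of_mem_erase hw (card_le_one.mp (by omega) w this c hc)
      exact ⟨(hleaf w hwT this).1, (hleaf w hwT this).2, this⟩
  exfalso
  have hT't : 2 * #T' ≤ tot m T' + 2 := tot_sdiff_leaves hs hd ht hLT hL1
  have hT'ac : Acyclic m T' := hac.mono hT'T
  obtain ⟨p, hp, -, hp1⟩ := hT'ac.exists_ne_degIn_le_one hs hd hT'2 u
  obtain ⟨q, hq, hqp, hq1⟩ := hT'ac.exists_ne_degIn_le_one hs hd hT'2 p
  -- a leaf `p` of `T'`, together with the leaves of `T` at `p`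
  have bunch : ∀ p ∈ T', degIn m p T' ≤ 1 → ∃ Lp ⊆ L, (∀ l ∈ Lp, m l p = 1) ∧
      2 * #(insert p Lp) ≤ tot m (insert p Lp) + 2 ∧
      2 * #(T \ insert p Lp) ≤ tot m (T \ insert p Lp) + 2 ∧
      (2 ≤ degIn m u (insert p Lp) ∨ 2 ≤ degIn m v (insert p Lp)) := by
    intro p hp hp1
    have hpT := hT'T hp
    have hpL : p ∉ L := (mem_sdiff.mp hp).2
    have hle : ∀ l ∈ L, m l p ≤ 1 := fun l hl ↦ (le_degIn hpT).trans (hL1 l hl)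
    set Lp := L.filter (fun l ↦ m l p = 1) with hLp
    have hLpL : Lp ⊆ L := filter_subset _ _
    have hpLp : p ∉ Lp := fun hh ↦ hpL (hLpL hh)
    have hone : ∀ l ∈ Lp, m l p = 1 := fun l hl ↦ (mem_filter.mp hl).2
    have c1 : degIn m p Lp = #Lp := by
      unfold degIn
      rw [card_eq_sum_ones]
      exact sum_congr rfl fun l hl ↦ by rw [hs]; exact hone l hl
    have c2 : degIn m p L = degIn m p Lp := by
      unfold degIn
      symm
      refine sum_subset hLpL fun x hx hx' ↦ ?_
      have := hle x hx
      have h0 : m x p ≠ 1 := fun h0 ↦ hx' (mem_filter.mpr ⟨hx, h0⟩)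
      rw [hs]; omega
    have c3 : degIn m u Lp = #Lp ∧ degIn m v Lp = #Lp := by
      unfold degIn
      rw [card_eq_sum_ones]
      have := fun l hl ↦ hleaf l (hLT (hLpL hl)) (hL1 l (hLpL hl))
      exact ⟨sum_congr rfl fun l hl ↦ by rw [hs]; exact (this l hl).1,
        sum_congr rfl fun l hl ↦ by rw [hs]; exact (this l hl).2⟩
    have c4 := hsplit p
    have c5 : 2 ≤ degIn m p T := by
      by_contra hcon
      exact hpL (mem_filter.mpr ⟨hpT, by omega⟩)
    have c6 := hdeg p hpT
    have c7 := h.three_le p (hTV hpT)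
    refine ⟨Lp, hLpL, hone, ?_, ?_, ?_⟩
    · rw [tot_insert hs hpLp hd, card_insert_of_notMem hpLp]
      omega
    · have d1 := tot_sdiff_leaves hs hd ht (hLpL.trans hLT) (fun l hl ↦ hL1 l (hLpL hl))
      have hpm : p ∈ T \ Lp := mem_sdiff.mpr ⟨hpT, hpLp⟩
      have d2 : T \ insert p Lp = (T \ Lp).erase p := by
        ext; simp; tauto
      rw [d2]
      have d3 := tot_erase hs hd hpm
      have d4 := card_erase_of_mem hpm
      have d5 := degIn_sdiff_add (m := m) (v := p) (hLpL.trans hLT)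
      omega
    · rw [degIn_insert hpLp, degIn_insert hpLp, c3.1, c3.2, hs u p, hs v p]
      omega
  obtain ⟨Lp, hLp, hLp1, hpt, hpc, hpd⟩ := bunch p hp hp1
  obtain ⟨Lq, hLq, hLq1, hqt, hqc, hqd⟩ := bunch q hq hq1
  have hpL : p ∉ L := (mem_sdiff.mp hp).2
  have hqL : q ∉ L := (mem_sdiff.mp hq).2
  set P := insert p Lp with hP
  set Q := insert q Lq with hQ
  have hPT : P ⊆ T := insert_subset (hT'T hp) (hLp.trans hLT)
  have hQT : Q ⊆ T \ P := by
    intro x hx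
    refine mem_sdiff.mpr ⟨insert_subset (hT'T hq) (hLq.trans hLT) hx, fun hxP ↦ ?_⟩
    obtain rfl | hx := mem_insert.mp hx
    · obtain rfl | hxP := mem_insert.mp hxP
      · exact hqp rfl
      · exact hqL (hLp hxP)
    · obtain rfl | hxP := mem_insert.mp hxP
      · exact hpL (hLq hx)
      · have h1 := hL1 x (hLp hxP)
        have h2 := degIn_erase (m := m) (v := x) (hT'T hp)
        have h3 := le_degIn (m := m) (v := x) (mem_erase.mpr ⟨hqp, hT'T hq⟩)
        rw [hLp1 x hxP] at h2
        rw [hLq1 x hx] at h3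
        omega
  have key : ∀ a b, a ∈ V → b ∈ V → a ≠ b → a ∉ T → b ∉ T → 2 ≤ degIn m a P →
      degIn m b (T \ P) ≤ 1 := by
    intro a b ha hb hab haT hbT h2
    refine degIn_le_one_of_acyclic_insert hs hd (fun hh ↦ hbT (sdiff_subset hh)) hpc ?_
    refine (h.acyclic_or (X := insert a P) (Y := insert b (T \ P)) ?_ ?_ ?_).resolve_left ?_
    · exact insert_subset ha (hPT.trans hTV)
    · exact insert_subset hb (sdiff_subset.trans hTV)
    · rw [disjoint_insert_left, disjoint_insert_right]
      refine ⟨?_, fun hh ↦ hbT (hPT hh), disjoint_sdiff⟩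
      simp [hab, haT]
    · exact not_acyclic_insert hs hd (fun hh ↦ haT (hPT hh)) hpt h2
  have hku := key u v hu hv huv huT hvT
  have hkv := key v u hv hu huv.symm hvT huT
  have su := degIn_sdiff_add (m := m) (v := u) hPT
  have sv := degIn_sdiff_add (m := m) (v := v) hPT
  have tu := degIn_mono (m := m) (v := u) hQT
  have tv := degIn_mono (m := m) (v := v) hQT
  by_cases hcu : 2 ≤ degIn m u P
  · have := hku hcu
    have := hkv (by omega)
    omega
  · have := hkv (by omega)
    have := hku (by omega)
    omega

/-- The structure of graphs of minimum degree at least `3` without two disjoint cycles, when all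
cycles pass through one of two vertices `u` and `v`. -/
theorem Tame.of_acyclic_sdiff_pair (h : Tame m V) (hu : u ∈ V) (hv : v ∈ V) (huv : u ≠ v)
    (hac : Acyclic m (V \ {u, v})) :
    IsForestPlusVertex m V ∨ IsMultiWheel m V ∨ IsThreeCone m V := by
  have hs := h.symm
  have hd := h.diag
  set F := V \ {u, v} with hF
  have huF : u ∉ F := by simp [hF]
  have hvF : v ∉ F := by simp [hF]
  have hFV : F ⊆ V := sdiff_subset
  have hVu : V.erase u = insert v F := by
    ext x; simp only [hF, mem_erase, mem_insert, mem_sdiff, mem_singleton]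
    constructor
    · tauto
    · rintro (rfl | hx)
      · exact ⟨huv.symm, hv⟩
      · tauto
  have hVv : V.erase v = insert u F := by
    ext x; simp only [hF, mem_erase, mem_insert, mem_sdiff, mem_singleton]
    constructor
    · tauto
    · rintro (rfl | hx)
      · exact ⟨huv, hu⟩
      · tauto
  have hpair : ({u, v} : Finset α) ⊆ V := by simp [insert_subset_iff, hu, hv]
  have hdegp : ∀ w, degIn m w {u, v} = m w u + m w v := fun w ↦ sum_pair huv
  have hdeg : ∀ w ∈ F, degIn m w V = degIn m w F + m w u + m w v := by
    intro w _
    rw [← degIn_sdiff_add hpair, hdegp, add_assoc]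
  obtain hF0 | hne := F.eq_empty_or_nonempty
  · refine Or.inl ⟨u, hu, ?_⟩
    rw [hVu]
    exact hac.insert_of_degIn_le_one (by simp [hF0, degIn, hd])
  obtain ht | ht := Nat.lt_or_ge (tot m F + 2) (2 * #F)
  · -- `F` is disconnected
    left
    obtain ⟨A, B, hA, hB, hAB, hU, hz⟩ := hac.exists_split hs hd hne ht
    have claim : ∀ A B : Finset α, A.Nonempty → Disjoint A B → A ∪ B = F →
        (∀ a ∈ A, ∀ b ∈ B, m a b = 0) →
        ¬ Acyclic m (insert u A) ∨ ¬ Acyclic m (insert v A) := by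
      intro A B hA hAB hU hz
      have hAF : A ⊆ F := hU ▸ subset_union_left
      by_contra! hcon
      have h1 := hcon.1.insert_bound hs hd (fun hh ↦ huF (hAF hh))
      have h2 := hcon.2.insert_bound hs hd (fun hh ↦ hvF (hAF hh))
      have h3 := (hac.mono hAF).tot_add_two_le hs hd hA
      have h4 := three_mul_card_le (S := {u, v}) hs (fun w hw ↦ h.three_le w (hFV (hAF hw))) (by
        intro w hw
        rw [hdeg w (hAF hw), ← hU, degIn_union hAB, hdegp]
        have : degIn m w B = 0 := sum_eq_zero fun b hb ↦ hz w hw b hb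
        omega)
      rw [sum_pair huv] at h4
      omega
    have cA := claim A B hA hAB hU hz
    have cB := claim B A hB hAB.symm (by rwa [union_comm]) (fun b hb a ha ↦ by
      rw [hs]; exact hz a ha b hb)
    have hAF : A ⊆ F := hU ▸ subset_union_left
    have hBF : B ⊆ F := hU ▸ subset_union_right
    have nb : ∀ {a b} {A B : Finset α}, a ∈ V → b ∈ V → a ∉ F → b ∉ F → a ≠ b → A ⊆ F → B ⊆ F →
        Disjoint A B → Acyclic m (insert a A) ∨ Acyclic m (insert b B) := by
      intro a b A B ha hb haF hbF hab hAF hBF hAB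
      refine h.acyclic_or (insert_subset ha (hAF.trans hFV)) (insert_subset hb (hBF.trans hFV)) ?_
      rw [disjoint_insert_left, disjoint_insert_right]
      refine ⟨?_, fun hh ↦ hbF (hAF hh), hAB⟩
      simp only [mem_insert, not_or]
      exact ⟨hab, fun hh ↦ haF (hBF hh)⟩
    have n1 := nb hu hv huF hvF huv hAF hBF hAB
    have n2 := nb hv hu hvF huF huv.symm hAF hBF hAB
    have : (Acyclic m (insert v A) ∧ Acyclic m (insert v B)) ∨
        (Acyclic m (insert u A) ∧ Acyclic m (insert u B)) := by tauto
    obtain ⟨a1, a2⟩ | ⟨a1, a2⟩ := this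
    · refine ⟨u, hu, ?_⟩
      rw [hVu, ← hU]
      exact a1.glue hs hd a2 (fun hh ↦ hvF (hAF hh)) (fun hh ↦ hvF (hBF hh)) hz
    · refine ⟨v, hv, ?_⟩
      rw [hVv, ← hU]
      exact a1.glue hs hd a2 (fun hh ↦ huF (hAF hh)) (fun hh ↦ huF (hBF hh)) hz
  by_cases hv2 : degIn m v F ≤ 2
  · have := h.of_degIn_le_two hu hvF hVu hac hne hv2
    tauto
  by_cases hu2 : degIn m u F ≤ 2
  · have := h.of_degIn_le_two hv huF hVv hac hne hu2
    tauto
  refine Or.inr (Or.inr ?_)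
  have hcen : ∃ c ∈ F, ∀ w ∈ F.erase c, m w u = 1 ∧ m w v = 1 ∧ degIn m w F ≤ 1 := by
    obtain hc1 | hc2 := Nat.lt_or_ge #F 2
    · obtain ⟨c, hc⟩ := hne
      refine ⟨c, hc, fun w hw ↦ ?_⟩
      exact absurd (card_le_one.mp (by omega) w (mem_of_mem_erase hw) c hc) (ne_of_mem_erase hw)
    · exact h.exists_center hu hv huv hFV huF hvF hdeg hac ht hc2 (by omega) (by omega)
  obtain ⟨c, hc, H⟩ := hcen
  have hcu : u ≠ c := fun e ↦ huF (e ▸ hc)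
  have hcv : v ≠ c := fun e ↦ hvF (e ▸ hc)
  have hrest : V \ {u, v, c} = F.erase c := by
    ext x; simp only [hF, mem_sdiff, mem_insert, mem_singleton, mem_erase]; tauto
  refine ⟨u, hu, v, hv, c, hFV hc, huv, hcu, hcv, ?_⟩
  rw [hrest]
  intro w hw
  obtain ⟨h1, h2, h3⟩ := H w hw
  have hwF := mem_of_mem_erase hw
  have hind : ∀ w' ∈ F.erase c, m w w' = 0 := by
    intro w' hw'
    by_contra h0
    have hw'F := mem_of_mem_erase hw'
    have hne' : w' ≠ w := fun e ↦ h0 (by rw [e, hd])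
    have e1 := (H w' hw').2.2
    have e2 := degIn_erase (m := m) (v := w') hwF
    have e3 := tot_erase hs hd hwF
    have e4 := card_erase_of_mem hwF
    have e5 : 1 < #(F.erase w) := one_lt_card.mpr ⟨c, mem_erase.mpr ⟨(ne_of_mem_erase hw).symm, hc⟩,
      w', mem_erase.mpr ⟨hne', hw'F⟩, (ne_of_mem_erase hw').symm⟩
    have e6 := (hac.mono (erase_subset w F)).degIn_pos hs hd e5 (by omega)
      (mem_erase.mpr ⟨hne', hw'F⟩)
    rw [hs] at h0
    omega
  refine ⟨h1, h2, ?_, hind⟩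
  have e1 := h.three_le w (hFV hwF)
  have e2 := hdeg w hwF
  have e3 := degIn_erase (m := m) (v := w) hc
  have e4 : degIn m w (F.erase c) = 0 := sum_eq_zero hind
  omega

end EdgeMult

/-! ### Graphs of minimum degree three without two disjoint cycles -/

namespace EdgeMult

open Finset

set_option linter.unusedSectionVars false

variable {α : Type*} [DecidableEq α]
variable {m : α → α → ℕ} {V X Y S T A B F : Finset α} {u v w a b c d : α}

lemma Tame.isCyc_self (h : Tame m V) (hV : V.Nonempty) : IsCyc m V :=
  ⟨hV, fun v hv ↦ by have := h.three_le v hv; omega⟩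

lemma isCyc_triangle (hs : ∀ v w, m v w = m w v) (hd : ∀ v, m v v = 0) (hab : 1 ≤ m a b)
    (hac : 1 ≤ m a c) (hbc : 1 ≤ m b c) : IsCyc m {a, b, c} ∧ #({a, b, c} : Finset α) = 3 := by
  have h1 : a ≠ b := by rintro rfl; simp [hd] at hab
  have h2 : a ≠ c := by rintro rfl; simp [hd] at hac
  have h3 : b ≠ c := by rintro rfl; simp [hd] at hbc
  refine ⟨⟨⟨a, by simp⟩, ?_⟩, by simp [h1, h2, h3]⟩
  have hdeg : ∀ x, degIn m x {a, b, c} = m x a + (m x b + m x c) := by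
    intro x
    simp [degIn, h1, h2, h3]
  have e1 := hs a b
  have e2 := hs a c
  have e3 := hs b c
  intro x hx
  simp only [mem_insert, mem_singleton] at hx
  rw [hdeg]
  obtain rfl | rfl | rfl := hx <;> omega

lemma isCyc_square (hs : ∀ v w, m v w = m w v) (hd : ∀ v, m v v = 0) (hab : 1 ≤ m a b)
    (hbc : 1 ≤ m b c) (hcd : 1 ≤ m c d) (hda : 1 ≤ m d a) (hac : a ≠ c) (hbd : b ≠ d) :
    IsCyc m {a, b, c, d} := by
  have h1 : a ≠ b := by rintro rfl; simp [hd] at hab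
  have h2 : a ≠ d := by rintro rfl; simp [hd] at hda
  have h3 : b ≠ c := by rintro rfl; simp [hd] at hbc
  have h4 : c ≠ d := by rintro rfl; simp [hd] at hcd
  refine ⟨⟨a, by simp⟩, ?_⟩
  have hdeg : ∀ x, degIn m x {a, b, c, d} = m x a + (m x b + (m x c + m x d)) := by
    intro x
    simp [degIn, h1, h2, h3, h4, hac, hbd]
  have e1 := hs a b
  have e2 := hs b c
  have e3 := hs c d
  have e4 := hs d a
  intro x hx
  simp only [mem_insert, mem_singleton] at hx
  rw [hdeg]
  obtain rfl | rfl | rfl | rfl := hx <;> omega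

/-- A vertex joined to an edgeless graph by simple edges gives a star. -/
lemma acyclic_insert_of_forall (hd : ∀ v, m v v = 0)
    (h : ∀ x ∈ X, degIn m x (insert c X) ≤ 1) : Acyclic m (insert c X) := by
  intro S hS hc
  by_cases hw : ∃ x ∈ S, x ≠ c
  · obtain ⟨x, hx, hxc⟩ := hw
    have h1 := h x ((mem_insert.mp (hS hx)).resolve_left hxc)
    have h2 := hc.2 x hx
    have h3 := degIn_mono (m := m) (v := x) hS
    omega
  · push Not at hw
    obtain ⟨x, hx⟩ := hc.1
    have h2 := hc.2 x hx
    have h3 : degIn m x S = 0 := sum_eq_zero fun y hy ↦ by rw [hw x hx, hw y hy, hd]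
    omega

/-- A tree to which each of `a`, `b`, `c` is joined and whose leaves are joined to all three is
a single edge: the graph is `K₅`. -/
lemma Tame.isKFive_of_triangle (h : Tame m V) (hle : ∀ x ∈ V, ∀ y ∈ V, m x y ≤ 1)
    (ha : a ∈ V) (hb : b ∈ V) (hc : c ∈ V)
    (hab : m a b = 1) (hac : m a c = 1) (hbc : m b c = 1) (hF : F = V \ {a, b, c})
    (hacF : Acyclic m F) (ht : 2 * #F ≤ tot m F + 2) (hcard : 2 ≤ #F)
    (hleaf : ∀ l ∈ F, degIn m l F ≤ 1 → m l a = 1 ∧ m l b = 1 ∧ m l c = 1) : IsKFive m V := by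
  have hs := h.symm
  have hd := h.diag
  have hFV : F ⊆ V := hF ▸ sdiff_subset
  have n1 : a ≠ b := by rintro rfl; simp [hd] at hab
  have n2 : a ≠ c := by rintro rfl; simp [hd] at hac
  have n3 : b ≠ c := by rintro rfl; simp [hd] at hbc
  have haF : a ∉ F := by simp [hF]
  have hbF : b ∉ F := by simp [hF]
  have hcF : c ∉ F := by simp [hF]
  have hsub : ({a, b, c} : Finset α) ⊆ V := by simp [insert_subset_iff, ha, hb, hc]
  have hdeg : ∀ w, degIn m w V = degIn m w F + (m w a + (m w b + m w c)) := by
    intro w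
    rw [← degIn_sdiff_add hsub, ← hF]
    simp [degIn, n1, n2, n3]
  obtain ⟨l, hl, -, hl1⟩ := hacF.exists_ne_degIn_le_one hs hd hcard a
  obtain ⟨l', hl', hne, hl'1⟩ := hacF.exists_ne_degIn_le_one hs hd hcard l
  have hl'e : l' ∈ F.erase l := mem_erase.mpr ⟨hne, hl'⟩
  have el := hleaf l hl hl1
  have el' := hleaf l' hl' hl'1
  have hte := tot_erase hs hd hl
  have hce := card_erase_of_mem hl
  have key : ∀ x y z, x ∈ V → y ∈ V → z ∈ V → x ∉ F → y ∉ F → z ∉ F → x ≠ y → x ≠ z →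
      m l y = 1 → m l z = 1 → m y z = 1 → degIn m x (F.erase l) ≤ 1 := by
    intro x y z hx hy hz hxF hyF hzF hxy hxz h1 h2 h3
    refine degIn_le_one_of_acyclic_insert hs hd (fun hh ↦ hxF (mem_of_mem_erase hh)) (by omega) ?_
    refine (h.acyclic_or (X := {l, y, z}) ?_ ?_ ?_).resolve_left ?_
    · simp [insert_subset_iff, hFV hl, hy, hz]
    · exact insert_subset hx ((erase_subset _ _).trans hFV)
    · have : x ≠ l := fun e ↦ hxF (e ▸ hl)
      simp [disjoint_insert_right, this, hxy, hxz, hyF, hzF]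
    · exact not_acyclic_iff.mpr ⟨_, Subset.rfl, (isCyc_triangle hs hd h1.ge h2.ge h3.ge).1⟩
  have ka := key a b c ha hb hc haF hbF hcF n1 n2 el.2.1 el.2.2 hbc
  have kb := key b a c hb ha hc hbF haF hcF n1.symm n3 el.1 el.2.2 hac
  have kc := key c a b hc ha hb hcF haF hbF n2.symm n3.symm el.1 el.2.1 hab
  have hz : ∀ x ∈ (F.erase l).erase l', 3 ≤ degIn m x F := by
    intro x hx
    have hxF := mem_of_mem_erase (mem_of_mem_erase hx)
    have g : ∀ y, degIn m y (F.erase l) ≤ 1 → m l' y = 1 → m x y = 0 := by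
      intro y hy hy'
      have g1 := degIn_erase (m := m) (v := y) hl'e
      have g2 := le_degIn (m := m) (v := y) hx
      rw [hs] at g2
      have g3 := hs l' y
      omega
    have := g a ka el'.1
    have := g b kb el'.2.1
    have := g c kc el'.2.2
    have := hdeg x
    have := h.three_le x (hFV hxF)
    omega
  have hsum : 3 * #((F.erase l).erase l') ≤ ∑ x ∈ (F.erase l).erase l', degIn m x F := by
    rw [mul_comm, ← smul_eq_mul]
    exact card_nsmul_le_sum _ _ _ hz
  have q1 : tot m F = degIn m l F + (degIn m l' F + ∑ x ∈ (F.erase l).erase l', degIn m x F) := by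
    rw [add_sum_erase _ (fun x ↦ degIn m x F) hl'e, add_sum_erase _ (fun x ↦ degIn m x F) hl]
    rfl
  have q2 := hacF.degIn_pos hs hd hcard ht hl
  have q3 := hacF.degIn_pos hs hd hcard ht hl'
  have q4 := hacF.tot_add_two_le hs hd ⟨l, hl⟩
  have q5 := card_erase_of_mem hl'e
  have hF2 : #F = 2 := by omega
  have hFe : F = {l, l'} := by
    symm
    apply eq_of_subset_of_card_le
    · simp [insert_subset_iff, hl, hl']
    · rw [hF2, card_pair hne.symm]
  have hll' : m l l' = 1 := by
    have h1 := hle l (hFV hl) l' (hFV hl')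
    have h2 : degIn m l F = m l l' := by simp [hFe, degIn, sum_pair hne.symm, hd]
    omega
  have hVe : V = {l, l', a, b, c} := by
    rw [← sdiff_union_of_subset hsub, ← hF, hFe]
    ext; simp; tauto
  refine ⟨?_, ?_⟩
  · have h3 : #({a, b, c} : Finset α) = 3 := by simp [n1, n2, n3]
    have := card_sdiff_add_card_eq_card hsub
    rw [← hF] at this
    omega
  · have e0 := hs l' l
    have e1 := hs a l
    have e2 := hs b l
    have e3 := hs c l
    have e4 := hs a l'
    have e5 := hs b l'
    have e6 := hs c l'
    have e7 := hs b a
    have e8 := hs c a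
    have e9 := hs c b
    obtain ⟨x1, x2, x3⟩ := el
    obtain ⟨x4, x5, x6⟩ := el'
    intro v hv w hw hvw
    rw [hVe] at hv hw
    simp only [mem_insert, mem_singleton] at hv hw
    obtain rfl | rfl | rfl | rfl | rfl := hv <;> obtain rfl | rfl | rfl | rfl | rfl := hw <;>
      first | exact absurd rfl hvw | omega

/-- The case in which a triangle is a shortest cycle. -/
lemma Tame.of_triangle (h : Tame m V) (hle : ∀ x ∈ V, ∀ y ∈ V, m x y ≤ 1)
    (ha : a ∈ V) (hb : b ∈ V) (hc : c ∈ V)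
    (hab : m a b = 1) (hac : m a c = 1) (hbc : m b c = 1) :
    IsForestPlusVertex m V ∨ IsMultiWheel m V ∨ IsThreeCone m V ∨ IsKFive m V := by
  have hs := h.symm
  have hd := h.diag
  obtain ⟨F, hF⟩ : ∃ F, F = V \ {a, b, c} := ⟨_, rfl⟩
  have hFV : F ⊆ V := hF ▸ sdiff_subset
  have n1 : a ≠ b := by rintro rfl; simp [hd] at hab
  have n2 : a ≠ c := by rintro rfl; simp [hd] at hac
  have n3 : b ≠ c := by rintro rfl; simp [hd] at hbc
  have haF : a ∉ F := by simp [hF]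
  have hbF : b ∉ F := by simp [hF]
  have hcF : c ∉ F := by simp [hF]
  have hsub : ({a, b, c} : Finset α) ⊆ V := by simp [insert_subset_iff, ha, hb, hc]
  have hdeg3 : ∀ w, degIn m w {a, b, c} = m w a + (m w b + m w c) := by
    intro w
    simp [degIn, n1, n2, n3]
  have hdeg : ∀ w, degIn m w V = degIn m w F + (m w a + (m w b + m w c)) := by
    intro w
    rw [← degIn_sdiff_add hsub, ← hF, hdeg3]
  have hacF : Acyclic m F := by
    refine (h.acyclic_or hsub hFV ?_).resolve_left
      (not_acyclic_iff.mpr ⟨_, Subset.rfl, (isCyc_triangle hs hd hab.ge hac.ge hbc.ge).1⟩)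
    rw [hF]; exact disjoint_sdiff
  have hle' : ∀ x ∈ V, ∀ A ⊆ V, degIn m x A ≤ #A := by
    intro x hx A hA
    have := sum_le_card_nsmul A (fun y ↦ m x y) 1 (fun y hy ↦ hle x hx y (hA hy))
    simpa [degIn] using this
  -- it is enough that `F` stays a forest when one vertex of the triangle is added
  have fin : ∀ x y z, x ∈ V → y ∈ V → z ∈ V → x ≠ y → x ≠ z → y ≠ z → F = V \ {x, y, z} →
      Acyclic m (insert z F) →
      IsForestPlusVertex m V ∨ IsMultiWheel m V ∨ IsThreeCone m V ∨ IsKFive m V := by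
    intro x y z hx hy hz hxy hxz hyz hF hacz
    have : V \ {x, y} = insert z F := by
      rw [hF]; ext t
      simp only [mem_sdiff, mem_insert, mem_singleton]
      constructor
      · tauto
      · rintro (rfl | ht)
        · exact ⟨hz, by simp [hxz.symm, hyz.symm]⟩
        · tauto
    rw [← this] at hacz
    have := h.of_acyclic_sdiff_pair hx hy hxy hacz
    tauto
  have fin0 : tot m F = 0 →
      IsForestPlusVertex m V ∨ IsMultiWheel m V ∨ IsThreeCone m V ∨ IsKFive m V := by
    intro h0
    refine fin a b c ha hb hc n1 n2 n3 hF (acyclic_insert_of_forall hd fun x hx ↦ ?_)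
    have h1 := hle x (hFV hx) c hc
    have h2 : degIn m x F = 0 := sum_eq_zero_iff.mp h0 x hx
    rw [degIn_insert hcF]
    omega
  obtain hF0 | hne := F.eq_empty_or_nonempty
  · exact fin0 (by simp [hF0, tot])
  obtain ht | ht := Nat.lt_or_ge (tot m F + 2) (2 * #F)
  · -- if `F` is disconnected, counting edges shows that it has none
    obtain ⟨A, B, hA, hB, hAB, hU, hz⟩ := hacF.exists_split hs hd hne ht
    have count : ∀ A B : Finset α, A.Nonempty → Disjoint A B → A ∪ B = F →
        (∀ a ∈ A, ∀ b ∈ B, m a b = 0) →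
        3 * #A ≤ tot m A + (degIn m a A + (degIn m b A + degIn m c A)) := by
      intro A B hA hAB hU hz
      have hAF : A ⊆ F := hU ▸ subset_union_left
      have h4 := three_mul_card_le (S := {a, b, c}) hs (fun w hw ↦ h.three_le w (hFV (hAF hw))) (by
        intro w hw
        rw [hdeg w, ← hU, degIn_union hAB, hdeg3]
        have : degIn m w B = 0 := sum_eq_zero fun b hb ↦ hz w hw b hb
        omega)
      simpa [n1, n2, n3] using h4
    have claim : ∀ A B : Finset α, A.Nonempty → B.Nonempty → Disjoint A B → A ∪ B = F →
        (∀ a ∈ A, ∀ b ∈ B, m a b = 0) → tot m A = 0 := by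
      intro A B hA hB hAB hU hz
      have hAF : A ⊆ F := hU ▸ subset_union_left
      have hBF : B ⊆ F := hU ▸ subset_union_right
      have cA := count A B hA hAB hU hz
      have cB := count B A hB hAB.symm (by rwa [union_comm]) (fun b hb a ha ↦ by
        rw [hs]; exact hz a ha b hb)
      have tB := (hacF.mono hBF).tot_add_two_le hs hd hB
      have part : ∀ x y z, x ∈ V → y ∈ V → z ∈ V → x ∉ F → y ∉ F → z ∉ F → x ≠ y → x ≠ z →
          y ≠ z → m y z = 1 →
          3 * #B ≤ tot m B + (degIn m x B + (degIn m y B + degIn m z B)) →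
          tot m A + 2 * degIn m x A ≤ 2 * #A := by
        intro x y z hx hy hz hxF hyF hzF hxy hxz hyz hm cB
        refine Acyclic.insert_bound hs hd (fun hh ↦ hxF (hAF hh)) ?_
        have hzB : z ∉ B := fun hh ↦ hzF (hBF hh)
        have hyB : y ∉ insert z B := by
          simp only [mem_insert, not_or]
          exact ⟨hyz, fun hh ↦ hyF (hBF hh)⟩
        refine (h.acyclic_or (X := insert x A) (Y := insert y (insert z B)) ?_ ?_ ?_).resolve_right
          fun hcon ↦ ?_
        · exact insert_subset hx (hAF.trans hFV)
        · exact insert_subset hy (insert_subset hz (hBF.trans hFV))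
        · have : x ∉ B := fun hh ↦ hxF (hBF hh)
          have : y ∉ A := fun hh ↦ hyF (hAF hh)
          have : z ∉ A := fun hh ↦ hzF (hAF hh)
          simp [disjoint_insert_left, disjoint_insert_right, *, hxy.symm, hxz.symm]
        · have e1 := hcon.insert_bound hs hd hyB
          rw [tot_insert hs hzB hd, degIn_insert hzB, card_insert_of_notMem hzB] at e1
          have e2 := hle' x hx B (hBF.trans hFV)
          omega
      have p1 := part a b c ha hb hc haF hbF hcF n1 n2 n3 hbc cB
      have p2 := part b a c hb ha hc hbF haF hcF n1.symm n3 n2 hac (by omega)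
      have p3 := part c a b hc ha hb hcF haF hbF n2.symm n3.symm n1 hab (by omega)
      omega
    refine fin0 ?_
    rw [← hU, tot_union hs hAB, claim A B hA hB hAB hU hz,
      claim B A hB hA hAB.symm (by rwa [union_comm]) (fun b hb a ha ↦ by
        rw [hs]; exact hz a ha b hb)]
    simp only [zero_add, mul_eq_zero, OfNat.ofNat_ne_zero, false_or]
    exact sum_eq_zero fun a ha ↦ sum_eq_zero fun b hb ↦ hz a ha b hb
  obtain hcard | hcard := Nat.lt_or_ge #F 2
  · refine fin0 ?_
    obtain ⟨x, hx⟩ := card_eq_one.mp (le_antisymm (by omega) (card_pos.mpr hne))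
    simp [hx, tot, degIn, hd]
  by_cases hleaf : ∀ l ∈ F, degIn m l F ≤ 1 → m l a = 1 ∧ m l b = 1 ∧ m l c = 1
  · exact Or.inr (Or.inr (Or.inr (h.isKFive_of_triangle hle ha hb hc hab hac hbc hF hacF ht hcard
      hleaf)))
  push Not at hleaf
  obtain ⟨l, hl, hl1, hl0⟩ := hleaf
  have hte := tot_erase hs hd hl
  have hce := card_erase_of_mem hl
  have main : ∀ x y z, x ∈ V → y ∈ V → z ∈ V → x ∉ F → y ∉ F → z ∉ F → x ≠ y → x ≠ z → y ≠ z →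
      F = V \ {x, y, z} → m x y = 1 → m l x = 1 → m l y = 1 → m l z = 0 →
      IsForestPlusVertex m V ∨ IsMultiWheel m V ∨ IsThreeCone m V ∨ IsKFive m V := by
    intro x y z hx hy hz hxF hyF hzF hxy hxz hyz hF hm h1 h2 h3
    refine fin x y z hx hy hz hxy hxz hyz hF (hacF.insert_of_degIn_le_one ?_)
    rw [degIn_insert hzF, hd, ← degIn_erase hl, hs z l, h3]
    refine (zero_add _).trans_le (degIn_le_one_of_acyclic_insert hs hd
      (fun hh ↦ hzF (mem_of_mem_erase hh)) (by omega) ?_)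
    refine (h.acyclic_or (X := {l, x, y}) ?_ ?_ ?_).resolve_left ?_
    · simp [insert_subset_iff, hFV hl, hx, hy]
    · exact insert_subset hz ((erase_subset _ _).trans hFV)
    · have : z ≠ l := fun e ↦ hzF (e ▸ hl)
      simp [disjoint_insert_right, this, hxz.symm, hyz.symm, hxF, hyF]
    · exact not_acyclic_iff.mpr ⟨_, Subset.rfl, (isCyc_triangle hs hd h1.ge h2.ge hm.ge).1⟩
  have b1 := hle l (hFV hl) a ha
  have b2 := hle l (hFV hl) b hb
  have b3 := hle l (hFV hl) c hc
  have b4 := h.three_le l (hFV hl)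
  have b5 := hdeg l
  obtain h0 | h0 | h0 : m l a = 0 ∨ m l b = 0 ∨ m l c = 0 := by
    by_contra! hcon
    exact hl0 (by omega) (by omega) (by omega)
  · refine main b c a hb hc ha hbF hcF haF n3 n1.symm n2.symm ?_ hbc (by omega) (by omega) h0
    rw [hF, insert_comm, Finset.pair_comm a c]
  · refine main a c b ha hc hb haF hcF hbF n2 n1 n3.symm ?_ hac (by omega) (by omega) h0
    rw [hF, Finset.pair_comm b c]
  · exact main a b c ha hb hc haF hbF hcF n1 n2 n3 hF hab (by omega) (by omega) h0

/-- The case in which a cycle `a, b, c, d` of length `4` is a shortest one, where moreover `w` is a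
leaf of the rest of the graph. -/
lemma Tame.of_square (h : Tame m V) (hle : ∀ x ∈ V, ∀ y ∈ V, m x y ≤ 1)
    (htri : ∀ x ∈ V, ∀ y ∈ V, ∀ z ∈ V, 1 ≤ m x y → 1 ≤ m x z → 1 ≤ m y z → False)
    (ha : a ∈ V) (hb : b ∈ V) (hc : c ∈ V) (hd' : d ∈ V)
    (hab : m a b = 1) (hbc : m b c = 1) (hcd : m c d = 1) (hda : m d a = 1)
    (hac : a ≠ c) (hbd : b ≠ d) (hbd0 : m b d = 0)
    (hF : F = V \ {a, b, c, d}) (hw : w ∈ F) (hw1 : degIn m w F ≤ 1)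
    (hwa : m w a = 1) (hwc : m w c = 1) :
    IsForestPlusVertex m V ∨ IsMultiWheel m V ∨ IsThreeCone m V := by
  have hs := h.symm
  have hd := h.diag
  have hFV : F ⊆ V := hF ▸ sdiff_subset
  have n1 : a ≠ b := by rintro rfl; simp [hd] at hab
  have n2 : b ≠ c := by rintro rfl; simp [hd] at hbc
  have n3 : c ≠ d := by rintro rfl; simp [hd] at hcd
  have n4 : a ≠ d := by rintro rfl; simp [hd] at hda
  have haF : a ∉ F := by simp [hF]
  have hbF : b ∉ F := by simp [hF]
  have hcF : c ∉ F := by simp [hF]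
  have hdF : d ∉ F := by simp [hF]
  have hsub : ({a, b, c, d} : Finset α) ⊆ V := by simp [insert_subset_iff, ha, hb, hc, hd']
  have hdeg4 : ∀ w, degIn m w {a, b, c, d} = m w a + (m w b + (m w c + m w d)) := by
    intro w
    simp [degIn, n1, n2, n3, n4, hac, hbd]
  have hdeg : ∀ w, degIn m w V = degIn m w F + (m w a + (m w b + (m w c + m w d))) := by
    intro w
    rw [← degIn_sdiff_add hsub, ← hF, hdeg4]
  have hacF : Acyclic m F := by
    refine (h.acyclic_or hsub hFV ?_).resolve_left
      (not_acyclic_iff.mpr ⟨_, Subset.rfl, isCyc_square hs hd hab.ge hbc.ge hcd.ge hda.ge hac hbd⟩)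
    rw [hF]; exact disjoint_sdiff
  -- as there is no triangle, two adjacent vertices have no common neighbour
  have hadj : ∀ x ∈ V, ∀ y ∈ V, m x y = 1 → ∀ A ⊆ V, degIn m x A + degIn m y A ≤ #A := by
    intro x hx y hy hxy A hA
    have := sum_le_card_nsmul A (fun z ↦ m x z + m y z) 1 (fun z hz ↦ by
      by_contra hcon
      have h1 := hle x hx z (hA hz)
      have h2 := hle y hy z (hA hz)
      exact htri x hx y hy z (hA hz) hxy.ge (by omega) (by omega))
    simpa [degIn, sum_add_distrib] using this
  have hne : F.Nonempty := ⟨w, hw⟩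
  obtain ht | ht := Nat.lt_or_ge (tot m F + 2) (2 * #F)
  · exfalso
    obtain ⟨A, B, hA, hB, hAB, hU, hz⟩ := hacF.exists_split hs hd hne ht
    have hAF : A ⊆ F := hU ▸ subset_union_left
    have hBF : B ⊆ F := hU ▸ subset_union_right
    have count : ∀ A B : Finset α, Disjoint A B → A ∪ B = F →
        (∀ a ∈ A, ∀ b ∈ B, m a b = 0) →
        3 * #A ≤ tot m A + (degIn m a A + (degIn m b A + (degIn m c A + degIn m d A))) := by
      intro A B hAB hU hz
      have hAF : A ⊆ F := hU ▸ subset_union_left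
      have h4 := three_mul_card_le (S := {a, b, c, d}) hs
        (fun w hw ↦ h.three_le w (hFV (hAF hw))) (by
          intro w hw
          rw [hdeg w, ← hU, degIn_union hAB, hdeg4]
          have : degIn m w B = 0 := sum_eq_zero fun b hb ↦ hz w hw b hb
          omega)
      simpa [n1, n2, n3, n4, hac, hbd] using h4
    have cA := count A B hAB hU hz
    have cB := count B A hAB.symm (by rwa [union_comm]) (fun b hb a ha ↦ by
      rw [hs]; exact hz a ha b hb)
    have tB := (hacF.mono hBF).tot_add_two_le hs hd hB
    have pairb : ∀ {x y} {A : Finset α}, x ∉ F → y ∉ F → x ≠ y → m x y = 1 → A ⊆ F →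
        Acyclic m (insert x (insert y A)) → tot m A + 2 * (degIn m x A + degIn m y A) ≤ 2 * #A := by
      intro x y A hxF hyF hxy hm hAF hacy
      have hyA : y ∉ A := fun hh ↦ hyF (hAF hh)
      have hxA : x ∉ insert y A := by
        simp only [mem_insert, not_or]
        exact ⟨hxy, fun hh ↦ hxF (hAF hh)⟩
      have e1 := hacy.insert_bound hs hd hxA
      rw [tot_insert hs hyA hd, degIn_insert hyA, card_insert_of_notMem hyA] at e1
      omega
    have part : ∀ x y z t, x ∈ V → y ∈ V → z ∈ V → t ∈ V → x ∉ F → y ∉ F → z ∉ F → t ∉ F →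
        x ≠ y → x ≠ z → x ≠ t → y ≠ z → y ≠ t → z ≠ t → m x y = 1 → m z t = 1 →
        3 * #B ≤ tot m B + (degIn m x B + (degIn m y B + (degIn m z B + degIn m t B))) →
        tot m A + 2 * (degIn m x A + degIn m y A) ≤ 2 * #A := by
      intro x y z t hx hy hz ht hxF hyF hzF htF hxy hxz hxt hyz hyt hzt hm hm' cB
      refine pairb hxF hyF hxy hm hAF ?_
      refine (h.acyclic_or (X := insert x (insert y A)) (Y := insert z (insert t B))
        ?_ ?_ ?_).resolve_right fun hcon ↦ ?_
      · exact insert_subset hx (insert_subset hy (hAF.trans hFV))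
      · exact insert_subset hz (insert_subset ht (hBF.trans hFV))
      · have : x ∉ B := fun hh ↦ hxF (hBF hh)
        have : y ∉ B := fun hh ↦ hyF (hBF hh)
        have : z ∉ A := fun hh ↦ hzF (hAF hh)
        have : t ∉ A := fun hh ↦ htF (hAF hh)
        simp [disjoint_insert_left, disjoint_insert_right, *, hxz.symm, hxt.symm, hyz.symm,
          hyt.symm]
      · have e1 := pairb hzF htF hzt hm' hBF hcon
        have e2 := hadj x hx y hy hm B (hBF.trans hFV)
        omega
    have p1 := part a b c d ha hb hc hd' haF hbF hcF hdF n1 hac n4 n2 hbd n3 hab hcd cB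
    have p2 := part c d a b hc hd' ha hb hcF hdF haF hbF n3 hac.symm n2.symm n4.symm hbd.symm n1
      hcd hab (by omega)
    have := card_pos.mpr hA
    omega
  · -- `F` is a tree, joined to each of `b` and `d` by at most one edge
    have hte := tot_erase hs hd hw
    have hce := card_erase_of_mem hw
    have key : ∀ x y, x ∈ V → y ∈ V → x ∉ F → y ∉ F → x ≠ y → x ≠ a → x ≠ c → m a x = 1 →
        m a y = 1 → m y c = 1 → degIn m x F ≤ 1 := by
      intro x y hx hy hxF hyF hxy hxa hxc hax hay hyc
      have hwx : m w x = 0 := by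
        by_contra hcon
        exact htri w (hFV hw) a ha x hx hwa.ge (by omega) hax.ge
      rw [← degIn_erase hw, hs x w, hwx]
      refine degIn_le_one_of_acyclic_insert hs hd
        (fun hh ↦ hxF (mem_of_mem_erase hh)) (by omega) ?_
      have hwy : w ≠ y := fun e ↦ hyF (e ▸ hw)
      have hwx' : x ≠ w := fun e ↦ hxF (e ▸ hw)
      refine (h.acyclic_or (X := {w, a, y, c}) ?_ ?_ ?_).resolve_left ?_
      · simp [insert_subset_iff, hFV hw, ha, hy, hc]
      · exact insert_subset hx ((erase_subset _ _).trans hFV)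
      · simp [disjoint_insert_right, hwx', hxy, hxa, hxc, haF, hyF, hcF]
      · exact not_acyclic_iff.mpr ⟨_, Subset.rfl,
          isCyc_square hs hd hwa.ge hay.ge hyc.ge (by rw [hs]; exact hwc.ge) hwy hac⟩
    have kb := key b d hb hd' hbF hdF hbd n1.symm n2 hab (by rw [hs]; exact hda)
      (by rw [hs]; exact hcd)
    have kd := key d b hd' hb hdF hbF hbd.symm n4.symm n3.symm (by rw [hs]; exact hda) hab hbc
    have hac1 : Acyclic m (insert b F) :=
      hacF.insert_of_degIn_le_one (by rw [degIn_insert hbF, hd]; omega)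
    have hdb : d ∉ insert b F := by simp [hbd.symm, hdF]
    have hac2 : Acyclic m (insert d (insert b F)) :=
      hac1.insert_of_degIn_le_one (by
        rw [degIn_insert hdb, degIn_insert hbF, hd, hs, hbd0]; omega)
    refine h.of_acyclic_sdiff_pair ha hc hac (hac2.mono fun x hx ↦ ?_)
    simp only [mem_sdiff, mem_insert, mem_singleton, hF] at hx ⊢
    tauto

/-- Multigraphs of minimum degree at least `3` without two disjoint cycles (Lovász): some vertex
meets all cycles, or the graph is a wheel with multiple spokes, or a `K_{3,n}` with additional edges
on the small side, or `K₅`. -/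
theorem Tame.classification (h : Tame m V) (hV : V.Nonempty) :
    IsForestPlusVertex m V ∨ IsMultiWheel m V ∨ IsThreeCone m V ∨ IsKFive m V := by
  classical
  have hs := h.symm
  have hd := h.diag
  obtain ⟨S, hS, hmin⟩ := exists_min_image (V.powerset.filter (IsCyc m)) card
    ⟨V, by simp [h.isCyc_self hV]⟩
  simp only [mem_filter, mem_powerset, and_imp] at hS hmin
  obtain ⟨hSV, hSc⟩ := hS
  have hdis : Disjoint S (V \ S) := disjoint_sdiff
  have hacF : Acyclic m (V \ S) := (h.acyclic_or hSV sdiff_subset hdis).resolve_left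
    (not_acyclic_iff.mpr ⟨S, Subset.rfl, hSc⟩)
  have hS2 : 2 ≤ #S := by
    obtain ⟨s, hs'⟩ := hSc.1
    by_contra hcon
    have : S = {s} := eq_singleton_iff_unique_mem.mpr
      ⟨hs', fun x hx ↦ card_le_one.mp (by omega) x hx s hs'⟩
    have h2 := hSc.2 s hs'
    rw [this] at h2
    simp [degIn, hd] at h2
  obtain hS2' | hS3 := hS2.eq_or_lt
  · obtain ⟨u, v, huv, rfl⟩ := card_eq_two.mp hS2'.symm
    have := h.of_acyclic_sdiff_pair (hSV (by simp)) (hSV (by simp)) huv hacF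
    tauto
  have hle : ∀ x ∈ V, ∀ y ∈ V, m x y ≤ 1 := by
    intro x hx y hy
    by_contra hcon
    have hxy : x ≠ y := by rintro rfl; simp [hd] at hcon
    have := hmin {x, y} (by simp [insert_subset_iff, hx, hy]) (isCyc_pair hd hs hxy (by omega))
    rw [card_pair hxy] at this
    omega
  -- a shortest cycle has no chords
  have hdeg2 : ∀ s ∈ S, degIn m s S = 2 := by
    have hE : ∀ s ∈ S, Acyclic m (S.erase s) := by
      intro s hs' T hT hTc
      have h1 := hmin T ((hT.trans (erase_subset _ _)).trans hSV) hTc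
      have h2 := card_le_card hT
      have h3 := card_erase_of_mem hs'
      have := card_pos.mpr ⟨s, hs'⟩
      omega
    obtain ⟨s, hs'⟩ := hSc.1
    obtain ⟨t, ht, ht1⟩ := (hE s hs').exists_degIn_le_one
      (card_pos.mp (by rw [card_erase_of_mem hs']; omega))
    have htS := mem_of_mem_erase ht
    have e1 := degIn_erase (m := m) (v := t) hs'
    have e2 := hle t (hSV htS) s (hSV hs')
    have e3 := (hE t htS).tot_add_two_le hs hd
      (card_pos.mp (by rw [card_erase_of_mem htS]; omega))
    have e4 := tot_erase hs hd htS
    have e5 := card_erase_of_mem htS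
    have e6 : ∑ v ∈ S, 2 ≤ ∑ v ∈ S, degIn m v S := sum_le_sum hSc.2
    have e7 : ∑ v ∈ S, 2 = ∑ v ∈ S, degIn m v S := by
      simp only [sum_const, smul_eq_mul] at e6 ⊢
      unfold tot at e3 e4
      omega
    exact fun x hx ↦ ((sum_eq_sum_iff_of_le hSc.2).mp e7 x hx).symm
  have htot : tot m S = 2 * #S := by
    unfold tot
    rw [sum_congr rfl hdeg2]; simp [mul_comm]
  obtain hS3' | hS4 := (show 3 ≤ #S from hS3).eq_or_lt
  · obtain ⟨a, b, c, hab, hac, hbc, rfl⟩ := card_eq_three.mp hS3'.symm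
    have ha : a ∈ V := hSV (by simp)
    have hb : b ∈ V := hSV (by simp)
    have hc : c ∈ V := hSV (by simp)
    have e1 := hdeg2 a (by simp)
    have e2 := hdeg2 b (by simp)
    simp only [degIn, sum_insert (show a ∉ ({b, c} : Finset α) by simp [hab, hac]),
      sum_pair hbc, hd] at e1 e2
    have f1 := hle a ha b hb
    have f2 := hle a ha c hc
    have f3 := hle b hb c hc
    have f4 := hs a b
    exact h.of_triangle hle ha hb hc (by omega) (by omega) (by omega)
  have htri : ∀ x ∈ V, ∀ y ∈ V, ∀ z ∈ V, 1 ≤ m x y → 1 ≤ m x z → 1 ≤ m y z → False := by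
    intro x hx y hy z hz h1 h2 h3
    obtain ⟨hc, hc3⟩ := isCyc_triangle hs hd h1 h2 h3
    have := hmin _ (by simp [insert_subset_iff, hx, hy, hz]) hc
    omega
  have hFne : (V \ S).Nonempty := by
    rw [nonempty_iff_ne_empty]
    intro h0
    have : V ⊆ S := sdiff_eq_empty_iff_subset.mp h0
    obtain ⟨s, hs'⟩ := hSc.1
    have h1 := hdeg2 s hs'
    rw [subset_antisymm hSV this] at h1
    have := h.three_le s (hSV hs')
    omega
  obtain ⟨w, hw, hw1⟩ := hacF.exists_degIn_le_one hFne
  have hwV : w ∈ V := sdiff_subset hw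
  have hwS : w ∉ S := (mem_sdiff.mp hw).2
  have hwS2 : 2 ≤ degIn m w S := by
    have h1 := degIn_sdiff_add (m := m) (v := w) hSV
    have h2 := h.three_le w hwV
    omega
  -- replacing a vertex `t` of `S` by `w` gives enough edges for a cycle, which is then as short
  -- as `S`; so the neighbours of `t` are neighbours of `w`
  have exch : ∀ t ∈ S, 2 + m w t ≤ degIn m w S → ∀ x ∈ S, x ≠ t → m x t ≤ m x w := by
    intro t ht hwt x hx hxt
    have hwe : w ∉ S.erase t := fun hh ↦ hwS (mem_of_mem_erase hh)
    have c1 := card_insert_of_notMem hwe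
    have c2 := card_erase_of_mem ht
    have e1 := tot_insert hs hwe hd
    have e2 := tot_erase hs hd ht
    have e3 := degIn_erase (m := m) (v := w) ht
    have e4 := hdeg2 t ht
    obtain ⟨C, hC, hCc⟩ := exists_isCyc_of_card_le hs hd (insert_nonempty w (S.erase t)) (by omega)
    have hCV : insert w (S.erase t) ⊆ V := insert_subset hwV ((erase_subset _ _).trans hSV)
    have hCe : C = insert w (S.erase t) := by
      refine eq_of_subset_of_card_le hC ?_
      have := hmin C (hC.trans hCV) hCc
      omega
    have h5 := hCc.2 x (by rw [hCe]; simp [hx, hxt])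
    rw [hCe, degIn_insert hwe] at h5
    have h6 := degIn_erase (m := m) (v := x) ht
    have h7 := hdeg2 x hx
    omega
  have hwdeg : degIn m w S = 2 := by
    by_contra hcon
    obtain ⟨s, hs'⟩ := hSc.1
    have hall : ∀ x ∈ S, m x w = 1 ∧ ∃ t ∈ S, m x t = 1 := by
      intro x hx
      have h1 := hdeg2 x hx
      obtain ⟨t, ht, ht0⟩ := exists_ne_zero_of_sum_ne_zero (show ∑ t ∈ S, m x t ≠ 0 by
        unfold degIn at h1; omega)
      have hxt : x ≠ t := by rintro rfl; exact ht0 (hd x)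
      have h2 := exch t ht (by have := hle w hwV t (hSV ht); omega) x hx hxt
      have h3 := hle x (hSV hx) w hwV
      have h4 := hle x (hSV hx) t (hSV ht)
      exact ⟨by omega, t, ht, by omega⟩
    obtain ⟨h1, t, ht, h2⟩ := hall s hs'
    exact htri s (hSV hs') t (hSV ht) w hwV h2.ge h1.ge (hall t ht).1.ge
  set N := S.filter (fun x ↦ m w x = 1) with hN
  have hN2 : #N = 2 := by
    rw [hN, card_filter, ← hwdeg, degIn]
    refine sum_congr rfl fun x hx ↦ ?_
    have := hle w hwV x (hSV hx)
    split_ifs <;> omega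
  obtain ⟨a, c, hac, hNe⟩ := card_eq_two.mp hN2
  have haN : a ∈ N := by simp [hNe]
  have hcN : c ∈ N := by simp [hNe]
  have haS := (mem_filter.mp haN).1
  have hcS := (mem_filter.mp hcN).1
  have hNS : N ⊆ S := filter_subset _ _
  have hacS : ∀ x, degIn m x S = degIn m x (S \ N) + (m x a + m x c) := by
    intro x
    rw [← degIn_sdiff_add hNS]
    congr 1
    rw [hNe, degIn, sum_pair hac]
  have htN : ∀ t ∈ S \ N, m t a = 1 ∧ m t c = 1 := by
    intro t ht
    obtain ⟨htS, htN⟩ := mem_sdiff.mp ht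
    have hwt : m w t = 0 := by
      have h1 : m w t ≠ 1 := fun h1 ↦ htN (mem_filter.mpr ⟨htS, h1⟩)
      have := hle w hwV t (hSV htS)
      omega
    have h1 := hacS t
    have h2 : degIn m t (S \ N) = 0 := by
      refine sum_eq_zero fun x hx ↦ ?_
      obtain ⟨hxS, hxN⟩ := mem_sdiff.mp hx
      obtain rfl | hxt := eq_or_ne x t
      · exact hd x
      · have h3 := exch t htS (by omega) x hxS hxt
        have h4 : m w x ≠ 1 := fun h1 ↦ hxN (mem_filter.mpr ⟨hxS, h1⟩)
        have h5 := hle w hwV x (hSV hxS)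
        rw [hs x w] at h3
        rw [hs]
        omega
    have h6 := hdeg2 t htS
    have h7 := hle t (hSV htS) a (hSV haS)
    have h8 := hle t (hSV htS) c (hSV hcS)
    omega
  have hcardN := card_sdiff_add_card_eq_card hNS
  have hST : degIn m a (S \ N) = #(S \ N) := by
    unfold degIn
    rw [card_eq_sum_ones]
    exact sum_congr rfl fun t ht ↦ by rw [hs]; exact (htN t ht).1
  have ha2 := hdeg2 a haS
  have haac := hacS a
  obtain ⟨b, d, hbd, hbde⟩ := card_eq_two.mp (show #(S \ N) = 2 by omega)
  have hbm : b ∈ S \ N := by simp [hbde]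
  have hdm : d ∈ S \ N := by simp [hbde]
  have hbS := sdiff_subset hbm
  have hdS := sdiff_subset hdm
  have hbd0 : m b d = 0 := by
    have h1 := hacS b
    have h2 := hdeg2 b hbS
    have h3 := htN b hbm
    have h4 := le_degIn (m := m) (v := b) hdm
    omega
  have hSe : S = {a, b, c, d} := by
    rw [← sdiff_union_of_subset hNS, hbde, hNe]
    ext; simp; tauto
  have hwa := (mem_filter.mp haN).2
  have hwc := (mem_filter.mp hcN).2
  have := h.of_square (a := a) (b := b) (c := c) (d := d) (F := V \ S) (w := w) hle htri (hSV haS)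
    (hSV hbS) (hSV hcS) (hSV hdS) (by rw [hs]; exact (htN b hbm).1) (htN b hbm).2
    (by rw [hs]; exact (htN d hdm).2) (htN d hdm).1 hac hbd hbd0 (by rw [hSe]) hw hw1 hwa hwc
  tauto

end EdgeMult

/-! ### Solutions of the incidence relations in a group -/

namespace Graph

universe u v w

variable {α : Type u} {β : Type v} {K : Type w} [Group K]

/-- A family `x` of elements of a group satisfies the relations of the incidence group of `G`.
The values of `x` outside of `E(G)` play no role. -/
structure IsSol (G : Graph α β) (x : β → K) : Prop where
  sq : ∀ e ∈ E(G), x e * x e = 1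
  comm : ∀ v e f, G.Inc e v → G.Inc f v → Commute (x e) (x f)
  prod : ∀ v ∈ V(G), ∀ l : List β, l.Nodup → (∀ e, e ∈ l ↔ G.Inc e v) → (l.map x).prod = 1

/-- In every group (of a fixed universe), solutions of the relations of `G` are commutative. -/
def CommSols (G : Graph α β) : Prop :=
  ∀ (K : Type w) [Group K] (x : β → K), G.IsSol x → ∀ e ∈ E(G), ∀ f ∈ E(G), Commute (x e) (x f)

lemma commute_of_mem_closure {s : Set K} (h : ∀ a ∈ s, ∀ b ∈ s, Commute a b) {a b : K}
    (ha : a ∈ Subgroup.closure s) (hb : b ∈ Subgroup.closure s) : Commute a b := by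
  have h1 : Subgroup.closure s ≤ Subgroup.centralizer s := by
    rw [Subgroup.closure_le]
    intro c hc
    exact Subgroup.mem_centralizer_iff.mpr fun d hd ↦ h d hd c hc
  have h2 : Subgroup.closure s ≤ Subgroup.centralizer (Subgroup.closure s : Set K) := by
    rw [Subgroup.closure_le]
    intro c hc
    exact Subgroup.mem_centralizer_iff.mpr fun d hd ↦
      (Subgroup.mem_centralizer_iff.mp (h1 hd) c hc).symm
  exact (Subgroup.mem_centralizer_iff.mp (h2 ha) b hb).symm

lemma commSols_of_commutative {G : Graph α β} (h : ∀ a b : G.IncidenceGroup, a * b = b * a) :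
    CommSols.{u, v, w} G := by
  intro K _ x hx e he f hf
  let φ : G.IncidenceGroup →* K := PresentedGroup.toGroup (f := fun e : E(G) ↦ x e) (by
    rintro r (hr : IncidenceRelator G r)
    cases hr with
    | sq e => simpa [pow_two] using hx.sq e e.2
    | comm v hv e e' he he' =>
      have := hx.comm v e e' he he'
      simp only [map_mul, map_inv, FreeGroup.lift_apply_of]
      rw [this.eq]; group
    | prod v hv l hl hlv =>
      rw [map_list_prod, List.map_map]
      have h1 : (⇑(FreeGroup.lift fun e : E(G) ↦ x e)) ∘ FreeGroup.of = x ∘ Subtype.val := by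
        ext e; simp
      rw [h1, ← List.map_map]
      refine hx.prod v hv _ (hl.map Subtype.val_injective) fun e ↦ ?_
      simp only [List.mem_map, Subtype.exists, exists_and_right, exists_eq_right]
      exact ⟨fun ⟨he, h⟩ ↦ (hlv _).mp h, fun h ↦ ⟨h.edge_mem, (hlv ⟨e, h.edge_mem⟩).mpr h⟩⟩)
  have := congrArg φ (h (PresentedGroup.of ⟨e, he⟩) (PresentedGroup.of ⟨f, hf⟩))
  simpa [φ, Commute, SemiconjBy] using this

open Classical in
lemma CommSols.commutative {G : Graph α β} (h : CommSols.{u, v, v} G) (a b : G.IncidenceGroup) :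
    a * b = b * a := by
  let x : β → G.IncidenceGroup := fun e ↦ if he : e ∈ E(G) then PresentedGroup.of ⟨e, he⟩ else 1
  have hxe : ∀ (e : E(G)), x e = PresentedGroup.of e := fun e ↦ by simp [x]
  have hof : ∀ e : E(G), PresentedGroup.of (rels := {r | IncidenceRelator G r}) e =
    PresentedGroup.mk _ (FreeGroup.of e) := fun e ↦ rfl
  have hx : G.IsSol x := by
    refine ⟨fun e he ↦ ?_, fun v e f he hf ↦ ?_, fun v hv l hl hlv ↦ ?_⟩
    · have h1 : PresentedGroup.mk {r | IncidenceRelator G r} (FreeGroup.of ⟨e, he⟩ ^ 2) = 1 :=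
        PresentedGroup.one_of_mem (IncidenceRelator.sq ⟨e, he⟩)
      rw [hxe ⟨e, he⟩, hof, ← map_mul, ← pow_two, h1]
    · have h1 := PresentedGroup.one_of_mem (rels := {r | IncidenceRelator G r})
        (IncidenceRelator.comm v he.vertex_mem ⟨e, he.edge_mem⟩ ⟨f, hf.edge_mem⟩ he hf)
      rw [hxe ⟨e, he.edge_mem⟩, hxe ⟨f, hf.edge_mem⟩, hof, hof]
      simp only [map_mul, map_inv] at h1
      rw [mul_inv_eq_one, mul_inv_eq_iff_eq_mul] at h1
      exact h1
    · have hmem : ∀ e ∈ l, e ∈ E(G) := fun e he ↦ ((hlv e).mp he).edge_mem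
      have h1 := PresentedGroup.one_of_mem (rels := {r | IncidenceRelator G r})
        (IncidenceRelator.prod v hv (l.attachWith (· ∈ E(G)) hmem) (by
          rw [← List.nodup_map_iff Subtype.val_injective]
          simpa using hl) (by
          intro e
          rw [List.mem_attachWith]
          exact hlv e))
      rw [map_list_prod, List.map_map] at h1
      rw [← h1]
      congr 1
      conv_lhs => rw [← List.attachWith_map_subtype_val hmem, List.map_map]
      refine List.map_congr_left fun e _ ↦ ?_
      exact hxe e
  refine (commute_of_mem_closure (s := Set.range (PresentedGroup.of (rels := _))) ?_ ?_ ?_).eq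
  · rintro _ ⟨e, rfl⟩ _ ⟨f, rfl⟩
    rw [← hxe, ← hxe]
    exact h _ x hx e e.2 f f.2
  · rw [PresentedGroup.closure_range_of]; trivial
  · rw [PresentedGroup.closure_range_of]; trivial

lemma exists_enum {ι : Type*} {s : Set ι} (hs : s.Finite) :
    ∃ l : List ι, l.Nodup ∧ ∀ e, e ∈ l ↔ e ∈ s :=
  ⟨hs.toFinset.toList, Finset.nodup_toList _, by simp⟩

/-- Products of commuting elements do not depend on the enumeration. -/
lemma map_prod_eq_of_forall_mem_iff {ι : Type*} {x : ι → K} {l l' : List ι} (hl : l.Nodup)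
    (hl' : l'.Nodup) (h : ∀ e, e ∈ l ↔ e ∈ l') (hc : ∀ e ∈ l, ∀ f ∈ l, Commute (x e) (x f)) :
    (l.map x).prod = (l'.map x).prod := by
  have hp : l.Perm l' := (List.perm_ext_iff_of_nodup hl hl').mpr h
  refine (hp.map x).prod_eq' ?_
  rw [List.pairwise_map]
  exact List.Pairwise.imp_of_mem (fun {a b} ha hb _ ↦ hc a ha b hb) (List.pairwise_of_forall
    (R := fun _ _ ↦ True) (fun _ _ ↦ trivial))

variable {G : Graph α β} {x : β → K}

lemma finite_setOf_inc (hE : E(G).Finite) (v : α) : {e | G.Inc e v}.Finite :=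
  hE.subset fun _ he ↦ he.edge_mem

/-- To satisfy the product relation at `v` it is enough to satisfy it for one enumeration of the
edges at `v`. -/
lemma prod_eq_one_of_enum {y : β → K} {v : α}
    (hc : ∀ e f, G.Inc e v → G.Inc f v → Commute (y e) (y f))
    {l : List β} (hl : l.Nodup) (hlv : ∀ e, e ∈ l ↔ G.Inc e v) (h : (l.map y).prod = 1)
    {l' : List β} (hl' : l'.Nodup) (hlv' : ∀ e, e ∈ l' ↔ G.Inc e v) : (l'.map y).prod = 1 := by
  rw [← h]
  refine map_prod_eq_of_forall_mem_iff hl' hl (fun e ↦ (hlv' e).trans (hlv e).symm) ?_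
  exact fun e he f hf ↦ hc e f ((hlv' e).mp he) ((hlv' f).mp hf)

lemma IsSol.mem_of_forall_ne (hx : G.IsSol x) (hE : E(G).Finite) {v : α} {e : β}
    (he : G.Inc e v) {U : Subgroup K} (h : ∀ f, G.Inc f v → f ≠ e → x f ∈ U) : x e ∈ U := by
  obtain ⟨l, hl, hlv⟩ := exists_enum ((finite_setOf_inc hE v).sdiff (t := {e}))
  have h1 := hx.prod v he.vertex_mem (e :: l) (by simp [hl, hlv]) (by
    intro f
    simp only [List.mem_cons, hlv, Set.mem_sdiff, Set.mem_ofPred_eq, Set.mem_singleton_iff]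
    by_cases hf : f = e
    · simp [hf, he]
    · simp [hf])
  rw [List.map_cons, List.prod_cons, mul_eq_one_iff_eq_inv] at h1
  rw [h1]
  refine U.inv_mem (U.list_prod_mem fun y hy ↦ ?_)
  obtain ⟨f, hf, rfl⟩ := List.mem_map.mp hy
  have := (hlv f).mp hf
  exact h f this.1 this.2

lemma IsSol.mul_mem_of_forall_ne (hx : G.IsSol x) (hE : E(G).Finite) {v : α} {e f : β}
    (he : G.Inc e v) (hf : G.Inc f v) (hef : e ≠ f) {U : Subgroup K}
    (h : ∀ g, G.Inc g v → g ≠ e → g ≠ f → x g ∈ U) : x e * x f ∈ U := by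
  obtain ⟨l, hl, hlv⟩ := exists_enum ((finite_setOf_inc hE v).sdiff (t := {e, f}))
  have h1 := hx.prod v he.vertex_mem (e :: f :: l) (by simp [hl, hlv, hef]) (by
    intro g
    simp only [List.mem_cons, hlv, Set.mem_sdiff, Set.mem_ofPred_eq, Set.mem_singleton_iff,
      Set.mem_insert_iff]
    by_cases hg : g = e
    · simp [hg, he]
    · by_cases hg' : g = f
      · simp [hg', hf]
      · simp [hg, hg'])
  rw [List.map_cons, List.prod_cons, List.map_cons, List.prod_cons, ← mul_assoc,
    mul_eq_one_iff_eq_inv] at h1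
  rw [h1]
  refine U.inv_mem (U.list_prod_mem fun y hy ↦ ?_)
  obtain ⟨g, hg, rfl⟩ := List.mem_map.mp hy
  have := (hlv g).mp hg
  simp only [Set.mem_sdiff, Set.mem_ofPred_eq, Set.mem_insert_iff, Set.mem_singleton_iff,
    not_or] at this
  exact h g this.1 this.2.1 this.2.2

/-! ### The incidence relations of `K_{3,3}` and `K₅` -/

/-- The relations of `K_{3,3}`, with central corrections coming from edges on one side, force
commutativity. The three corrections multiply to `1`; with corrections multiplying to a nontrivial
central element one would get the magic square instead. -/
lemma commute_of_three_rows {P₁ P₂ P₃ Q₁ Q₂ Q₃ p q r : K}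
    (hp : p * p = 1) (hq : q * q = 1) (hr : r * r = 1)
    (hP₃ : P₃ * P₃ = 1) (hQ₃ : Q₃ * Q₃ = 1)
    (hp' : ∀ y ∈ [P₁, P₂, P₃, Q₁, Q₂, Q₃, q, r], Commute p y)
    (hq' : ∀ y ∈ [P₁, P₂, P₃, Q₁, Q₂, Q₃, r], Commute q y)
    (hr' : ∀ y ∈ [P₁, P₂, P₃, Q₁, Q₂, Q₃], Commute r y) (hPQ : Commute P₃ Q₃)
    (h1 : p * q * (P₁ * P₂ * P₃) = 1) (h2 : p * r * (Q₁ * Q₂ * Q₃) = 1)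
    (h3 : q * r * (P₁ * Q₁ * (P₂ * Q₂) * (P₃ * Q₃)) = 1) : Commute P₂ Q₁ := by
  simp only [List.mem_cons, List.not_mem_nil, or_false, forall_eq_or_imp, forall_eq] at hp' hq' hr'
  obtain ⟨a1, a2, a3, a4, a5, a6, a7, a8⟩ := hp'
  obtain ⟨b1, b2, b3, b4, b5, b6, b7⟩ := hq'
  obtain ⟨c1, c2, c3, c4, c5, c6⟩ := hr'
  have e1 : P₁ * P₂ = p * q * P₃ := by
    have h : P₁ * P₂ * P₃ = p * q := by
      rw [← mul_right_inj (p * q), h1, mul_assoc, ← mul_assoc q, ← a7.eq, mul_assoc, hq, mul_one,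
        hp]
    rw [← h, mul_assoc _ P₃, hP₃, mul_one]
  have e2 : Q₁ * Q₂ = p * r * Q₃ := by
    have h : Q₁ * Q₂ * Q₃ = p * r := by
      rw [← mul_right_inj (p * r), h2, mul_assoc, ← mul_assoc r, ← a8.eq, mul_assoc, hr, mul_one,
        hp]
    rw [← h, mul_assoc _ Q₃, hQ₃, mul_one]
  have e3 : P₁ * Q₁ * (P₂ * Q₂) = q * r * (P₃ * Q₃) := by
    have h : P₁ * Q₁ * (P₂ * Q₂) * (P₃ * Q₃) = q * r := by
      rw [← mul_right_inj (q * r), h3, mul_assoc, ← mul_assoc r, ← b7.eq, mul_assoc, hr, mul_one,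
        hq]
    have h' : P₃ * Q₃ * (P₃ * Q₃) = 1 := by
      rw [mul_assoc, ← mul_assoc Q₃, ← hPQ.eq, mul_assoc, hQ₃, mul_one, hP₃]
    rw [← h, mul_assoc _ (P₃ * Q₃), h', mul_one]
  have e4 : P₁ * P₂ * (Q₁ * Q₂) = q * r * (P₃ * Q₃) := by
    rw [e1, e2]
    have : p * q * P₃ * (p * r * Q₃) = p * p * (q * r * (P₃ * Q₃)) := by
      have : q * P₃ * (p * r) = p * (q * r) * P₃ := by
        calc q * P₃ * (p * r) = q * (P₃ * p) * r := by group
          _ = q * (p * P₃) * r := by rw [a3.eq]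
          _ = (q * p) * (P₃ * r) := by group
          _ = (p * q) * (r * P₃) := by rw [a7.eq, c3.eq]
          _ = p * (q * r) * P₃ := by group
      calc p * q * P₃ * (p * r * Q₃) = p * (q * P₃ * (p * r)) * Q₃ := by group
        _ = p * (p * (q * r) * P₃) * Q₃ := by rw [this]
        _ = _ := by group
    rw [this, hp, one_mul]
  have e5 : P₁ * (Q₁ * P₂) * Q₂ = P₁ * (P₂ * Q₁) * Q₂ := by
    simpa only [mul_assoc] using e3.trans e4.symm
  exact (mul_left_cancel (mul_right_cancel e5)).symm

/-- The relations of `K₅` force commutativity. Here `a`, `b` belong to two disjoint edges `12`, `34`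
and `c`, `d`, `e`, `f` to the edges `13`, `14`, `23`, `24`; the edges at the vertex `5` are
eliminated. -/
lemma commute_of_pentagram {a b c d e f : K} (ha : a * a = 1) (hb : b * b = 1) (hc : c * c = 1)
    (hd : d * d = 1) (he : e * e = 1) (hf : f * f = 1)
    (ha' : ∀ y ∈ [c, d, e, f], Commute a y) (hb' : ∀ y ∈ [c, d, e, f], Commute b y)
    (hcd : Commute c d) (hce : Commute c e) (hdf : Commute d f) (hef : Commute e f)
    (h14 : Commute (a * c * d) (b * d * f)) (h23 : Commute (a * e * f) (b * c * e))
    (h13 : Commute (a * c * d) (b * c * e))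
    (h5 : a * c * d * (a * e * f) * (b * c * e * (b * d * f)) = 1) : Commute a b := by
  simp only [List.mem_cons, List.not_mem_nil, or_false, forall_eq_or_imp, forall_eq] at ha' hb'
  obtain ⟨a1, a2, a3, a4⟩ := ha'
  obtain ⟨b1, b2, b3, b4⟩ := hb'
  have i {y z : K} (h : y * y = 1) : y * (y * z) = z := by rw [← mul_assoc, h, one_mul]
  have k {y z t : K} (h : Commute y z) : y * (z * t) = z * (y * t) := h.left_comm t
  -- `J` is the commutator of `a` and `b`
  have f1 : a * b * (c * f) = b * a * (f * c) := by
    have l1 : a * c * d * (b * d * f) = a * b * (c * f) := by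
      calc a * c * d * (b * d * f) = a * (c * (d * (b * (d * f)))) := by group
        _ = a * (c * (b * (d * (d * f)))) := by rw [k b2.symm]
        _ = a * (b * (c * f)) := by rw [i hd, k b1.symm]
        _ = _ := by group
    have l2 : b * d * f * (a * c * d) = b * a * (f * c) := by
      calc b * d * f * (a * c * d) = b * (d * (f * (a * (c * d)))) := by group
        _ = b * (d * (f * (a * (d * c)))) := by rw [hcd.eq]
        _ = b * (d * (f * (d * (a * c)))) := by rw [k a2]
        _ = b * (d * (d * (f * (a * c)))) := by rw [k hdf.symm]
        _ = b * (a * (f * c)) := by rw [i hd, k a4.symm]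
        _ = _ := by group
    rw [← l1, ← l2, h14.eq]
  have f2 : a * b * (f * c) = b * a * (c * f) := by
    have l1 : a * e * f * (b * c * e) = a * b * (f * c) := by
      calc a * e * f * (b * c * e) = a * (e * (f * (b * (c * e)))) := by group
        _ = a * (e * (f * (b * (e * c)))) := by rw [hce.eq]
        _ = a * (e * (f * (e * (b * c)))) := by rw [k b3]
        _ = a * (e * (e * (f * (b * c)))) := by rw [k hef.symm]
        _ = a * (b * (f * c)) := by rw [i he, k b4.symm]
        _ = _ := by group
    have l2 : b * c * e * (a * e * f) = b * a * (c * f) := by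
      calc b * c * e * (a * e * f) = b * (c * (e * (a * (e * f)))) := by group
        _ = b * (c * (a * (e * (e * f)))) := by rw [k a3.symm]
        _ = b * (a * (c * f)) := by rw [i he, k a1.symm]
        _ = _ := by group
    rw [← l1, ← l2, h23.eq]
  have f3 : a * b * (d * e) = b * a * (e * d) := by
    have l1 : a * c * d * (b * c * e) = a * b * (d * e) := by
      calc a * c * d * (b * c * e) = a * (c * (d * (b * (c * e)))) := by group
        _ = a * (c * (d * (c * (b * e)))) := by rw [k b1]
        _ = a * (c * (c * (d * (b * e)))) := by rw [k hcd.symm]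
        _ = a * (b * (d * e)) := by rw [i hc, k b2.symm]
        _ = _ := by group
    have l2 : b * c * e * (a * c * d) = b * a * (e * d) := by
      calc b * c * e * (a * c * d) = b * (c * (e * (a * (c * d)))) := by group
        _ = b * (c * (e * (c * (a * d)))) := by rw [k a1]
        _ = b * (c * (c * (e * (a * d)))) := by rw [k hce.symm]
        _ = b * (a * (e * d)) := by rw [i hc, k a3.symm]
        _ = _ := by group
    rw [← l1, ← l2, h13.eq]
  obtain ⟨J, hJ⟩ : ∃ J, J = b * a * (a * b)⁻¹ := ⟨_, rfl⟩
  have hJab : b * a = J * (a * b) := by rw [hJ]; group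
  have hinv : (a * b)⁻¹ = b * a := by
    rw [mul_inv_rev, inv_eq_of_mul_eq_one_right ha, inv_eq_of_mul_eq_one_right hb]
  have hJ' : J = b * a * (b * a) := by rw [hJ, hinv]
  have hcomm : ∀ y, Commute a y → Commute b y → Commute J y := by
    intro y h1 h2
    rw [hJ']
    exact (h2.mul_left h1).mul_left (h2.mul_left h1)
  have Jc := hcomm c a1 b1
  have Jd := hcomm d a2 b2
  have Je := hcomm e a3 b3
  have Jf := hcomm f a4 b4
  have push {y z y' z' : K} (h : a * b * (y' * z') = b * a * (y * z)) : y' * z' = J * (y * z) := by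
    have : a * b * (y' * z') = a * b * (J * (y * z)) := by
      have hJab' : J * (a * b) = a * b * J := by
        have h3 : a * b * J = b * a := by
          rw [hJ', ← hinv]; group
        rw [h3, hJab]
      rw [h, hJab, hJab']; group
    exact mul_left_cancel this
  have g1 : c * f = J * (f * c) := push f1
  have g2 : f * c = J * (c * f) := push f2
  have g3 : d * e = J * (e * d) := push f3
  have hJJ : J * J = 1 := by
    have : f * c = J * J * (f * c) := by
      calc f * c = J * (c * f) := g2
        _ = J * (J * (f * c)) := by rw [← g1]
        _ = _ := by group
    exact mul_eq_right.mp this.symm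
  have l5 : c * d * (e * f) * (c * e * (d * f)) = 1 := by
    rw [← h5]
    have l1 : a * c * d * (a * e * f) = c * d * (e * f) := by
      calc a * c * d * (a * e * f) = a * (c * (d * (a * (e * f)))) := by group
        _ = c * (d * (e * f)) := by rw [k a2.symm, k a1.symm, i ha]
        _ = _ := by group
    have l2 : b * c * e * (b * d * f) = c * e * (d * f) := by
      calc b * c * e * (b * d * f) = b * (c * (e * (b * (d * f)))) := by group
        _ = c * (e * (d * f)) := by rw [k b3.symm, k b1.symm, i hb]
        _ = _ := by group
    rw [l1, l2]
  have l6 : c * d * (e * f) * (c * e * (d * f)) = J := by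
    calc c * d * (e * f) * (c * e * (d * f)) = c * (d * e) * f * (c * e * (d * f)) := by group
      _ = c * (J * (e * d)) * f * (c * e * (d * f)) := by rw [← g3]
      _ = (c * J) * (e * (d * (f * (c * (e * (d * f)))))) := by group
      _ = (J * c) * (e * (d * (f * (c * (e * (d * f)))))) := by rw [Jc.eq]
      _ = J * (c * (e * (d * (f * (c * (e * (d * f))))))) := by group
      _ = J * (c * (e * (d * (f * (e * (c * (f * d))))))) := by
        rw [show c * (e * (d * f)) = e * (c * (f * d)) by rw [k hce, hdf.eq]]
      _ = J * (c * (e * (d * (f * (e * (c * f * d)))))) := by group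
      _ = J * (c * (e * (d * (f * (e * (J * (f * c) * d)))))) := by rw [← g1]
      _ = J * (c * (e * (d * (f * (e * (J * (f * (c * d)))))))) := by group
      _ = J * (J * (c * (e * (d * (f * (e * (f * (c * d)))))))) := by
        rw [k Je.symm, k Jf.symm, k Jd.symm, k Je.symm, k Jc.symm]
      _ = J * (J * (c * (e * (d * (e * (c * d)))))) := by rw [k hef, i hf]
      _ = J * (J * (c * (e * (d * e) * (c * d)))) := by group
      _ = J * (J * (c * (e * (J * (e * d)) * (c * d)))) := by rw [← g3]
      _ = J * (J * (c * (e * (J * (e * (d * (c * d))))))) := by group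
      _ = J * (J * (J * (c * (e * (e * (d * (c * d))))))) := by rw [k Je.symm, k Jc.symm]
      _ = J := by rw [i he, k hcd.symm, i hc, hd, mul_one, hJJ, mul_one]
  have hJ1 : J = 1 := l6.symm.trans l5
  rw [hJ1, one_mul] at hJab
  exact hJab.symm

end Graph

/-! ### Edge multiplicities; commutativity for forests with an apex and for wheels -/

namespace Graph

universe u v w

open EdgeMult Finset

variable {α : Type u} {β : Type v} {K : Type w} [Group K]

/-- The number of edges between two vertices. -/
noncomputable def mult (G : Graph α β) (v w : α) : ℕ := {e | G.IsLink e v w}.ncard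

variable {G : Graph α β} {x : β → K} {v w : α}

lemma mult_comm (G : Graph α β) (v w : α) : G.mult v w = G.mult w v := by
  simp only [mult, isLink_comm]

lemma mult_self (G : Graph α β) [G.Loopless] (v : α) : G.mult v v = 0 := by
  simp [mult]

lemma finite_isLink (hE : E(G).Finite) (v w : α) : {e | G.IsLink e v w}.Finite :=
  hE.subset fun _ he ↦ IsLink.edge_mem he

lemma finite_setOf_isLink (hE : E(G).Finite) (v : α) (X : Finset α) :
    {e | ∃ w ∈ X, G.IsLink e v w}.Finite :=
  hE.subset fun _ ⟨_, _, he⟩ ↦ he.edge_mem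

lemma degIn_mult [DecidableEq α] (hE : E(G).Finite) (v : α) (X : Finset α) :
    degIn G.mult v X = {e | ∃ w ∈ X, G.IsLink e v w}.ncard := by
  induction X using Finset.induction_on with
  | empty => simp [degIn]
  | insert w X hw ih =>
    rw [degIn_insert hw, ih, mult, ← Set.ncard_union_eq ?_ (finite_isLink hE v w)
      (finite_setOf_isLink hE v X)]
    · congr 1
      ext e
      simp
    · rw [Set.disjoint_left]
      rintro e he ⟨w', hw', he'⟩
      exact hw (IsLink.right_unique he he' ▸ hw')

lemma mult_eq_zero_iff (hE : E(G).Finite) : G.mult v w = 0 ↔ ∀ e, ¬ G.IsLink e v w := by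
  rw [mult, Set.ncard_eq_zero (finite_isLink hE v w)]
  simp [Set.eq_empty_iff_forall_notMem]

lemma mult_eq_one_iff : G.mult v w = 1 ↔ ∃ e, ∀ f, G.IsLink f v w ↔ f = e := by
  rw [mult, Set.ncard_eq_one]
  simp [Set.ext_iff]

lemma degIn_mult_vertexSet [DecidableEq α] (hV : V(G).Finite) (hE : E(G).Finite) (v : α) :
    degIn G.mult v hV.toFinset = {e | G.Inc e v}.ncard := by
  rw [degIn_mult hE]
  congr 1
  ext e
  simp only [Set.Finite.mem_toFinset, Set.mem_ofPred_eq]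
  exact ⟨fun ⟨w, _, h⟩ ↦ ⟨w, h⟩, fun ⟨w, h⟩ ↦ ⟨w, h.right_mem, h⟩⟩

/-- If all cycles pass through `u`, then the edges at `u` generate the incidence group. -/
theorem IsSol.commute_of_isForestPlusVertex [DecidableEq α] [G.Loopless] (hV : V(G).Finite)
    (hE : E(G).Finite) (hx : G.IsSol x) (h : IsForestPlusVertex G.mult hV.toFinset) :
    ∀ e ∈ E(G), ∀ f ∈ E(G), Commute (x e) (x f) := by
  obtain ⟨u, hu, hac⟩ := h
  set H := hV.toFinset.erase u with hH
  set U := Subgroup.closure (x '' {e | G.Inc e u}) with hU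
  have hmemU : ∀ e, G.Inc e u → x e ∈ U := fun e he ↦
    Subgroup.subset_closure (Set.mem_image_of_mem _ he)
  have hHmem : ∀ w, w ∈ H ↔ w ∈ V(G) ∧ w ≠ u := by intro w; simp [hH, and_comm]
  have peel : ∀ W ⊆ H, (∀ h ∈ H \ W, ∀ e, G.Inc e h → x e ∈ U) →
      ∀ h ∈ H, ∀ e, G.Inc e h → x e ∈ U := by
    intro W
    induction W using Finset.strongInduction with
    | H W ih =>
      intro hWH hW
      obtain rfl | hne := W.eq_empty_or_nonempty
      · simpa using hW
      obtain ⟨w, hw, hw1⟩ := (hac.mono hWH).exists_degIn_le_one hne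
      refine ih (W.erase w) (erase_ssubset hw) ((erase_subset _ _).trans hWH) fun h hh ↦ ?_
      by_cases hhW : h ∈ W
      · have hhw : h = w := by
          by_contra hne'
          exact (mem_sdiff.mp hh).2 (mem_erase.mpr ⟨hne', hhW⟩)
        subst hhw
        rw [degIn_mult hE, Set.ncard_le_one (finite_setOf_isLink hE _ _)] at hw1
        -- all edges at `h`, with at most one exception, are known to lie in `U`
        have hother : ∀ e, G.Inc e h → (∃ w ∈ W, G.IsLink e h w) ∨ x e ∈ U := by
          rintro e ⟨w, he⟩
          by_cases hwu : w = u
          · exact Or.inr (hmemU e (hwu ▸ he.inc_right))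
          by_cases hwW : w ∈ W
          · exact Or.inl ⟨w, hwW, he⟩
          · exact Or.inr (hW w (mem_sdiff.mpr ⟨(hHmem w).mpr ⟨he.right_mem, hwu⟩, hwW⟩) e
              he.inc_right)
        intro e he
        obtain he' | he' := hother e he
        · refine hx.mem_of_forall_ne hE he fun f hf hfe ↦ ?_
          exact (hother f hf).resolve_left fun hf' ↦ hfe (hw1 f hf' e he')
        · exact he'
      · exact hW h (mem_sdiff.mpr ⟨(mem_sdiff.mp hh).1, hhW⟩)
  have hall : ∀ e ∈ E(G), x e ∈ U := by
    intro e he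
    obtain ⟨v, w, hvw⟩ := exists_isLink_of_mem_edgeSet he
    by_cases hvu : v = u
    · exact hmemU e (hvu ▸ hvw.inc_left)
    · exact peel H Subset.rfl (by simp) v ((hHmem v).mpr ⟨hvw.left_mem, hvu⟩) e hvw.inc_left
  intro e he f hf
  refine commute_of_mem_closure ?_ (hall e he) (hall f hf)
  rintro _ ⟨a, ha, rfl⟩ _ ⟨b, hb, rfl⟩
  exact hx.comm u a b ha hb

/-- In a wheel with hub `u`, consecutive rim edges differ by a product of spokes; so each rim edge
commutes with all spokes. -/
theorem IsSol.commute_of_isMultiWheel [DecidableEq α] [G.Loopless] (hV : V(G).Finite)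
    (hE : E(G).Finite) (hx : G.IsSol x) (ht : Tame G.mult hV.toFinset)
    (h : IsMultiWheel G.mult hV.toFinset) :
    ∀ e ∈ E(G), ∀ f ∈ E(G), Commute (x e) (x f) := by
  obtain ⟨u, hu, hreg⟩ := h
  set H := hV.toFinset.erase u with hH
  set U := Subgroup.closure (x '' {e | G.Inc e u}) with hU
  have hmemU : ∀ e, G.Inc e u → x e ∈ U := fun e he ↦
    Subgroup.subset_closure (Set.mem_image_of_mem _ he)
  have hHmem : ∀ w, w ∈ H ↔ w ∈ V(G) ∧ w ≠ u := by intro w; simp [hH, and_comm]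
  have hUU : ∀ a ∈ U, ∀ b ∈ U, Commute a b := by
    intro a ha b hb
    refine commute_of_mem_closure ?_ ha hb
    rintro _ ⟨a, ha, rfl⟩ _ ⟨b, hb, rfl⟩
    exact hx.comm u a b ha hb
  obtain hH0 | ⟨h0, hh0⟩ := H.eq_empty_or_nonempty
  · intro e he
    exfalso
    obtain ⟨v, w, hvw⟩ := exists_isLink_of_mem_edgeSet he
    have h1 : ∀ v ∈ V(G), v = u := by
      intro v hv
      by_contra hvu
      have := (hHmem v).mpr ⟨hv, hvu⟩
      simp [hH0] at this
    exact hvw.ne ((h1 v hvw.left_mem).trans (h1 w hvw.right_mem).symm)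
  -- the rim edges at a rim vertex
  have hrim : ∀ h ∈ H, ∃ e f, e ≠ f ∧ ∀ g, (∃ w ∈ H, G.IsLink g h w) ↔ g = e ∨ g = f := by
    intro h hh
    have h2 := hreg h hh
    rw [degIn_mult hE, Set.ncard_eq_two] at h2
    obtain ⟨e, f, hef, heq⟩ := h2
    exact ⟨e, f, hef, fun g ↦ by simpa using Set.ext_iff.mp heq g⟩
  have hspoke : ∀ h ∈ H, ∀ g, G.Inc g h → ¬ (∃ w ∈ H, G.IsLink g h w) → G.Inc g u := by
    rintro h hh g ⟨w, hg⟩ hn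
    by_cases hwu : w = u
    · exact hwu ▸ hg.inc_right
    · exact absurd ⟨w, (hHmem w).mpr ⟨hg.right_mem, hwu⟩, hg⟩ hn
  have hpair : ∀ h ∈ H, ∀ e f, (∃ w ∈ H, G.IsLink e h w) → (∃ w ∈ H, G.IsLink f h w) →
      x e * x f ∈ U := by
    intro h hh e f he hf
    obtain ⟨a, b, hab, hab'⟩ := hrim h hh
    have hinc : ∀ g, (∃ w ∈ H, G.IsLink g h w) → G.Inc g h := fun g ⟨w, _, hg⟩ ↦ ⟨w, hg⟩
    have key : ∀ c d, c ≠ d → (∀ g, (∃ w ∈ H, G.IsLink g h w) ↔ g = c ∨ g = d) →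
        x c * x d ∈ U := by
      intro c d hcd hcd'
      refine hx.mul_mem_of_forall_ne hE (hinc c ((hcd' c).mpr (Or.inl rfl)))
        (hinc d ((hcd' d).mpr (Or.inr rfl))) hcd fun g hg hgc hgd ↦ hmemU g (hspoke h hh g hg ?_)
      rw [hcd']
      tauto
    by_cases hef : e = f
    · subst hef
      rw [hx.sq e (hinc e he).edge_mem]
      exact U.one_mem
    · refine key e f hef fun g ↦ ?_
      rw [hab'] at he hf ⊢
      have : e ≠ f := hef
      obtain rfl | rfl := he <;> obtain rfl | rfl := hf
      · exact absurd rfl hef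
      · rfl
      · exact or_comm
      · exact absurd rfl hef
  obtain ⟨e0, _, -, he0⟩ := hrim h0 hh0
  have he0' : ∃ w ∈ H, G.IsLink e0 h0 w := (he0 e0).mpr (Or.inl rfl)
  have he0E : e0 ∈ E(G) := by
    obtain ⟨w, -, hw⟩ := he0'
    exact hw.edge_mem
  have h00 := hx.sq e0 he0E
  -- `S` consists of the vertices reached along the rim from `e0`
  obtain ⟨S, hS⟩ : ∃ S, ∀ h, h ∈ S ↔
      h ∈ H ∧ ∀ e, (∃ w ∈ H, G.IsLink e h w) → x e0 * x e ∈ U := by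
    classical
    exact ⟨H.filter (fun h ↦ ∀ e, (∃ w ∈ H, G.IsLink e h w) → x e0 * x e ∈ U), by simp⟩
  have hSmem : ∀ h ∈ H, ∀ e, (∃ w ∈ H, G.IsLink e h w) → x e0 * x e ∈ U → h ∈ S := by
    intro h hh e he heU
    refine (hS h).mpr ⟨hh, fun f hf ↦ ?_⟩
    have hee : x e * x e = 1 := hx.sq e (by obtain ⟨w, -, hw⟩ := he; exact hw.edge_mem)
    have : x e0 * x f = x e0 * x e * (x e * x f) := by
      rw [mul_assoc, ← mul_assoc (x e), hee, one_mul]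
    rw [this]
    exact U.mul_mem heU (hpair h hh e f he hf)
  have hSH : S ⊆ H := fun h hh ↦ ((hS h).mp hh).1
  have hstep : ∀ h ∈ H, ∀ w ∈ H, ∀ e, G.IsLink e h w → h ∈ S → w ∈ S := by
    intro h hh w hw e he hhS
    exact hSmem w hw e ⟨h, hh, he.symm⟩ (((hS h).mp hhS).2 e ⟨w, hw, he⟩)
  have hHV : H ⊆ hV.toFinset := erase_subset _ _
  have hScyc : IsCyc G.mult S := by
    refine ⟨⟨h0, hSmem h0 hh0 e0 he0' (by rw [h00]; exact U.one_mem)⟩, fun h hh ↦ ?_⟩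
    rw [← hreg h (hSH hh)]
    unfold degIn
    refine sum_le_sum_of_ne_zero fun w hw hne ↦ ?_
    rw [Ne, mult_eq_zero_iff hE] at hne
    push Not at hne
    obtain ⟨e, he⟩ := hne
    exact hstep h (hSH hh) w hw e he hh
  have hSeq : S = H := by
    by_contra hne
    refine ht.meet S (hSH.trans hHV) (H \ S) (sdiff_subset.trans hHV) hScyc ⟨?_, ?_⟩
      disjoint_sdiff
    · rw [sdiff_nonempty]
      exact fun hc ↦ hne (subset_antisymm hSH hc)
    · intro h hh
      obtain ⟨hhH, hhS⟩ := mem_sdiff.mp hh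
      rw [← hreg h hhH]
      unfold degIn
      refine sum_le_sum_of_ne_zero fun w hw hne ↦ mem_sdiff.mpr ⟨hw, fun hwS ↦ hhS ?_⟩
      rw [Ne, mult_eq_zero_iff hE] at hne
      push Not at hne
      obtain ⟨e, he⟩ := hne
      exact hstep w hw h hhH e he.symm hwS
  have hrimU : ∀ h ∈ H, ∀ e, (∃ w ∈ H, G.IsLink e h w) → x e0 * x e ∈ U := by
    intro h hh
    rw [← hSeq] at hh
    exact ((hS h).mp hh).2
  have hdich : ∀ e ∈ E(G), x e ∈ U ∨ x e0 * x e ∈ U := by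
    intro e he
    obtain ⟨v, w, hvw⟩ := exists_isLink_of_mem_edgeSet he
    by_cases hvu : v = u
    · exact Or.inl (hmemU e (hvu ▸ hvw.inc_left))
    by_cases hwu : w = u
    · exact Or.inl (hmemU e (hwu ▸ hvw.inc_right))
    · exact Or.inr (hrimU v ((hHmem v).mpr ⟨hvw.left_mem, hvu⟩) e
        ⟨w, (hHmem w).mpr ⟨hvw.right_mem, hwu⟩, hvw⟩)
  have he0U : ∀ y ∈ U, Commute (x e0) y := by
    have : U ≤ Subgroup.centralizer {x e0} := by
      rw [hU, Subgroup.closure_le]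
      rintro _ ⟨s, ⟨h, hs⟩, rfl⟩
      have hs : G.IsLink s u h := hs
      have hh : h ∈ H := (hHmem h).mpr ⟨hs.right_mem, fun e ↦ hs.ne e.symm⟩
      obtain ⟨e, _, -, he⟩ := hrim h hh
      have he' : ∃ w ∈ H, G.IsLink e h w := (he e).mpr (Or.inl rfl)
      have hU' := hrimU h hh e he'
      obtain ⟨w, hw, hew⟩ := he'
      have c1 : Commute (x e) (x s) := hx.comm h e s hew.inc_left hs.inc_right
      have c2 : Commute (x e0 * x e) (x s) := hUU _ hU' _ (hmemU s hs.inc_left)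
      have c3 : x e0 = x e0 * x e * x e := by rw [mul_assoc, hx.sq e hew.edge_mem, mul_one]
      rw [SetLike.mem_coe, Subgroup.mem_centralizer_singleton_iff, c3]
      exact (c2.mul_left c1).eq.symm
    intro y hy
    have := Subgroup.mem_centralizer_singleton_iff.mp (this hy)
    exact this.symm
  have hform : ∀ e ∈ E(G), ∃ y ∈ U, x e = y ∨ x e = x e0 * y := by
    intro e he
    obtain h1 | h1 := hdich e he
    · exact ⟨_, h1, Or.inl rfl⟩
    · exact ⟨_, h1, Or.inr (by rw [← mul_assoc, h00, one_mul])⟩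
  intro e he f hf
  obtain ⟨y, hy, h1⟩ := hform e he
  obtain ⟨z, hz, h2⟩ := hform f hf
  have c0 := Commute.refl (x e0)
  have cy := he0U y hy
  have cz := he0U z hz
  have cyz := hUU y hy z hz
  obtain h1 | h1 := h1 <;> obtain h2 | h2 := h2 <;> rw [h1, h2]
  · exact cyz
  · exact cy.symm.mul_right cyz
  · exact cz.mul_left cyz
  · exact (c0.mul_right cz).mul_left (cy.symm.mul_right cyz)

end Graph

/-! ### Commutativity for cones over three vertices and for `K₅` -/

namespace Graph

universe u v w

open EdgeMult Finset

variable {α : Type u} {β : Type v} {K : Type w} [Group K]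
variable {G : Graph α β} {x : β → K} {a b c : α} {W : Finset α}

/-- `G` consists of three vertices `a`, `b`, `c`, of an independent set `W` of vertices joined to
each of `a`, `b`, `c` by one edge, and of arbitrary edges between `a`, `b`, `c`. -/
structure IsCone (G : Graph α β) (a b c : α) (W : Finset α) : Prop where
  ab : a ≠ b
  ac : a ≠ c
  bc : b ≠ c
  mem : ∀ w, w ∈ V(G) ↔ w = a ∨ w = b ∨ w = c ∨ w ∈ W
  ha : a ∉ W
  hb : b ∉ W
  hc : c ∉ W
  one_a : ∀ w ∈ W, ∃ e, ∀ f, G.IsLink f w a ↔ f = e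
  one_b : ∀ w ∈ W, ∃ e, ∀ f, G.IsLink f w b ↔ f = e
  one_c : ∀ w ∈ W, ∃ e, ∀ f, G.IsLink f w c ↔ f = e
  zero : ∀ w ∈ W, ∀ w' ∈ W, ∀ e, ¬ G.IsLink e w w'

lemma IsCone.rotate (h : G.IsCone a b c W) : G.IsCone b c a W where
  ab := h.bc
  ac := h.ab.symm
  bc := h.ac.symm
  mem w := by rw [h.mem]; tauto
  ha := h.hb
  hb := h.hc
  hc := h.ha
  one_a := h.one_b
  one_b := h.one_c
  one_c := h.one_a
  zero := h.zero

lemma IsCone.swap (h : G.IsCone a b c W) : G.IsCone b a c W where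
  ab := h.ab.symm
  ac := h.bc
  bc := h.ac
  mem w := by rw [h.mem]; tauto
  ha := h.hb
  hb := h.ha
  hc := h.hc
  one_a := h.one_b
  one_b := h.one_a
  one_c := h.one_c
  zero := h.zero

lemma IsCone.prod_triple (h : G.IsCone a b c W) (hx : G.IsSol x) {w : α} (hw : w ∈ W) {e f g : β}
    (he : G.IsLink e w a) (hf : G.IsLink f w b) (hg : G.IsLink g w c) : x e * x f * x g = 1 := by
  have ue : ∀ e', G.IsLink e' w a → e' = e := by
    obtain ⟨e₀, h₀⟩ := h.one_a w hw
    intro e' he'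
    rw [(h₀ e').mp he', (h₀ e).mp he]
  have uf : ∀ e', G.IsLink e' w b → e' = f := by
    obtain ⟨e₀, h₀⟩ := h.one_b w hw
    intro e' he'
    rw [(h₀ e').mp he', (h₀ f).mp hf]
  have ug : ∀ e', G.IsLink e' w c → e' = g := by
    obtain ⟨e₀, h₀⟩ := h.one_c w hw
    intro e' he'
    rw [(h₀ e').mp he', (h₀ g).mp hg]
  have hef : e ≠ f := by rintro rfl; exact h.ab (he.right_unique hf)
  have heg : e ≠ g := by rintro rfl; exact h.ac (he.right_unique hg)
  have hfg : f ≠ g := by rintro rfl; exact h.bc (hf.right_unique hg)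
  have := hx.prod w he.left_mem [e, f, g] (by simp [hef, heg, hfg]) (by
    intro e'
    simp only [List.mem_cons, List.not_mem_nil, or_false]
    constructor
    · rintro (rfl | rfl | rfl)
      exacts [he.inc_left, hf.inc_left, hg.inc_left]
    · rintro ⟨y, hy⟩
      obtain rfl | rfl | rfl | hyW := (h.mem y).mp hy.right_mem
      · exact Or.inl (ue _ hy)
      · exact Or.inr (Or.inl (uf _ hy))
      · exact Or.inr (Or.inr (ug _ hy))
      · exact absurd hy (h.zero w hw y hyW e'))
  simpa [mul_assoc] using this

/-- An edge between `a` and `b` commutes with the edges at `a` and `b`, hence also with the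
products of two such edges which appear as edges at `c`. -/
lemma IsCone.commute_base (h : G.IsCone a b c W) [G.Loopless] (hx : G.IsSol x) {e f : β}
    (hf : G.IsLink f a b) (he : e ∈ E(G)) : Commute (x f) (x e) := by
  obtain ⟨p, q, hpq⟩ := exists_isLink_of_mem_edgeSet he
  have ca : ∀ g, G.Inc g a → Commute (x f) (x g) := fun g hg ↦ hx.comm a f g hf.inc_left hg
  have cb : ∀ g, G.Inc g b → Commute (x f) (x g) := fun g hg ↦ hx.comm b f g hf.inc_right hg
  have main : ∀ w ∈ W, G.IsLink e w c → Commute (x f) (x e) := by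
    intro w hw hwc
    obtain ⟨e₁, h₁⟩ := h.one_a w hw
    obtain ⟨e₂, h₂⟩ := h.one_b w hw
    have l₁ := (h₁ e₁).mpr rfl
    have l₂ := (h₂ e₂).mpr rfl
    have := h.prod_triple hx hw l₁ l₂ hwc
    rw [eq_inv_of_mul_eq_one_right this]
    exact ((ca e₁ l₁.inc_right).mul_right (cb e₂ l₂.inc_right)).inv_right
  obtain rfl | rfl | rfl | hp := (h.mem p).mp hpq.left_mem
  · exact ca e hpq.inc_left
  · exact cb e hpq.inc_left
  · obtain rfl | rfl | rfl | hq := (h.mem q).mp hpq.right_mem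
    · exact ca e hpq.inc_right
    · exact cb e hpq.inc_right
    · exact absurd rfl hpq.ne
    · exact main q hq hpq.symm
  · obtain rfl | rfl | rfl | hq := (h.mem q).mp hpq.right_mem
    · exact ca e hpq.inc_right
    · exact cb e hpq.inc_right
    · exact main p hp hpq
    · exact absurd hpq (h.zero p hp q hq e)

/-- The product relation at `a`, with the edges grouped by their other end. -/
lemma IsCone.prod_apex (h : G.IsCone a b c W) (hx : G.IsSol x) [G.Loopless]
    {E : α → β} (hE : ∀ w ∈ W, ∀ f, G.IsLink f w a ↔ f = E w) {lb lc : List β}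
    (hlb : lb.Nodup) (hlb' : ∀ e, e ∈ lb ↔ G.IsLink e a b)
    (hlc : lc.Nodup) (hlc' : ∀ e, e ∈ lc ↔ G.IsLink e a c)
    {lw : List α} (hlw : lw.Nodup) (hlw' : ∀ w, w ∈ lw ↔ w ∈ W) :
    (lb.map x).prod * (lc.map x).prod * (lw.map fun w ↦ x (E w)).prod = 1 := by
  have hinj : ∀ w ∈ lw, ∀ w' ∈ lw, E w = E w' → w = w' := by
    intro w hw w' hw' hww'
    have h1 := (hE w ((hlw' w).mp hw) _).mpr rfl
    have h2 := (hE w' ((hlw' w').mp hw') _).mpr rfl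
    rw [hww'] at h1
    exact h1.left_unique h2
  by_cases hav : a ∈ V(G)
  swap
  · exact absurd ((h.mem a).mpr (Or.inl rfl)) hav
  have := hx.prod a hav (lb ++ lc ++ lw.map E) (by
    rw [List.nodup_append', List.nodup_append']
    refine ⟨⟨hlb, hlc, ?_⟩, ?_, ?_⟩
    · intro e h1 h2
      exact h.bc (((hlb' e).mp h1).right_unique ((hlc' e).mp h2))
    · exact hlw.map_on hinj
    · intro e h1 h2
      obtain ⟨w, hw, rfl⟩ := List.mem_map.mp h2
      have hwW := (hlw' w).mp hw
      have h3 := ((hE w hwW _).mpr rfl).symm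
      rw [List.mem_append, hlb', hlc'] at h1
      obtain h1 | h1 := h1
      · exact h.hb (h1.right_unique h3 ▸ hwW)
      · exact h.hc (h1.right_unique h3 ▸ hwW)) (by
    intro e
    rw [List.mem_append, List.mem_append, hlb', hlc', List.mem_map]
    constructor
    · rintro ((h1 | h1) | ⟨w, hw, rfl⟩)
      · exact h1.inc_left
      · exact h1.inc_left
      · exact ((hE w ((hlw' w).mp hw) _).mpr rfl).inc_right
    · rintro ⟨y, hy⟩
      obtain rfl | rfl | rfl | hyW := (h.mem y).mp hy.right_mem
      · exact absurd rfl hy.ne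
      · exact Or.inl (Or.inl hy)
      · exact Or.inl (Or.inr hy)
      · exact Or.inr ⟨y, (hlw' y).mpr hyW, ((hE y hyW e).mp hy.symm).symm⟩)
  rw [List.map_append, List.map_append, List.prod_append, List.prod_append, List.map_map] at this
  exact this

lemma list_prod_mul_self {l : List K} (hsq : ∀ a ∈ l, a * a = 1)
    (hc : ∀ a ∈ l, ∀ b ∈ l, Commute a b) : l.prod * l.prod = 1 := by
  induction l with
  | nil => simp
  | cons a l ih =>
    have h1 : Commute a l.prod := Commute.list_prod_right _ _ fun b hb ↦
      hc a (by simp) b (by simp [hb])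
    rw [List.prod_cons, mul_assoc, ← mul_assoc l.prod, ← h1.eq, mul_assoc,
      ih (fun b hb ↦ hsq b (by simp [hb])) (fun b hb d hd ↦ hc b (by simp [hb]) d (by simp [hd])),
      mul_one, hsq a (by simp)]

lemma IsCone.commute_cross (h : G.IsCone a b c W) [G.Loopless] (hE : E(G).Finite) (hx : G.IsSol x)
    (hW : #W ≤ 3) {w₁ w₂ : α} (hw₁ : w₁ ∈ W) (hw₂ : w₂ ∈ W) (hne : w₁ ≠ w₂) {e f : β}
    (he : G.IsLink e w₁ b) (hf : G.IsLink f w₂ a) : Commute (x f) (x e) := by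
  classical
  have : Nonempty β := ⟨e⟩
  choose! P hP using h.one_a
  choose! Q hQ using h.one_b
  choose! R hR using h.one_c
  have hP' : ∀ w ∈ W, G.IsLink (P w) w a := fun w hw ↦ (hP w hw _).mpr rfl
  have hQ' : ∀ w ∈ W, G.IsLink (Q w) w b := fun w hw ↦ (hQ w hw _).mpr rfl
  have hR' : ∀ w ∈ W, G.IsLink (R w) w c := fun w hw ↦ (hR w hw _).mpr rfl
  obtain ⟨lp, hlp, hlp'⟩ := exists_enum (finite_isLink hE a b)
  obtain ⟨lq, hlq, hlq'⟩ := exists_enum (finite_isLink hE a c)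
  obtain ⟨lr, hlr, hlr'⟩ := exists_enum (finite_isLink hE b c)
  simp only [Set.mem_ofPred_eq] at hlp' hlq' hlr'
  obtain ⟨l, hl, hl'⟩ : ∃ l : List α, l.Nodup ∧ ∀ w, w ∈ l ↔ w ∈ (W.erase w₁).erase w₂ :=
    ⟨_, Finset.nodup_toList _, fun w ↦ Finset.mem_toList⟩
  have hlW : ∀ w ∈ l, w ∈ W := fun w hw ↦ mem_of_mem_erase (mem_of_mem_erase ((hl' w).mp hw))
  have hlen : l.length ≤ 1 := by
    have h1 : l.toFinset = (W.erase w₁).erase w₂ := by ext w; simp [hl']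
    have h2 := List.toFinset_card_of_nodup hl
    rw [h1, card_erase_of_mem (mem_erase.mpr ⟨hne.symm, hw₂⟩), card_erase_of_mem hw₁] at h2
    omega
  have hlw : (w₁ :: w₂ :: l).Nodup := by simp [hne, hl, hl']
  have hlw' : ∀ w, w ∈ w₁ :: w₂ :: l ↔ w ∈ W := by
    intro w
    simp only [List.mem_cons, hl', mem_erase]
    constructor
    · rintro (rfl | rfl | h)
      exacts [hw₁, hw₂, h.2.2]
    · tauto
  have r₁ := h.prod_apex hx hP hlp hlp' hlq hlq' hlw hlw'
  have r₂ := h.swap.prod_apex hx hQ hlp (fun e ↦ (hlp' e).trans isLink_comm) hlr hlr' hlw hlw'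
  have r₃ := h.rotate.rotate.prod_apex hx hR hlq (fun e ↦ (hlq' e).trans isLink_comm) hlr
    (fun e ↦ (hlr' e).trans isLink_comm) hlw hlw'
  -- the edges at `c` are the products of the edges at `a` and `b`
  have hRPQ : ∀ w ∈ W, x (R w) = x (P w) * x (Q w) := by
    intro w hw
    have h1 := h.prod_triple hx hw (hP' w hw) (hQ' w hw) (hR' w hw)
    have h2 := hx.sq _ (hR' w hw).edge_mem
    rw [← mul_left_inj (x (R w)), h1, h2]
  have hsqP : ∀ w ∈ W, x (P w) * x (P w) = 1 := fun w hw ↦ hx.sq _ (hP' w hw).edge_mem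
  have hsqQ : ∀ w ∈ W, x (Q w) * x (Q w) = 1 := fun w hw ↦ hx.sq _ (hQ' w hw).edge_mem
  have cp : ∀ g ∈ E(G), Commute (lp.map x).prod (x g) := by
    intro g hg
    refine Commute.list_prod_left _ _ fun y hy ↦ ?_
    obtain ⟨e, he, rfl⟩ := List.mem_map.mp hy
    exact h.commute_base hx ((hlp' e).mp he) hg
  have cq : ∀ g ∈ E(G), Commute (lq.map x).prod (x g) := by
    intro g hg
    refine Commute.list_prod_left _ _ fun y hy ↦ ?_
    obtain ⟨e, he, rfl⟩ := List.mem_map.mp hy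
    exact h.rotate.rotate.commute_base hx ((hlq' e).mp he).symm hg
  have cr : ∀ g ∈ E(G), Commute (lr.map x).prod (x g) := by
    intro g hg
    refine Commute.list_prod_left _ _ fun y hy ↦ ?_
    obtain ⟨e, he, rfl⟩ := List.mem_map.mp hy
    exact h.rotate.commute_base hx ((hlr' e).mp he) hg
  have memE : ∀ {l : List β} {a b : α}, (∀ e, e ∈ l ↔ G.IsLink e a b) → ∀ e ∈ l, e ∈ E(G) :=
    fun hl e he ↦ ((hl e).mp he).edge_mem
  have sqprod : ∀ {l : List β} {a b : α}, (∀ e, e ∈ l ↔ G.IsLink e a b) →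
      (l.map x).prod * (l.map x).prod = 1 := by
    intro l a b hl
    refine list_prod_mul_self ?_ ?_
    · intro y hy
      obtain ⟨e, he, rfl⟩ := List.mem_map.mp hy
      exact hx.sq e (memE hl e he)
    · intro y hy z hz
      obtain ⟨e, he, rfl⟩ := List.mem_map.mp hy
      obtain ⟨f, hf, rfl⟩ := List.mem_map.mp hz
      exact hx.comm a e f ((hl e).mp he).inc_left ((hl f).mp hf).inc_left
  have commprod : ∀ {y : K} {l : List β}, (∀ g ∈ E(G), Commute y (x g)) → (∀ e ∈ l, e ∈ E(G)) →
      Commute y (l.map x).prod := by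
    intro y l hy hl
    refine Commute.list_prod_right _ _ fun z hz ↦ ?_
    obtain ⟨e, he, rfl⟩ := List.mem_map.mp hz
    exact hy e (hl e he)
  rw [(hP w₂ hw₂ f).mp hf, (hQ w₁ hw₁ e).mp he]
  -- a possible third vertex of `W` is represented by its edges, or by `1` if there is none
  obtain ⟨P₃, Q₃, hP₃, hQ₃, hPQ₃, hcP, hcQ, e₁, e₂, e₃⟩ : ∃ P₃ Q₃ : K, P₃ * P₃ = 1 ∧ Q₃ * Q₃ = 1 ∧
      Commute P₃ Q₃ ∧ (∀ y, (∀ g ∈ E(G), Commute y (x g)) → Commute y P₃) ∧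
      (∀ y, (∀ g ∈ E(G), Commute y (x g)) → Commute y Q₃) ∧
      (l.map fun w ↦ x (P w)).prod = P₃ ∧ (l.map fun w ↦ x (Q w)).prod = Q₃ ∧
      (l.map fun w ↦ x (R w)).prod = P₃ * Q₃ := by
    obtain hl0 | ⟨w₃, hl1⟩ : l = [] ∨ ∃ w₃, l = [w₃] := by
      match l, hlen with
      | [], _ => exact Or.inl rfl
      | [w], _ => exact Or.inr ⟨w, rfl⟩
    · subst hl0
      exact ⟨1, 1, by simp⟩
    · subst hl1
      have hw₃ := hlW w₃ (by simp)
      refine ⟨x (P w₃), x (Q w₃), hsqP _ hw₃, hsqQ _ hw₃,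
        hx.comm w₃ _ _ (hP' _ hw₃).inc_left (hQ' _ hw₃).inc_left,
        fun y hy ↦ hy _ (hP' _ hw₃).edge_mem, fun y hy ↦ hy _ (hQ' _ hw₃).edge_mem, ?_⟩
      simp [hRPQ _ hw₃]
  simp only [List.map_cons, List.prod_cons, e₁, e₂, e₃, hRPQ _ hw₁, hRPQ _ hw₂] at r₁ r₂ r₃
  have m₁ := (hP' _ hw₁).edge_mem
  have m₂ := (hP' _ hw₂).edge_mem
  have m₃ := (hQ' _ hw₁).edge_mem
  have m₄ := (hQ' _ hw₂).edge_mem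
  refine commute_of_three_rows (P₁ := x (P w₁)) (Q₂ := x (Q w₂)) (P₃ := P₃) (Q₃ := Q₃)
    (sqprod hlp') (sqprod hlq') (sqprod hlr') hP₃ hQ₃ ?_ ?_ ?_ hPQ₃
    (by simpa only [mul_assoc] using r₁) (by simpa only [mul_assoc] using r₂)
    (by simpa only [mul_assoc] using r₃)
  · simp only [List.mem_cons, List.not_mem_nil, or_false, forall_eq_or_imp, forall_eq]
    exact ⟨cp _ m₁, cp _ m₂, hcP _ cp, cp _ m₃, cp _ m₄, hcQ _ cp, commprod cp (memE hlq'),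
      commprod cp (memE hlr')⟩
  · simp only [List.mem_cons, List.not_mem_nil, or_false, forall_eq_or_imp, forall_eq]
    exact ⟨cq _ m₁, cq _ m₂, hcP _ cq, cq _ m₃, cq _ m₄, hcQ _ cq, commprod cq (memE hlr')⟩
  · simp only [List.mem_cons, List.not_mem_nil, or_false, forall_eq_or_imp, forall_eq]
    exact ⟨cr _ m₁, cr _ m₂, hcP _ cr, cr _ m₃, cr _ m₄, hcQ _ cr⟩

theorem IsCone.commute (h : G.IsCone a b c W) [G.Loopless] (hE : E(G).Finite) (hx : G.IsSol x)
    (hW : #W ≤ 3) : ∀ e ∈ E(G), ∀ f ∈ E(G), Commute (x e) (x f) := by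
  have key : ∀ e ∈ E(G), (∀ f ∈ E(G), Commute (x e) (x f)) ∨
      ∃ w ∈ W, G.IsLink e w a ∨ G.IsLink e w b ∨ G.IsLink e w c := by
    intro e he
    obtain ⟨p, q, hpq⟩ := exists_isLink_of_mem_edgeSet he
    have hab : G.IsLink e a b → ∀ f ∈ E(G), Commute (x e) (x f) :=
      fun h1 f hf ↦ h.commute_base hx h1 hf
    have hbc : G.IsLink e b c → ∀ f ∈ E(G), Commute (x e) (x f) :=
      fun h1 f hf ↦ h.rotate.commute_base hx h1 hf
    have hca : G.IsLink e c a → ∀ f ∈ E(G), Commute (x e) (x f) :=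
      fun h1 f hf ↦ h.rotate.rotate.commute_base hx h1 hf
    obtain rfl | rfl | rfl | hp := (h.mem p).mp hpq.left_mem <;>
      obtain rfl | rfl | rfl | hq := (h.mem q).mp hpq.right_mem
    · exact absurd rfl hpq.ne
    · exact Or.inl (hab hpq)
    · exact Or.inl (hca hpq.symm)
    · exact Or.inr ⟨q, hq, Or.inl hpq.symm⟩
    · exact Or.inl (hab hpq.symm)
    · exact absurd rfl hpq.ne
    · exact Or.inl (hbc hpq)
    · exact Or.inr ⟨q, hq, Or.inr (Or.inl hpq.symm)⟩
    · exact Or.inl (hca hpq)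
    · exact Or.inl (hbc hpq.symm)
    · exact absurd rfl hpq.ne
    · exact Or.inr ⟨q, hq, Or.inr (Or.inr hpq.symm)⟩
    · exact Or.inr ⟨p, hp, Or.inl hpq⟩
    · exact Or.inr ⟨p, hp, Or.inr (Or.inl hpq)⟩
    · exact Or.inr ⟨p, hp, Or.inr (Or.inr hpq)⟩
    · exact absurd hpq (h.zero p hp q hq e)
  have cross : ∀ {a b c}, G.IsCone a b c W → ∀ {w w' e f}, w ∈ W → w' ∈ W → G.IsLink e w a →
      G.IsLink f w' b → Commute (x e) (x f) := by
    intro a b c h w w' e f hw hw' he hf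
    by_cases hww : w = w'
    · subst hww
      exact hx.comm w e f he.inc_left hf.inc_left
    · exact h.commute_cross hE hx hW hw' hw (Ne.symm hww) hf he
  intro e he f hf
  obtain h1 | ⟨w, hw, h1⟩ := key e he
  · exact h1 f hf
  obtain h2 | ⟨w', hw', h2⟩ := key f hf
  · exact (h2 e he).symm
  obtain h1 | h1 | h1 := h1 <;> obtain h2 | h2 | h2 := h2
  · exact hx.comm a e f h1.inc_right h2.inc_right
  · exact cross h hw hw' h1 h2
  · exact cross h.rotate.rotate.swap hw hw' h1 h2
  · exact cross h.swap hw hw' h1 h2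
  · exact hx.comm b e f h1.inc_right h2.inc_right
  · exact cross h.rotate hw hw' h1 h2
  · exact cross h.rotate.rotate hw hw' h1 h2
  · exact cross h.rotate.swap hw hw' h1 h2
  · exact hx.comm c e f h1.inc_right h2.inc_right

lemma isCone_of_isThreeCone [DecidableEq α] (hV : V(G).Finite) (hE : E(G).Finite)
    (h : IsThreeCone G.mult hV.toFinset) : ∃ a b c W, G.IsCone a b c W := by
  obtain ⟨a, ha, b, hb, c, hc, hab, hac, hbc, hW⟩ := h
  rw [Set.Finite.mem_toFinset] at ha hb hc
  refine ⟨a, b, c, hV.toFinset \ {a, b, c}, hab, hac, hbc, ?_, by simp, by simp, by simp,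
    fun w hw ↦ mult_eq_one_iff.mp (hW w hw).1, fun w hw ↦ mult_eq_one_iff.mp (hW w hw).2.1,
    fun w hw ↦ mult_eq_one_iff.mp (hW w hw).2.2.1,
    fun w hw w' hw' ↦ (mult_eq_zero_iff hE).mp ((hW w hw).2.2.2 w' hw')⟩
  intro w
  simp only [mem_sdiff, Set.Finite.mem_toFinset, mem_insert, mem_singleton]
  constructor
  · tauto
  · rintro (rfl | rfl | rfl | h)
    exacts [ha, hb, hc, h.1]

/-- The relation at a vertex with four simple edges. -/
lemma IsSol.prod_four (hx : G.IsSol x) {v w₁ w₂ w₃ w₄ : α} {e₁ e₂ e₃ e₄ : β}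
    (h₁ : ∀ f, G.IsLink f v w₁ ↔ f = e₁) (h₂ : ∀ f, G.IsLink f v w₂ ↔ f = e₂)
    (h₃ : ∀ f, G.IsLink f v w₃ ↔ f = e₃) (h₄ : ∀ f, G.IsLink f v w₄ ↔ f = e₄)
    (hall : ∀ f w, G.IsLink f v w → w = w₁ ∨ w = w₂ ∨ w = w₃ ∨ w = w₄)
    (hne : [w₁, w₂, w₃, w₄].Nodup) : x e₁ * x e₂ * x e₃ * x e₄ = 1 := by
  have l₁ := (h₁ e₁).mpr rfl
  have l₂ := (h₂ e₂).mpr rfl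
  have l₃ := (h₃ e₃).mpr rfl
  have l₄ := (h₄ e₄).mpr rfl
  simp only [List.nodup_cons, List.mem_cons, List.not_mem_nil, or_false, not_or, not_false_eq_true,
    List.nodup_nil, and_true] at hne
  have key : ∀ {e f w w'}, w ≠ w' → G.IsLink e v w → G.IsLink f v w' → e ≠ f := by
    rintro e f w w' hww' he hf rfl
    exact hww' (he.right_unique hf)
  have := hx.prod v l₁.left_mem [e₁, e₂, e₃, e₄] (by
    simp [key hne.1.1 l₁ l₂, key hne.1.2.1 l₁ l₃, key hne.1.2.2 l₁ l₄, key hne.2.1.1 l₂ l₃,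
      key hne.2.1.2 l₂ l₄, key hne.2.2 l₃ l₄]) (by
    intro e
    simp only [List.mem_cons, List.not_mem_nil, or_false]
    constructor
    · rintro (rfl | rfl | rfl | rfl)
      exacts [l₁.inc_left, l₂.inc_left, l₃.inc_left, l₄.inc_left]
    · rintro ⟨w, hw⟩
      obtain rfl | rfl | rfl | rfl := hall e w hw
      · exact Or.inl ((h₁ e).mp hw)
      · exact Or.inr (Or.inl ((h₂ e).mp hw))
      · exact Or.inr (Or.inr (Or.inl ((h₃ e).mp hw)))
      · exact Or.inr (Or.inr (Or.inr ((h₄ e).mp hw))))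
  simpa [mul_assoc] using this

theorem IsSol.commute_of_isKFive [DecidableEq α] [G.Loopless] (hV : V(G).Finite)
    (hx : G.IsSol x) (h : IsKFive G.mult hV.toFinset) :
    ∀ e ∈ E(G), ∀ f ∈ E(G), Commute (x e) (x f) := by
  intro e₁₂ he e₃₄ hf
  obtain ⟨hcard, hone⟩ := h
  simp only [Set.Finite.mem_toFinset] at hone
  obtain ⟨v₁, v₂, l₁₂⟩ := exists_isLink_of_mem_edgeSet he
  obtain ⟨v₃, v₄, l₃₄⟩ := exists_isLink_of_mem_edgeSet hf
  by_cases h13 : v₁ = v₃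
  · exact hx.comm v₁ _ _ l₁₂.inc_left (h13 ▸ l₃₄.inc_left)
  by_cases h14 : v₁ = v₄
  · exact hx.comm v₁ _ _ l₁₂.inc_left (h14 ▸ l₃₄.inc_right)
  by_cases h23 : v₂ = v₃
  · exact hx.comm v₂ _ _ l₁₂.inc_right (h23 ▸ l₃₄.inc_left)
  by_cases h24 : v₂ = v₄
  · exact hx.comm v₂ _ _ l₁₂.inc_right (h24 ▸ l₃₄.inc_right)
  have h12 := l₁₂.ne
  have h34 := l₃₄.ne
  have m₁ := l₁₂.left_mem
  have m₂ := l₁₂.right_mem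
  have m₃ := l₃₄.left_mem
  have m₄ := l₃₄.right_mem
  have hsub : ({v₁, v₂, v₃, v₄} : Finset α) ⊆ hV.toFinset := by
    intro w hw
    simp only [mem_insert, mem_singleton] at hw
    rw [Set.Finite.mem_toFinset]
    obtain rfl | rfl | rfl | rfl := hw <;> assumption
  have hc4 : #({v₁, v₂, v₃, v₄} : Finset α) = 4 := by simp [h12, h13, h14, h23, h24, h34]
  have hc := card_sdiff_add_card_eq_card hsub
  obtain ⟨v₅, hv₅⟩ := card_eq_one.mp (show #(hV.toFinset \ {v₁, v₂, v₃, v₄}) = 1 by omega)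
  have hall : ∀ w ∈ V(G), w = v₁ ∨ w = v₂ ∨ w = v₃ ∨ w = v₄ ∨ w = v₅ := by
    intro w hw
    by_contra! hcon
    have : w ∈ hV.toFinset \ {v₁, v₂, v₃, v₄} := by simp [hw, hcon]
    rw [hv₅] at this
    simp [hcon] at this
  have hm₅ : v₅ ∈ hV.toFinset \ {v₁, v₂, v₃, v₄} := by simp [hv₅]
  simp only [mem_sdiff, Set.Finite.mem_toFinset, mem_insert, mem_singleton, not_or] at hm₅
  obtain ⟨m₅, h51, h52, h53, h54⟩ := hm₅
  have h15 := Ne.symm h51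
  have h25 := Ne.symm h52
  have h35 := Ne.symm h53
  have h45 := Ne.symm h54
  have edge : ∀ v ∈ V(G), ∀ w ∈ V(G), v ≠ w →
      ∃ e, (∀ f, G.IsLink f v w ↔ f = e) ∧ (∀ f, G.IsLink f w v ↔ f = e) := by
    intro v hv w hw hvw
    obtain ⟨e, he⟩ := mult_eq_one_iff.mp (hone v hv w hw hvw)
    exact ⟨e, he, fun f ↦ isLink_comm.trans (he f)⟩
  obtain ⟨e', a₁₂, a₂₁⟩ := edge v₁ m₁ v₂ m₂ h12
  obtain ⟨f', a₃₄, a₄₃⟩ := edge v₃ m₃ v₄ m₄ h34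
  obtain rfl : e₁₂ = e' := (a₁₂ _).mp l₁₂
  obtain rfl : e₃₄ = f' := (a₃₄ _).mp l₃₄
  obtain ⟨e₁₃, a₁₃, a₃₁⟩ := edge v₁ m₁ v₃ m₃ h13
  obtain ⟨e₁₄, a₁₄, a₄₁⟩ := edge v₁ m₁ v₄ m₄ h14
  obtain ⟨e₂₃, a₂₃, a₃₂⟩ := edge v₂ m₂ v₃ m₃ h23
  obtain ⟨e₂₄, a₂₄, a₄₂⟩ := edge v₂ m₂ v₄ m₄ h24
  obtain ⟨e₁₅, a₁₅, a₅₁⟩ := edge v₁ m₁ v₅ m₅ h15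
  obtain ⟨e₂₅, a₂₅, a₅₂⟩ := edge v₂ m₂ v₅ m₅ h25
  obtain ⟨e₃₅, a₃₅, a₅₃⟩ := edge v₃ m₃ v₅ m₅ h35
  obtain ⟨e₄₅, a₄₅, a₅₄⟩ := edge v₄ m₄ v₅ m₅ h45
  have r₁ := hx.prod_four a₁₂ a₁₃ a₁₄ a₁₅ (fun f w hw ↦ by
    obtain rfl | h | h | h | h := hall w hw.right_mem
    · exact absurd rfl hw.ne
    · simp [h]
    · simp [h]
    · simp [h]
    · simp [h]) (by
    simp [h23, h24, h25, h34, h35, h45])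
  have r₂ := hx.prod_four a₂₁ a₂₃ a₂₄ a₂₅ (fun f w hw ↦ by
    obtain h | rfl | h | h | h := hall w hw.right_mem
    · simp [h]
    · exact absurd rfl hw.ne
    · simp [h]
    · simp [h]
    · simp [h]) (by
    simp [h13, h14, h15, h34, h35, h45])
  have r₃ := hx.prod_four a₃₁ a₃₂ a₃₄ a₃₅ (fun f w hw ↦ by
    obtain h | h | rfl | h | h := hall w hw.right_mem
    · simp [h]
    · simp [h]
    · exact absurd rfl hw.ne
    · simp [h]
    · simp [h]) (by
    simp [h12, h14, h15, h24, h25, h45])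
  have r₄ := hx.prod_four a₄₁ a₄₂ a₄₃ a₄₅ (fun f w hw ↦ by
    obtain h | h | h | rfl | h := hall w hw.right_mem
    · simp [h]
    · simp [h]
    · simp [h]
    · exact absurd rfl hw.ne
    · simp [h]) (by
    simp [h12, h13, h15, h23, h25, h35])
  have r₅ := hx.prod_four a₅₁ a₅₂ a₅₃ a₅₄ (fun f w hw ↦ by
    obtain h | h | h | h | rfl := hall w hw.right_mem
    · simp [h]
    · simp [h]
    · simp [h]
    · simp [h]
    · exact absurd rfl hw.ne) (by
    simp [h12, h13, h14, h23, h24, h34])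
  have link : ∀ {v w e}, (∀ f, G.IsLink f v w ↔ f = e) → G.IsLink e v w := fun h ↦ (h _).mpr rfl
  have sq : ∀ {v w e}, (∀ f, G.IsLink f v w ↔ f = e) → x e * x e = 1 :=
    fun h ↦ hx.sq _ (link h).edge_mem
  have comm : ∀ {v w w' e e'}, (∀ f, G.IsLink f v w ↔ f = e) → (∀ f, G.IsLink f v w' ↔ f = e') →
      Commute (x e) (x e') := fun h h' ↦ hx.comm _ _ _ (link h).inc_left (link h').inc_left
  have solve : ∀ {y z : K}, z * z = 1 → y * z = 1 → z = y := by
    intro y z hz h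
    rw [← mul_left_inj z, hz, h]
  have s₁ := solve (sq a₁₅) r₁
  have s₂ := solve (sq a₂₅) r₂
  have s₃ := solve (sq a₃₅) r₃
  have s₄ := solve (sq a₄₅) r₄
  -- put the edge `34` first in the products at `3` and `4`
  have s₃' : x e₃₅ = x e₃₄ * x e₁₃ * x e₂₃ := by
    rw [s₃, ((comm a₃₁ a₃₄).mul_left (comm a₃₂ a₃₄)).eq, mul_assoc]
  have s₄' : x e₄₅ = x e₃₄ * x e₁₄ * x e₂₄ := by
    rw [s₄, ((comm a₄₁ a₄₃).mul_left (comm a₄₂ a₄₃)).eq, mul_assoc]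
  have c₁₄ := comm a₅₁ a₅₄
  have c₂₃ := comm a₅₂ a₅₃
  have c₁₃ := comm a₅₁ a₅₃
  rw [s₁, s₂, s₃', s₄', mul_assoc (_ * _ * _ * _)] at r₅
  rw [s₁, s₄'] at c₁₄
  rw [s₂, s₃'] at c₂₃
  rw [s₁, s₃'] at c₁₃
  refine commute_of_pentagram (sq a₁₂) (sq a₃₄) (sq a₁₃) (sq a₁₄) (sq a₂₃) (sq a₂₄) ?_ ?_
    (comm a₁₃ a₁₄) (comm a₃₁ a₃₂) (comm a₄₁ a₄₂) (comm a₂₃ a₂₄) c₁₄ c₂₃ c₁₃ r₅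
  · simp only [List.mem_cons, List.not_mem_nil, or_false, forall_eq_or_imp, forall_eq]
    exact ⟨comm a₁₂ a₁₃, comm a₁₂ a₁₄, comm a₂₁ a₂₃, comm a₂₁ a₂₄⟩
  · simp only [List.mem_cons, List.not_mem_nil, or_false, forall_eq_or_imp, forall_eq]
    exact ⟨comm a₃₄ a₃₁, comm a₄₃ a₄₁, comm a₃₄ a₃₂, comm a₄₃ a₄₂⟩

end Graph

/-! ### Commutativity passes to minors -/

namespace Graph

universe u v w u' v'

variable {α : Type u} {β : Type v} {K : Type w} [Group K]
variable {G H : Graph α β} {x : β → K} {v₁ v₂ u : α}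

open Classical in
lemma contractPair_isLink {e : β} {p q : α} : (G.contractPair v₁ v₂ u).IsLink e p q ↔
    ∃ a b, G.IsLink e a b ∧ ¬ (G.Inc e v₁ ∧ G.Inc e v₂) ∧
      (if a = v₁ ∨ a = v₂ then u else a) = p ∧ (if b = v₁ ∨ b = v₂ then u else b) = q := by
  simp [contractPair, Relation.Map, and_assoc]

open Classical in
lemma contractPair_vertexSet : V(G.contractPair v₁ v₂ u) =
    (fun x ↦ if x = v₁ ∨ x = v₂ then u else x) '' V(G) := by
  simp [contractPair]

lemma contractPair_edgeSet :
    E(G.contractPair v₁ v₂ u) = {e | e ∈ E(G) ∧ ¬ (G.Inc e v₁ ∧ G.Inc e v₂)} := by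
  ext e
  simp [contractPair]

open Classical in
lemma contractPair_inc {e : β} {p : α} : (G.contractPair v₁ v₂ u).Inc e p ↔
    ∃ a, G.Inc e a ∧ ¬ (G.Inc e v₁ ∧ G.Inc e v₂) ∧ (if a = v₁ ∨ a = v₂ then u else a) = p := by
  simp only [Inc, contractPair_isLink]
  constructor
  · rintro ⟨q, a, b, h1, h2, h3, h4⟩
    exact ⟨a, ⟨b, h1⟩, h2, h3⟩
  · rintro ⟨a, ⟨b, h1⟩, h2, h3⟩
    exact ⟨_, a, b, h1, h2, h3, rfl⟩

lemma contractPair_inc_new (hu : u ∉ V(G) \ {v₁, v₂}) {e : β} :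
    (G.contractPair v₁ v₂ u).Inc e u ↔
      (G.Inc e v₁ ∨ G.Inc e v₂) ∧ ¬ (G.Inc e v₁ ∧ G.Inc e v₂) := by
  rw [contractPair_inc]
  constructor
  · rintro ⟨a, h1, h2, h3⟩
    refine ⟨?_, h2⟩
    split_ifs at h3 with h
    · obtain rfl | rfl := h
      exacts [Or.inl h1, Or.inr h1]
    · exact absurd ⟨h3 ▸ h1.vertex_mem, by simpa [h3] using h⟩ hu
  · rintro ⟨h1 | h1, h2⟩
    · exact ⟨v₁, h1, h2, by simp⟩
    · exact ⟨v₂, h1, h2, by simp⟩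

lemma contractPair_inc_old (hu : u ∉ V(G) \ {v₁, v₂}) {e : β} {p : α} (hp : p ∈ V(G))
    (h1 : p ≠ v₁) (h2 : p ≠ v₂) : (G.contractPair v₁ v₂ u).Inc e p ↔
      G.Inc e p ∧ ¬ (G.Inc e v₁ ∧ G.Inc e v₂) := by
  have hpu : u ≠ p := fun e ↦ hu (e ▸ ⟨hp, by simp [h1, h2]⟩)
  rw [contractPair_inc]
  constructor
  · rintro ⟨a, h3, h4, h5⟩
    split_ifs at h5 with h
    · exact absurd h5 hpu
    · exact ⟨h5 ▸ h3, h4⟩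
  · rintro ⟨h3, h4⟩
    exact ⟨p, h3, h4, by simp [h1, h2]⟩

lemma contractPair_loopless [hG : G.Loopless] (hu : u ∉ V(G) \ {v₁, v₂}) :
    (G.contractPair v₁ v₂ u).Loopless := by
  refine ⟨fun e p ↦ ?_⟩
  rw [← isLink_self_iff, contractPair_isLink]
  rintro ⟨a, b, h1, h2, h3, h4⟩
  have hab := h1.ne
  have key : ∀ {c d : α}, G.IsLink e c d → c = v₁ ∨ c = v₂ → ¬ (d = v₁ ∨ d = v₂) → d = u →
      False := by
    intro c d h _ hd hdu
    exact hu (hdu ▸ ⟨h.right_mem, by simpa using hd⟩)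
  split_ifs at h3 h4 with h5 h6 h6
  · apply h2
    obtain rfl | rfl := h5 <;> obtain rfl | rfl := h6
    · exact absurd rfl hab
    · exact ⟨h1.inc_left, h1.inc_right⟩
    · exact ⟨h1.inc_right, h1.inc_left⟩
    · exact absurd rfl hab
  · exact key h1 h5 h6 (h4.trans h3.symm)
  · exact key h1.symm h6 h5 (h3.trans h4.symm)
  · exact hab (h3.trans h4.symm)

lemma MinorStep.loopless [G.Loopless] (h : MinorStep G H) : H.Loopless := by
  cases h with
  | deleteEdge e he => exact Loopless.anti deleteEdges_le
  | contractEdge e v₁ v₂ u he hu => exact contractPair_loopless hu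
  | deleteVertex v hv => exact Loopless.anti deleteVerts_le

lemma list_prod_map_filter {ι : Type*} (x : ι → K) (p : ι → Prop) [DecidablePred p] (l : List ι)
    (h : ∀ a ∈ l, ¬ p a → x a = 1) : (l.map x).prod = ((l.filter p).map x).prod := by
  induction l with
  | nil => simp
  | cons a l ih =>
    have := ih fun b hb ↦ h b (by simp [hb])
    by_cases hp : p a
    · simp [hp, this]
    · simp [hp, this, h a (by simp) hp]

/-- Solutions for a subgraph extend by `1`. -/
lemma CommSols.of_le (h : CommSols.{u, v, w} G) (hle : H ≤ G) : CommSols.{u, v, w} H := by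
  classical
  intro K _ y hy e he f hf
  let x : β → K := fun e ↦ if e ∈ E(H) then y e else 1
  have hxy : ∀ e ∈ E(H), x e = y e := fun e he ↦ if_pos he
  have hx1 : ∀ e ∉ E(H), x e = 1 := fun e he ↦ if_neg he
  have hE : E(H) ⊆ E(G) := hle.edgeSet_mono
  have hinc : ∀ {e v}, e ∈ E(H) → (H.Inc e v ↔ G.Inc e v) := fun he ↦ hle.inc_congr he
  have hx : G.IsSol x := by
    refine ⟨fun e _ ↦ ?_, fun v e f he hf ↦ ?_, fun v hv l hl hlv ↦ ?_⟩
    · by_cases he : e ∈ E(H)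
      · rw [hxy e he, hy.sq e he]
      · rw [hx1 e he, mul_one]
    · by_cases he' : e ∈ E(H)
      · by_cases hf' : f ∈ E(H)
        · rw [hxy e he', hxy f hf']
          exact hy.comm v e f ((hinc he').mpr he) ((hinc hf').mpr hf)
        · rw [hx1 f hf']
          exact Commute.one_right _
      · rw [hx1 e he']
        exact Commute.one_left _
    · rw [list_prod_map_filter x (· ∈ E(H)) l fun a _ ha ↦ hx1 a ha]
      have hmem : ∀ e, e ∈ l.filter (· ∈ E(H)) ↔ H.Inc e v := by
        intro e
        rw [List.mem_filter, hlv, decide_eq_true_iff]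
        exact ⟨fun ⟨h1, h2⟩ ↦ (hinc h2).mpr h1, fun h1 ↦ ⟨(hinc h1.edge_mem).mp h1, h1.edge_mem⟩⟩
      by_cases hv' : v ∈ V(H)
      · rw [← hy.prod v hv' _ (hl.filter _) hmem]
        congr 1
        exact List.map_congr_left fun e he ↦ hxy e ((hmem e).mp he).edge_mem
      · rw [List.eq_nil_iff_forall_not_mem.mpr fun e he ↦ hv' ((hmem e).mp he).vertex_mem]
        simp
  have := h K x hx e (hE he) f (hE hf)
  rwa [hxy e he, hxy f hf] at this

/-- Solutions for a contraction extend to the contracted edge `e₀` by the product of the remaining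
edges at one of its ends. -/
lemma CommSols.contractPair [G.Loopless] (h : CommSols.{u, v, w} G) (hE : E(G).Finite) {e₀ : β}
    (he₀ : G.IsLink e₀ v₁ v₂) (hu : u ∉ V(G) \ {v₁, v₂}) :
    CommSols.{u, v, w} (G.contractPair v₁ v₂ u) := by
  classical
  intro K _ y hy e he f hf
  set G' := G.contractPair v₁ v₂ u with hG'
  have hE' : ∀ e, e ∈ E(G') ↔ e ∈ E(G) ∧ ¬ (G.Inc e v₁ ∧ G.Inc e v₂) := fun e ↦ by
    rw [hG', contractPair_edgeSet]; rfl
  have he₀' : e₀ ∉ E(G') := fun hh ↦ ((hE' _).mp hh).2 ⟨he₀.inc_left, he₀.inc_right⟩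
  obtain ⟨l₁, hl₁, hl₁'⟩ := exists_enum (s := {e | G.Inc e v₁ ∧ ¬ G.Inc e v₂})
    ((finite_setOf_inc hE v₁).subset fun e he ↦ he.1)
  obtain ⟨l₂, hl₂, hl₂'⟩ := exists_enum (s := {e | G.Inc e v₂ ∧ ¬ G.Inc e v₁})
    ((finite_setOf_inc hE v₂).subset fun e he ↦ he.1)
  obtain ⟨l₀, hl₀, hl₀'⟩ := exists_enum (s := {e | G.Inc e v₁ ∧ G.Inc e v₂ ∧ e ≠ e₀})
    ((finite_setOf_inc hE v₁).subset fun e he ↦ he.1)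
  simp only [Set.mem_ofPred_eq] at hl₀' hl₁' hl₂'
  have hinc : ∀ e, G'.Inc e u ↔ (G.Inc e v₁ ∨ G.Inc e v₂) ∧ ¬ (G.Inc e v₁ ∧ G.Inc e v₂) :=
    fun e ↦ contractPair_inc_new hu
  have hu₁ : ∀ e ∈ l₁, G'.Inc e u := fun e he ↦ by rw [hinc]; have := (hl₁' e).mp he; tauto
  have hu₂ : ∀ e ∈ l₂, G'.Inc e u := fun e he ↦ by rw [hinc]; have := (hl₂' e).mp he; tauto
  obtain ⟨p, hp⟩ : ∃ p, p = (l₁.map y).prod := ⟨_, rfl⟩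
  have hpp : p * p = 1 := by
    rw [hp]
    refine list_prod_mul_self ?_ ?_
    · intro z hz
      obtain ⟨e, he, rfl⟩ := List.mem_map.mp hz
      exact hy.sq e (hu₁ e he).edge_mem
    · intro z hz z' hz'
      obtain ⟨e, he, rfl⟩ := List.mem_map.mp hz
      obtain ⟨f, hf, rfl⟩ := List.mem_map.mp hz'
      exact hy.comm u e f (hu₁ e he) (hu₁ f hf)
  have hpc : ∀ f, G'.Inc f u → Commute p (y f) := by
    intro f hf
    rw [hp]
    refine Commute.list_prod_left _ _ fun z hz ↦ ?_
    obtain ⟨e, he, rfl⟩ := List.mem_map.mp hz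
    exact hy.comm u e f (hu₁ e he) hf
  have hpl₂ : p * (l₂.map y).prod = 1 := by
    have huV : u ∈ V(G') := by
      rw [hG', contractPair_vertexSet]
      exact ⟨v₁, he₀.left_mem, by simp⟩
    rw [hp, ← List.prod_append, ← List.map_append]
    refine hy.prod u huV _ ?_ ?_
    · rw [List.nodup_append']
      refine ⟨hl₁, hl₂, fun e h1 h2 ↦ ?_⟩
      rw [hl₁'] at h1
      rw [hl₂'] at h2
      exact h1.2 h2.1
    · intro e
      rw [List.mem_append, hl₁', hl₂', hinc]
      tauto
  let x : β → K := fun e ↦ if e = e₀ then p else if e ∈ E(G') then y e else 1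
  have hx₀ : x e₀ = p := if_pos rfl
  have hxy : ∀ e ∈ E(G'), x e = y e := by
    intro e he
    have : e ≠ e₀ := fun h ↦ he₀' (h ▸ he)
    simp [x, this, he]
  have hx1 : ∀ e ∉ E(G'), e ≠ e₀ → x e = 1 := by
    intro e he hne
    simp [x, he, hne]
  have hmap : ∀ l : List β, (∀ e ∈ l, e ∈ E(G')) → l.map x = l.map y :=
    fun l hl ↦ List.map_congr_left fun e he ↦ hxy e (hl e he)
  have hprod₀ : (l₀.map x).prod = 1 := by
    refine List.prod_eq_one fun z hz ↦ ?_
    obtain ⟨e, he, rfl⟩ := List.mem_map.mp hz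
    obtain ⟨h1, h2, h3⟩ := (hl₀' e).mp he
    exact hx1 e (fun h ↦ ((hE' e).mp h).2 ⟨h1, h2⟩) h3
  have hcomm : ∀ v e f, G.Inc e v → G.Inc f v → Commute (x e) (x f) := by
    intro v e f he hf
    have hinc' : ∀ g ∈ E(G'), G.Inc g v → G'.Inc g (if v = v₁ ∨ v = v₂ then u else v) :=
      fun g hg hgv ↦ contractPair_inc.mpr ⟨v, hgv, ((hE' g).mp hg).2, rfl⟩
    have hpe : ∀ g, G.Inc e₀ v → G.Inc g v → Commute p (x g) := by
      intro g hev hgv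
      by_cases hg₀ : g = e₀
      · rw [hg₀, hx₀]
      by_cases hg : g ∈ E(G')
      · rw [hxy g hg]
        have h1 := hinc' g hg hgv
        rw [if_pos (hev.eq_or_eq_of_isLink he₀)] at h1
        exact hpc g h1
      · rw [hx1 g hg hg₀]
        exact Commute.one_right _
    by_cases he₁ : e = e₀
    · rw [he₁, hx₀]
      exact hpe f (he₁ ▸ he) hf
    by_cases hf₁ : f = e₀
    · rw [hf₁, hx₀]
      exact (hpe e (hf₁ ▸ hf) he).symm
    by_cases he₂ : e ∈ E(G')
    · by_cases hf₂ : f ∈ E(G')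
      · rw [hxy e he₂, hxy f hf₂]
        exact hy.comm _ e f (hinc' e he₂ he) (hinc' f hf₂ hf)
      · rw [hx1 f hf₂ hf₁]
        exact Commute.one_right _
    · rw [hx1 e he₂ he₁]
      exact Commute.one_left _
  have hx : G.IsSol x := by
    refine ⟨fun e he ↦ ?_, hcomm, fun v hv l hl hlv ↦ ?_⟩
    · by_cases he₁ : e = e₀
      · rw [he₁, hx₀, hpp]
      by_cases he₂ : e ∈ E(G')
      · rw [hxy e he₂, hy.sq e he₂]
      · rw [hx1 e he₂ he₁, mul_one]
    · by_cases h1 : v = v₁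
      · subst h1
        refine prod_eq_one_of_enum (hcomm v) (l := e₀ :: (l₀ ++ l₁)) ?_ ?_ ?_ hl hlv
        · rw [List.nodup_cons, List.nodup_append', List.mem_append, hl₀', hl₁']
          refine ⟨?_, hl₀, hl₁, fun e h1 h2 ↦ ?_⟩
          · have := he₀.inc_right
            tauto
          · rw [hl₀'] at h1
            rw [hl₁'] at h2
            exact h2.2 h1.2.1
        · intro e
          rw [List.mem_cons, List.mem_append, hl₀', hl₁']
          constructor
          · rintro (rfl | h | h)
            exacts [he₀.inc_left, h.1, h.1]
          · tauto
        · rw [List.map_cons, List.prod_cons, List.map_append, List.prod_append, hprod₀, one_mul,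
            hx₀, hmap l₁ fun e he ↦ (hu₁ e he).edge_mem, ← hp, hpp]
      by_cases h2 : v = v₂
      · subst h2
        refine prod_eq_one_of_enum (hcomm v) (l := e₀ :: (l₀ ++ l₂)) ?_ ?_ ?_ hl hlv
        · rw [List.nodup_cons, List.nodup_append', List.mem_append, hl₀', hl₂']
          refine ⟨?_, hl₀, hl₂, fun e h1 h2 ↦ ?_⟩
          · have := he₀.inc_left
            tauto
          · rw [hl₀'] at h1
            rw [hl₂'] at h2
            exact h2.2 h1.1
        · intro e
          rw [List.mem_cons, List.mem_append, hl₀', hl₂']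
          constructor
          · rintro (rfl | h | h)
            exacts [he₀.inc_right, h.2.1, h.1]
          · tauto
        · rw [List.map_cons, List.prod_cons, List.map_append, List.prod_append, hprod₀, one_mul,
            hx₀, hmap l₂ fun e he ↦ (hu₂ e he).edge_mem, hpl₂]
      · have hmem : ∀ e, e ∈ l ↔ G'.Inc e v := by
          intro e
          rw [hlv, hG', contractPair_inc_old hu hv h1 h2]
          refine ⟨fun h ↦ ⟨h, fun h' ↦ ?_⟩, fun h ↦ h.1⟩
          obtain h3 | h3 | h3 := h'.1.eq_or_eq_or_eq h'.2 h
          · exact he₀.ne h3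
          · exact h1 h3.symm
          · exact h2 h3.symm
        have hvV : v ∈ V(G') := by
          rw [hG', contractPair_vertexSet]
          exact ⟨v, hv, by simp [h1, h2]⟩
        rw [hmap l fun e he ↦ ((hmem e).mp he).edge_mem]
        exact hy.prod v hvV l hl hmem
  have := h K x hx e ((hE' e).mp he).1 f ((hE' f).mp hf).1
  rwa [hxy e he, hxy f hf] at this

/-- Commutativity passes to minors obtained by one operation. -/
lemma MinorStep.commSols [G.Loopless] (hs : MinorStep G H) (hE : E(G).Finite)
    (h : CommSols.{u, v, w} G) : CommSols.{u, v, w} H := by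
  cases hs with
  | deleteEdge e he => exact h.of_le deleteEdges_le
  | contractEdge e v₁ v₂ u he hu => exact h.contractPair hE he hu
  | deleteVertex v hv => exact h.of_le deleteVerts_le

lemma MinorStep.edgeSet_finite (hs : MinorStep G H) (hE : E(G).Finite) : E(H).Finite := by
  cases hs with
  | deleteEdge e he => exact hE.subset deleteEdges_le.edgeSet_mono
  | contractEdge e v₁ v₂ u he hu =>
    exact hE.subset fun e he ↦ by rw [contractPair_edgeSet] at he; exact he.1
  | deleteVertex v hv => exact hE.subset deleteVerts_le.edgeSet_mono

variable {α' : Type u'} {β' : Type v'} {H' : Graph α' β'}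

lemma Iso.inc_iff (φ : Iso G H') (e : E(G)) (v : V(G)) :
    H'.Inc (φ.edgeEquiv e) (φ.vertexEquiv v) ↔ G.Inc e v := by
  constructor
  · rintro ⟨w, hw⟩
    obtain ⟨w', hw'⟩ := φ.vertexEquiv.surjective ⟨w, hw.right_mem⟩
    refine ⟨w', (φ.isLink_iff e v w').mp ?_⟩
    rwa [hw']
  · rintro ⟨w, hw⟩
    exact ⟨_, (φ.isLink_iff e v ⟨w, hw.right_mem⟩).mpr hw⟩

lemma Iso.commSols (φ : Iso G H') (h : CommSols.{u, v, w} G) : CommSols.{u', v', w} H' := by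
  classical
  intro K _ y hy e he f hf
  let x : β → K := fun e ↦ if h : e ∈ E(G) then y (φ.edgeEquiv ⟨e, h⟩) else 1
  have hxy : ∀ e : E(G), x e = y (φ.edgeEquiv e) := fun e ↦ by simp [x]
  have hx : G.IsSol x := by
    refine ⟨fun e he ↦ ?_, fun v e f he hf ↦ ?_, fun v hv l hl hlv ↦ ?_⟩
    · rw [hxy ⟨e, he⟩]
      exact hy.sq _ (φ.edgeEquiv _).2
    · rw [hxy ⟨e, he.edge_mem⟩, hxy ⟨f, hf.edge_mem⟩]
      exact hy.comm (φ.vertexEquiv ⟨v, he.vertex_mem⟩) _ _ ((φ.inc_iff _ _).mpr he)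
        ((φ.inc_iff _ _).mpr hf)
    · have hmem : ∀ e ∈ l, e ∈ E(G) := fun e he ↦ ((hlv e).mp he).edge_mem
      have hl2 : (l.attachWith (· ∈ E(G)) hmem).Nodup := by
        rw [← List.nodup_map_iff Subtype.val_injective]
        simpa using hl
      have := hy.prod (φ.vertexEquiv ⟨v, hv⟩) (φ.vertexEquiv _).2
        ((l.attachWith (· ∈ E(G)) hmem).map fun e ↦ (φ.edgeEquiv e : β'))
        (hl2.map (Subtype.val_injective.comp φ.edgeEquiv.injective)) (by
          intro e
          simp only [List.mem_map, List.mem_attachWith, hlv]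
          constructor
          · rintro ⟨e', h1, rfl⟩
            exact (φ.inc_iff _ _).mpr h1
          · intro h1
            obtain ⟨e', he'⟩ := φ.edgeEquiv.surjective ⟨e, h1.edge_mem⟩
            refine ⟨e', (φ.inc_iff e' ⟨v, hv⟩).mp (by rw [he']; exact h1), by rw [he']⟩)
      rw [← this, List.map_map]
      conv_lhs => rw [← List.attachWith_map_subtype_val hmem, List.map_map]
      congr 1
      exact List.map_congr_left fun e _ ↦ hxy e
  obtain ⟨e', he'⟩ := φ.edgeEquiv.surjective ⟨e, he⟩
  obtain ⟨f', hf'⟩ := φ.edgeEquiv.surjective ⟨f, hf⟩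
  have := h K x hx e' e'.2 f' f'.2
  rwa [hxy, hxy, he', hf'] at this

/-- Commutativity passes to minors. -/
theorem IsMinor.commSols [hG : G.Loopless] (hm : H'.IsMinor G) (hE : E(G).Finite)
    (h : CommSols.{u, v, w} G) : CommSols.{u', v', w} H' := by
  obtain ⟨G', hG', hφ⟩ := hm
  suffices G'.Loopless ∧ E(G').Finite ∧ CommSols.{u, v, w} G' from hφ.some.commSols this.2.2
  clear hφ
  induction hG' with
  | refl => exact ⟨hG, hE, h⟩
  | tail _ hs ih =>
    have := ih.1
    exact ⟨hs.loopless, hs.edgeSet_finite ih.2.1, hs.commSols ih.2.1 ih.2.2⟩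

end Graph

/-! ### The incidence groups of `C₂ ⊔ C₂` and `K_{3,4}` are not abelian -/

namespace Graph

universe u v w

lemma disjUnion_twoCycle_isLink {e p q : Fin 2 ⊕ Fin 2} :
    (disjUnion twoCycle twoCycle).IsLink e p q ↔ p ≠ q ∧ e.isLeft = p.isLeft ∧
      p.isLeft = q.isLeft := by
  have h01 : ∀ x y : Fin 2, (x = 0 ∧ y = 1 ∨ x = 1 ∧ y = 0) ↔ x ≠ y := by decide
  have h2 : ∀ x : Fin 2, x = 0 ∨ x = 1 := by decide
  rcases e with e | e <;> rcases p with p | p <;> rcases q with q | q <;>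
    simp [disjUnion, twoCycle, h01]
  all_goals exact fun _ ↦ h2 e

lemma disjUnion_twoCycle_inc {e p : Fin 2 ⊕ Fin 2} :
    (disjUnion twoCycle twoCycle).Inc e p ↔ e.isLeft = p.isLeft := by
  simp only [Inc, disjUnion_twoCycle_isLink]
  revert e p
  decide

/-- Two noncommuting involutions, one for the edges of each cycle. -/
theorem not_commSols_disjUnion_twoCycle : ¬ CommSols.{0, 0, 0} (disjUnion twoCycle twoCycle) := by
  intro h
  let x : Fin 2 ⊕ Fin 2 → Equiv.Perm (Fin 3) := fun e ↦
    if e.isLeft then Equiv.swap 0 1 else Equiv.swap 1 2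
  have hE : ∀ e : Fin 2 ⊕ Fin 2, e ∈ E(disjUnion twoCycle twoCycle) :=
    fun e ↦ (disjUnion_twoCycle_inc.mpr rfl : (disjUnion twoCycle twoCycle).Inc e e).edge_mem
  have hc : ∀ v e f, (disjUnion twoCycle twoCycle).Inc e v → (disjUnion twoCycle twoCycle).Inc f v →
      Commute (x e) (x f) := by
    intro v e f he hf
    rw [disjUnion_twoCycle_inc] at he hf
    simp [x, he, hf]
  have hx : IsSol (disjUnion twoCycle twoCycle) x := by
    refine ⟨fun e _ ↦ ?_, hc, fun v hv l hl hlv ↦ ?_⟩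
    · simp only [x]; split_ifs <;> simp
    · rcases v with v | v
      · have h2 : ∀ (v : Fin 2) (e : Fin 2 ⊕ Fin 2),
            e ∈ ([.inl 0, .inl 1] : List (Fin 2 ⊕ Fin 2)) ↔
              e.isLeft = (Sum.inl v : Fin 2 ⊕ Fin 2).isLeft := by
          rintro - (e | e)
          all_goals fin_cases e <;> simp
        exact prod_eq_one_of_enum (hc (.inl v)) (l := [.inl 0, .inl 1]) (by simp)
          (fun e ↦ (h2 v e).trans disjUnion_twoCycle_inc.symm) (by simp [x]) hl hlv
      · have h2 : ∀ (v : Fin 2) (e : Fin 2 ⊕ Fin 2),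
            e ∈ ([.inr 0, .inr 1] : List (Fin 2 ⊕ Fin 2)) ↔
              e.isLeft = (Sum.inr v : Fin 2 ⊕ Fin 2).isLeft := by
          rintro - (e | e)
          all_goals fin_cases e <;> simp
        exact prod_eq_one_of_enum (hc (.inr v)) (l := [.inr 0, .inr 1]) (by simp)
          (fun e ↦ (h2 v e).trans disjUnion_twoCycle_inc.symm) (by simp [x]) hl hlv
  have := h _ x hx (.inl 0) (hE _) (.inr 0) (hE _)
  have h2 : ¬ (Equiv.swap (0 : Fin 3) 1 * Equiv.swap 1 2 = Equiv.swap 1 2 * Equiv.swap 0 1) := by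
    decide
  exact h2 this

lemma completeBipartite_isLink {m n : ℕ} {e : Sym2 (Fin m ⊕ Fin n)} {p q : Fin m ⊕ Fin n} :
    (completeBipartite m n).IsLink e p q ↔ e = s(p, q) ∧ p.isLeft ≠ q.isLeft := by
  simp only [completeBipartite, ofSimpleGraph_isLink]
  constructor
  · rintro ⟨rfl, h⟩
    rcases p with p | p <;> rcases q with q | q <;> simp_all
  · rintro ⟨rfl, h⟩
    rcases p with p | p <;> rcases q with q | q <;> simp_all

/-- Bit flips and sign changes: the two-qubit Pauli operators `X ⊗ 1`, `1 ⊗ X`, `Z ⊗ 1`, `1 ⊗ Z`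
as permutations of the signed computational basis. The first coordinate is the sign. -/
def pauli : Fin 4 → Equiv.Perm (Bool × Bool × Bool)
  | 0 => Function.Involutive.toPerm (fun t ↦ (t.1, !t.2.1, t.2.2))
    (by rintro ⟨_ | _, _ | _, _ | _⟩ <;> rfl)
  | 1 => Function.Involutive.toPerm (fun t ↦ (t.1, t.2.1, !t.2.2))
    (by rintro ⟨_ | _, _ | _, _ | _⟩ <;> rfl)
  | 2 => Function.Involutive.toPerm (fun t ↦ (t.1 ^^ t.2.1, t.2.1, t.2.2))
    (by rintro ⟨_ | _, _ | _, _ | _⟩ <;> rfl)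
  | 3 => Function.Involutive.toPerm (fun t ↦ (t.1 ^^ t.2.2, t.2.1, t.2.2))
    (by rintro ⟨_ | _, _ | _, _ | _⟩ <;> rfl)

/-- A `3 × 4` array of Pauli operators in which the entries of each row, and of each column, commute
and multiply to the identity. -/
def pauliArray : Fin 3 → Fin 4 → Equiv.Perm (Bool × Bool × Bool)
  | 0, 0 => pauli 0
  | 0, 1 => pauli 1
  | 0, 2 => pauli 0
  | 0, 3 => pauli 1
  | 1, 0 => pauli 3
  | 1, 1 => pauli 2
  | 1, 2 => pauli 3
  | 1, 3 => pauli 2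
  | 2, 0 => pauli 0 * pauli 3
  | 2, 1 => pauli 1 * pauli 2
  | 2, 2 => pauli 0 * pauli 3
  | 2, 3 => pauli 1 * pauli 2

/-- The array `pauliArray` as a function on the edges of `K_{3,4}`. -/
def pauliEdge : Sym2 (Fin 3 ⊕ Fin 4) → Equiv.Perm (Bool × Bool × Bool) :=
  Sym2.lift ⟨fun p q ↦ match p, q with
    | .inl i, .inr j => pauliArray i j
    | .inr j, .inl i => pauliArray i j
    | _, _ => 1, by rintro (_ | _) (_ | _) <;> rfl⟩

theorem not_commSols_completeBipartite : ¬ CommSols.{0, 0, 0} (completeBipartite 3 4) := by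
  intro h
  have hlink : ∀ (i : Fin 3) (j : Fin 4),
      (completeBipartite 3 4).IsLink s(.inl i, .inr j) (.inl i) (.inr j) :=
    fun i j ↦ completeBipartite_isLink.mpr ⟨rfl, by simp⟩
  have hincl : ∀ e i, (completeBipartite 3 4).Inc e (.inl i) ↔ ∃ j, e = s(.inl i, .inr j) := by
    intro e i
    constructor
    · rintro ⟨q, hq⟩
      rw [completeBipartite_isLink] at hq
      obtain ⟨rfl, h⟩ := hq
      rcases q with q | q
      · simp at h
      · exact ⟨q, rfl⟩
    · rintro ⟨j, rfl⟩
      exact (hlink i j).inc_left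
  have hincr : ∀ e j, (completeBipartite 3 4).Inc e (.inr j) ↔ ∃ i, e = s(.inl i, .inr j) := by
    intro e j
    constructor
    · rintro ⟨q, hq⟩
      rw [completeBipartite_isLink] at hq
      obtain ⟨rfl, h⟩ := hq
      rcases q with q | q
      · exact ⟨q, Sym2.eq_swap⟩
      · simp at h
    · rintro ⟨i, rfl⟩
      exact (hlink i j).inc_right
  have hval : ∀ i j, pauliEdge s(.inl i, .inr j) = pauliArray i j := fun i j ↦ rfl
  have sq : ∀ i j, pauliArray i j * pauliArray i j = 1 := by decide
  have row : ∀ i j j', pauliArray i j * pauliArray i j' = pauliArray i j' * pauliArray i j := by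
    decide
  have col : ∀ i i' j, pauliArray i j * pauliArray i' j = pauliArray i' j * pauliArray i j := by
    decide
  have hc : ∀ v e f, (completeBipartite 3 4).Inc e v → (completeBipartite 3 4).Inc f v →
      Commute (pauliEdge e) (pauliEdge f) := by
    rintro (v | v) e f he hf
    · obtain ⟨j, rfl⟩ := (hincl e v).mp he
      obtain ⟨j', rfl⟩ := (hincl f v).mp hf
      exact row v j j'
    · obtain ⟨j, rfl⟩ := (hincr e v).mp he
      obtain ⟨j', rfl⟩ := (hincr f v).mp hf
      exact col j j' v
  have hx : IsSol (completeBipartite 3 4) pauliEdge := by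
    refine ⟨fun e he ↦ ?_, hc, fun v hv l hl hlv ↦ ?_⟩
    · obtain ⟨p, q, hpq⟩ := exists_isLink_of_mem_edgeSet he
      rcases p with p | p
      · obtain ⟨j, rfl⟩ := (hincl e p).mp hpq.inc_left
        exact sq p j
      · obtain ⟨j, rfl⟩ := (hincr e p).mp hpq.inc_left
        exact sq j p
    · rcases v with v | v
      · refine prod_eq_one_of_enum (hc (.inl v))
          (l := (List.finRange 4).map fun j ↦ s(.inl v, .inr j)) ?_ ?_ ?_ hl hlv
        · exact (List.nodup_finRange 4).map fun j j' hjj ↦ by simpa using hjj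
        · intro e
          rw [hincl]
          simp [eq_comm]
        · have : ∀ v, ((List.finRange 4).map fun j ↦ pauliArray v j).prod = 1 := by decide
          rw [List.map_map]
          exact this v
      · refine prod_eq_one_of_enum (hc (.inr v))
          (l := (List.finRange 3).map fun i ↦ s(.inl i, .inr v)) ?_ ?_ ?_ hl hlv
        · exact (List.nodup_finRange 3).map fun j j' hjj ↦ by simpa using hjj
        · intro e
          rw [hincr]
          simp [eq_comm]
        · have : ∀ v, ((List.finRange 3).map fun j ↦ pauliArray j v).prod = 1 := by decide
          rw [List.map_map]
          exact this v
  have := h _ _ hx _ (hlink 0 0).edge_mem _ (hlink 1 1).edge_mem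
  rw [hval, hval] at this
  have h2 : ¬ (pauliArray 0 0 * pauliArray 1 1 = pauliArray 1 1 * pauliArray 0 0) := by decide
  exact h2 this

end Graph

/-! ### Minors from subgraphs and from disjoint cycles -/

namespace Graph

universe u v u' v'

open EdgeMult Finset

variable {α : Type u} {β : Type v} {α' : Type u'} {β' : Type v'}
variable {G G' H : Graph α β} {H' : Graph α' β'}

lemma IsMinor.of_step (hs : MinorStep G G') (h : H'.IsMinor G') : H'.IsMinor G := by
  obtain ⟨G₁, h₁, h₂⟩ := h
  exact ⟨G₁, h₁.head hs, h₂⟩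

lemma MinorStep.vertexSet_finite (hs : MinorStep G H) (hV : V(G).Finite) : V(H).Finite := by
  cases hs with
  | deleteEdge e he => exact hV
  | contractEdge e v₁ v₂ u he hu =>
    rw [contractPair_vertexSet]
    exact hV.image _
  | deleteVertex v hv => exact hV.subset deleteVerts_le.vertexSet_mono

lemma MinorStep.reflTransGen_of_le (hV : V(G).Finite) (hE : E(G).Finite) (h : H ≤ G) :
    Relation.ReflTransGen MinorStep G H := by
  generalize hn : V(G).ncard + E(G).ncard = n
  induction n using Nat.strong_induction_on generalizing G with
  | _ n ih =>
    by_cases h1 : V(G) ⊆ V(H)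
    · by_cases h2 : E(G) ⊆ E(H)
      · rw [(Compatible.of_le h).ext (h.vertexSet_mono.antisymm h1) (h.edgeSet_mono.antisymm h2)]
      · obtain ⟨e, heG, heH⟩ := Set.not_subset.mp h2
        have hs := MinorStep.deleteEdge G e heG
        refine (ih (G := G.deleteEdges {e}) _ ?_ hV (hs.edgeSet_finite hE) ⟨h.vertexSet_mono,
          fun f x y hf ↦ ?_⟩ rfl).head hs
        · have : E(G.deleteEdges {e}).ncard < E(G).ncard :=
            Set.ncard_lt_ncard (by simpa using heG) hE
          rw [← hn]
          exact Nat.add_lt_add_left this _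
        · rw [deleteEdges_isLink]
          exact ⟨hf.mono h, fun hfe ↦ heH (Set.mem_singleton_iff.mp hfe ▸ hf.edge_mem)⟩
    · obtain ⟨v, hvG, hvH⟩ := Set.not_subset.mp h1
      have hs := MinorStep.deleteVertex G v hvG
      refine (ih _ ?_ (hs.vertexSet_finite hV) (hs.edgeSet_finite hE)
        ⟨fun w hw ↦ ?_, fun f x y hf ↦ ?_⟩ rfl).head hs
      · have h3 : V(G.deleteVerts {v}).ncard < V(G).ncard :=
          Set.ncard_lt_ncard (by simpa using hvG) hV
        have h4 : E(G.deleteVerts {v}).ncard ≤ E(G).ncard :=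
          Set.ncard_le_ncard deleteVerts_le.edgeSet_mono hE
        omega
      · rw [vertexSet_deleteVerts]
        exact ⟨h.vertexSet_mono hw, fun hwv ↦ hvH (Set.mem_singleton_iff.mp hwv ▸ hw)⟩
      · rw [deleteVerts_isLink]
        exact ⟨hf.mono h, fun hx ↦ hvH (Set.mem_singleton_iff.mp hx ▸ hf.left_mem),
          fun hy ↦ hvH (Set.mem_singleton_iff.mp hy ▸ hf.right_mem)⟩

/-- The image of an injective map of graphs is a minor of the target. -/
lemma isMinor_of_injective (hV : V(G).Finite) (hE : E(G).Finite) {g : α' → α} {k : E(H') → β}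
    (hg : Set.InjOn g V(H')) (hk : Function.Injective k) (hgV : ∀ v ∈ V(H'), g v ∈ V(G))
    (hgk : ∀ (e : E(H')) x y, H'.IsLink e x y → G.IsLink (k e) (g x) (g y)) : H'.IsMinor G := by
  have hle : (G.induce (g '' V(H'))).restrict (Set.range k) ≤ G :=
    restrict_le.trans (induce_le (by rintro _ ⟨v, hv, rfl⟩; exact hgV v hv))
  have hEk : E((G.induce (g '' V(H'))).restrict (Set.range k)) = Set.range k := by
    rw [edgeSet_restrict, Set.inter_eq_right]
    rintro _ ⟨e, rfl⟩
    obtain ⟨x, y, hxy⟩ := exists_isLink_of_mem_edgeSet e.2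
    exact ⟨_, _, hgk e x y hxy, ⟨x, hxy.left_mem, rfl⟩, ⟨y, hxy.right_mem, rfl⟩⟩
  let φ : V(H') ≃ V((G.induce (g '' V(H'))).restrict (Set.range k)) :=
    (Equiv.Set.imageOfInjOn g V(H') hg).trans (Equiv.setCongr rfl)
  let χ : E(H') ≃ E((G.induce (g '' V(H'))).restrict (Set.range k)) :=
    (Equiv.ofInjective k hk).trans (Equiv.setCongr hEk.symm)
  refine ⟨_, MinorStep.reflTransGen_of_le hV hE hle, ⟨φ.symm, χ.symm, fun e x y ↦ ?_⟩⟩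
  obtain ⟨e, rfl⟩ := χ.surjective e
  obtain ⟨x, rfl⟩ := φ.surjective x
  obtain ⟨y, rfl⟩ := φ.surjective y
  rw [Equiv.symm_apply_apply, Equiv.symm_apply_apply, Equiv.symm_apply_apply, hle.isLink_iff
    (Subtype.coe_prop _)]
  change H'.IsLink e x y ↔ G.IsLink (k e) (g x) (g y)
  refine ⟨hgk e x y, fun h ↦ ?_⟩
  obtain ⟨p, q, hpq⟩ := exists_isLink_of_mem_edgeSet e.2
  obtain ⟨h1, h2⟩ | ⟨h1, h2⟩ := (hgk e p q hpq).eq_and_eq_or_eq_and_eq h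
  · rw [← hg hpq.left_mem x.2 h1, ← hg hpq.right_mem y.2 h2]
    exact hpq
  · rw [← hg hpq.left_mem y.2 h1, ← hg hpq.right_mem x.2 h2]
    exact hpq.symm

lemma exists_pair_isLink (hE : E(G).Finite) {v w : α} (h : 2 ≤ G.mult v w) :
    ∃ e f, e ≠ f ∧ G.IsLink e v w ∧ G.IsLink f v w := by
  obtain ⟨e, he, f, hf, hef⟩ := (Set.one_lt_ncard (finite_isLink hE v w)).mp h
  exact ⟨e, f, hef, he, hf⟩

lemma isMinor_of_double_edges [G.Loopless] (hV : V(G).Finite) (hE : E(G).Finite) {a b c d : α}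
    (hab : 2 ≤ G.mult a b) (hcd : 2 ≤ G.mult c d) (hac : a ≠ c) (had : a ≠ d) (hbc : b ≠ c)
    (hbd : b ≠ d) : (disjUnion twoCycle twoCycle).IsMinor G := by
  obtain ⟨e₁, e₂, hne, he₁, he₂⟩ := exists_pair_isLink hE hab
  obtain ⟨f₁, f₂, hnf, hf₁, hf₂⟩ := exists_pair_isLink hE hcd
  have hef : ∀ {e f : β}, G.IsLink e a b → G.IsLink f c d → e ≠ f := by
    rintro e _ he hf rfl
    obtain h | h := he.left_eq_or_eq hf
    exacts [hac h, had h]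
  have h1 := (hef he₁ hf₁).symm
  have h2 := (hef he₁ hf₂).symm
  have h3 := (hef he₂ hf₁).symm
  have h4 := (hef he₂ hf₂).symm
  have h5 := he₁.ne
  have h6 := hf₁.ne
  refine isMinor_of_injective hV hE (g := Sum.elim ![a, b] ![c, d])
    (k := fun e ↦ Sum.elim ![e₁, e₂] ![f₁, f₂] e.1) (Function.Injective.injOn ?_)
    (Function.Injective.comp (g := Sum.elim ![e₁, e₂] ![f₁, f₂]) ?_ Subtype.val_injective) ?_ ?_
  · clear hef he₁ he₂ hf₁ hf₂
    rintro (x | x) (y | y) hxy <;> fin_cases x <;> fin_cases y <;> simp_all [eq_comm]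
  · have h1' := h1.symm
    have h2' := h2.symm
    have h3' := h3.symm
    have h4' := h4.symm
    clear hef he₁ he₂ hf₁ hf₂
    rintro (x | x) (y | y) hxy <;> fin_cases x <;> fin_cases y <;> simp_all
  · rintro (x | x) - <;> fin_cases x
    exacts [he₁.left_mem, he₁.right_mem, hf₁.left_mem, hf₁.right_mem]
  · rintro ⟨e, he⟩ x y hxy
    rw [disjUnion_twoCycle_isLink] at hxy
    rcases e with e | e <;> rcases x with x | x <;> rcases y with y | y <;> simp at hxy <;>
      fin_cases e <;> fin_cases x <;> fin_cases y <;>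
      simp_all [he₁.symm, he₂.symm, hf₁.symm, hf₂.symm]

lemma IsCone.isMinor (hV : V(G).Finite) (hE : E(G).Finite) {a b c : α} {W : Finset α}
    (h : G.IsCone a b c W) (hW : 4 ≤ #W) : (completeBipartite 3 4).IsMinor G := by
  obtain ⟨W', hW', hc⟩ := exists_subset_card_eq hW
  let ψ : Fin 4 ≃ W' := (Fintype.equivFinOfCardEq (by simpa using hc)).symm
  let w : Fin 4 → α := fun j ↦ ψ j
  have hw : ∀ j, w j ∈ W := fun j ↦ hW' (ψ j).2
  have hinj : Function.Injective w := Subtype.val_injective.comp ψ.injective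
  let g : Fin 3 ⊕ Fin 4 → α := Sum.elim ![a, b, c] w
  have hlink : ∀ i j, ∃ e, G.IsLink e (g (.inl i)) (g (.inr j)) := by
    intro i j
    obtain ⟨e₁, h₁⟩ := h.one_a _ (hw j)
    obtain ⟨e₂, h₂⟩ := h.one_b _ (hw j)
    obtain ⟨e₃, h₃⟩ := h.one_c _ (hw j)
    fin_cases i
    exacts [⟨e₁, ((h₁ e₁).mpr rfl).symm⟩, ⟨e₂, ((h₂ e₂).mpr rfl).symm⟩,
      ⟨e₃, ((h₃ e₃).mpr rfl).symm⟩]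
  have hk : ∀ e : E(completeBipartite 3 4), ∃ f, ∀ x y, (completeBipartite 3 4).IsLink e x y →
      G.IsLink f (g x) (g y) := by
    rintro ⟨e, he⟩
    have key : ∀ i j, e = s(.inl i, .inr j) → ∃ f, ∀ x y,
        (completeBipartite 3 4).IsLink e x y → G.IsLink f (g x) (g y) := by
      rintro i j rfl
      obtain ⟨f, hf⟩ := hlink i j
      refine ⟨f, fun x y hxy ↦ ?_⟩
      rw [completeBipartite_isLink, Sym2.eq_iff] at hxy
      obtain ⟨⟨rfl, rfl⟩ | ⟨rfl, rfl⟩, -⟩ := hxy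
      exacts [hf, hf.symm]
    obtain ⟨p, q, hpq⟩ := exists_isLink_of_mem_edgeSet he
    rw [completeBipartite_isLink] at hpq
    obtain ⟨h1, h2⟩ := hpq
    rcases p with p | p <;> rcases q with q | q
    · simp at h2
    · exact key p q h1
    · exact key q p (h1.trans Sym2.eq_swap)
    · simp at h2
  choose k hk using hk
  have hg : Function.Injective g := by
    have hab := h.ab
    have hac := h.ac
    have hbc := h.bc
    have h1 : ∀ j, w j ≠ a := fun j hj ↦ h.ha (hj ▸ hw j)
    have h2 : ∀ j, w j ≠ b := fun j hj ↦ h.hb (hj ▸ hw j)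
    have h3 : ∀ j, w j ≠ c := fun j hj ↦ h.hc (hj ▸ hw j)
    refine Function.Injective.sumElim ?_ hinj ?_
    · intro i j hij
      fin_cases i <;> fin_cases j <;> simp_all
    · intro i j
      fin_cases i
      exacts [(h1 j).symm, (h2 j).symm, (h3 j).symm]
  refine isMinor_of_injective hV hE hg.injOn (fun e f hef ↦ ?_) ?_ hk
  · obtain ⟨p, q, hpq⟩ := exists_isLink_of_mem_edgeSet e.2
    obtain ⟨r, s, hrs⟩ := exists_isLink_of_mem_edgeSet f.2
    have h1 := hk e p q hpq
    have h2 := hk f r s hrs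
    rw [hef] at h1
    rw [completeBipartite_isLink] at hpq hrs
    refine Subtype.ext (hpq.1.trans (Eq.trans ?_ hrs.1.symm))
    rw [Sym2.eq_iff]
    exact (h1.eq_and_eq_or_eq_and_eq h2).imp (fun h ↦ ⟨hg h.1, hg h.2⟩) fun h ↦ ⟨hg h.1, hg h.2⟩
  · rintro (i | j) -
    · fin_cases i
      exacts [(h.mem a).mpr (by simp), (h.mem b).mpr (by simp), (h.mem c).mpr (by simp)]
    · exact (h.mem _).mpr (by simp [g, hw])

/-- Multiplicities after contracting the edges between `v` and `w` to `v`. -/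
lemma mult_contractPair_of_ne {v w a b : α} (ha : a ≠ v) (ha' : a ≠ w) (hb : b ≠ v) (hb' : b ≠ w) :
    (G.contractPair v w v).mult a b = G.mult a b := by
  rw [mult, mult]
  congr 1
  ext e
  simp only [Set.mem_ofPred_eq, contractPair_isLink]
  constructor
  · rintro ⟨p, q, h, -, hp, hq⟩
    split_ifs at hp with h1
    · exact absurd hp.symm ha
    split_ifs at hq with h2
    · exact absurd hq.symm hb
    exact hp ▸ hq ▸ h
  · intro h
    refine ⟨a, b, h, fun hi ↦ ?_, by simp [ha, ha'], by simp [hb, hb']⟩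
    obtain h1 | h1 := hi.1.eq_or_eq_of_isLink h
    exacts [ha h1.symm, hb h1.symm]

lemma mult_contractPair_self (hE : E(G).Finite) {v w a : α} (hvw : v ≠ w) (ha : a ≠ v)
    (ha' : a ≠ w) : (G.contractPair v w v).mult a v = G.mult a v + G.mult a w := by
  rw [mult, mult, mult, ← Set.ncard_union_eq ?_ (finite_isLink hE a v) (finite_isLink hE a w)]
  · congr 1
    ext e
    simp only [Set.mem_ofPred_eq, contractPair_isLink, Set.mem_union]
    constructor
    · rintro ⟨p, q, h, -, hp, hq⟩
      split_ifs at hp with h1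
      · exact absurd hp.symm ha
      split_ifs at hq with h2
      · obtain rfl | rfl := h2
        exacts [Or.inl (hp ▸ h), Or.inr (hp ▸ h)]
      · exact Or.inl (hp ▸ hq ▸ h)
    · rintro (h | h)
      · refine ⟨a, v, h, fun hi ↦ ?_, by simp [ha, ha'], by simp⟩
        obtain h1 | h1 := hi.2.eq_or_eq_of_isLink h
        exacts [ha' h1.symm, hvw h1.symm]
      · refine ⟨a, w, h, fun hi ↦ ?_, by simp [ha, ha'], by simp⟩
        obtain h1 | h1 := hi.1.eq_or_eq_of_isLink h
        exacts [ha h1.symm, hvw h1]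
  · rw [Set.disjoint_left]
    exact fun e he he' ↦ hvw (IsLink.right_unique he he')

lemma vertexSet_contractPair_subset {v w : α} (hvw : v ≠ w) (hv : v ∈ V(G)) :
    V(G.contractPair v w v) ⊆ V(G) \ {w} := by
  rw [contractPair_vertexSet]
  rintro _ ⟨p, hp, rfl⟩
  dsimp only
  split_ifs with h
  · exact ⟨hv, hvw⟩
  · exact ⟨hp, fun h' ↦ h (Or.inr h')⟩

variable [DecidableEq α]

/-- A cycle without multiple edges survives, with fewer vertices, the contraction of an edge. -/
lemma isCyc_contractPair [G.Loopless] (hE : E(G).Finite) {S : Finset α} (hS : IsCyc G.mult S)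
    {v w : α} (hv : v ∈ S) (hw : w ∈ S) (hvw : v ≠ w) (h1 : G.mult v w = 1) :
    IsCyc (G.contractPair v w v).mult (S.erase w) := by
  have hvS' : v ∈ S.erase w := mem_erase.mpr ⟨hvw, hv⟩
  have hsplit : ∀ p, degIn G.mult p ((S.erase w).erase v) + G.mult p v + G.mult p w =
      degIn G.mult p S := fun p ↦ by rw [degIn_erase hvS', degIn_erase hw]
  have hmem : ∀ {p}, p ∈ (S.erase w).erase v → p ≠ v ∧ p ≠ w := fun hp ↦
    ⟨(mem_erase.mp hp).1, (mem_erase.mp (mem_erase.mp hp).2).1⟩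
  have : (G.contractPair v w v).Loopless := contractPair_loopless (by simp)
  refine ⟨⟨v, hvS'⟩, fun p hp ↦ ?_⟩
  rw [← degIn_erase hvS']
  by_cases hpv : p = v
  · subst hpv
    have h2 : degIn (G.contractPair p w p).mult p ((S.erase w).erase p) =
        degIn G.mult p ((S.erase w).erase p) + degIn G.mult w ((S.erase w).erase p) := by
      simp only [degIn]
      rw [← sum_add_distrib]
      refine sum_congr rfl fun q hq ↦ ?_
      rw [mult_comm, mult_contractPair_self hE hvw (hmem hq).1 (hmem hq).2, mult_comm,
        mult_comm _ w]
    have h3 := hsplit p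
    have h4 := hsplit w
    have h5 := hS.2 p hv
    have h6 := hS.2 w hw
    rw [mult_self] at h3 h4
    rw [mult_comm] at h4
    omega
  · have hp' := mem_erase.mp hp
    have h2 : degIn (G.contractPair v w v).mult p ((S.erase w).erase v) =
        degIn G.mult p ((S.erase w).erase v) := sum_congr rfl fun q hq ↦
      mult_contractPair_of_ne hpv hp'.1 (hmem hq).1 (hmem hq).2
    rw [h2, mult_contractPair_self hE hvw hpv hp'.1, ← add_assoc, hsplit]
    exact hS.2 p hp'.2

/-- Two disjoint cycles can be contracted to two disjoint pairs of parallel edges. -/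
theorem isMinor_of_disjoint_isCyc [G.Loopless] (hV : V(G).Finite) (hE : E(G).Finite)
    {S T : Finset α} (hS : IsCyc G.mult S) (hT : IsCyc G.mult T) (hST : Disjoint S T) :
    (disjUnion twoCycle twoCycle).IsMinor G := by
  generalize hn : V(G).ncard = n
  induction n using Nat.strong_induction_on generalizing G S T with
  | _ n ih =>
    have contract : ∀ {S T : Finset α}, IsCyc G.mult S → IsCyc G.mult T → Disjoint S T →
        (∀ a ∈ S, ∀ b ∈ S, ¬ 2 ≤ G.mult a b) → (disjUnion twoCycle twoCycle).IsMinor G := by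
      intro S T hS hT hST h2
      obtain ⟨v, hv⟩ := hS.1
      have h0 : degIn G.mult v S ≠ 0 := by have := hS.2 v hv; omega
      obtain ⟨w, hw, hw0⟩ := exists_ne_zero_of_sum_ne_zero h0
      have h1 : G.mult v w = 1 := by have := h2 v hv w hw; omega
      obtain ⟨e, he⟩ := mult_eq_one_iff.mp h1
      have he := (he e).mpr rfl
      have hs := MinorStep.contractEdge G e v w v he (by simp)
      have := hs.loopless
      refine .of_step hs (ih _ ?_ (hs.vertexSet_finite hV) (hs.edgeSet_finite hE)
        (isCyc_contractPair hE hS hv hw he.ne h1) (T := T) ⟨hT.1, fun p hp ↦ ?_⟩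
        (hST.mono_left (erase_subset _ _)) rfl)
      · rw [← hn]
        refine (Set.ncard_le_ncard (vertexSet_contractPair_subset he.ne he.left_mem)
          hV.sdiff).trans_lt (Set.ncard_lt_ncard ?_ hV)
        simpa using he.right_mem
      · have hne : ∀ {q}, q ∈ T → q ≠ v ∧ q ≠ w := fun hq ↦
          ⟨fun h ↦ disjoint_left.mp hST hv (h ▸ hq), fun h ↦ disjoint_left.mp hST hw (h ▸ hq)⟩
        have h3 : degIn (G.contractPair v w v).mult p T = degIn G.mult p T := sum_congr rfl
          fun q hq ↦ mult_contractPair_of_ne (hne hp).1 (hne hp).2 (hne hq).1 (hne hq).2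
        rw [h3]
        exact hT.2 p hp
    by_cases h2 : ∃ a ∈ S, ∃ b ∈ S, 2 ≤ G.mult a b
    · by_cases h3 : ∃ c ∈ T, ∃ d ∈ T, 2 ≤ G.mult c d
      · obtain ⟨a, ha, b, hb, hab⟩ := h2
        obtain ⟨c, hc, d, hd, hcd⟩ := h3
        have hne : ∀ {p q}, p ∈ S → q ∈ T → p ≠ q := fun hp hq h ↦
          disjoint_left.mp hST hp (h ▸ hq)
        exact isMinor_of_double_edges hV hE hab hcd (hne ha hc) (hne ha hd) (hne hb hc) (hne hb hd)
      · push Not at h3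
        exact contract hT hS hST.symm fun a ha b hb ↦ by have := h3 a ha b hb; omega
    · push Not at h2
      exact contract hS hT hST fun a ha b hb ↦ by have := h2 a ha b hb; omega

end Graph

/-! ### Graphs without the two minors have commutative solutions -/

namespace Graph

universe u v w

open EdgeMult Finset

variable {α : Type u} {β : Type v} {K : Type w} [Group K]
variable {G H : Graph α β} {x : β → K}

/-- Removing edges on which a solution is trivial leaves a solution. -/
lemma IsSol.of_le (hx : G.IsSol x) (hE : E(G).Finite) (hle : H ≤ G)
    (h1 : ∀ e ∈ E(G), e ∉ E(H) → x e = 1) : H.IsSol x := by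
  classical
  have hcomm : ∀ v e f, H.Inc e v → H.Inc f v → Commute (x e) (x f) := fun v e f he hf ↦
    hx.comm v e f (he.mono hle) (hf.mono hle)
  refine ⟨fun e he ↦ hx.sq e (hle.edgeSet_mono he), hcomm, fun v hv l hl hlv ↦ ?_⟩
  obtain ⟨l', hl', hlv'⟩ := exists_enum (finite_setOf_inc hE v)
  refine prod_eq_one_of_enum (hcomm v) (hl'.filter (· ∈ E(H))) (fun e ↦ ?_) ?_ hl hlv
  · rw [List.mem_filter, hlv', decide_eq_true_iff]
    exact ⟨fun ⟨h2, h3⟩ ↦ (hle.inc_congr h3).mpr h2, fun h2 ↦ ⟨h2.mono hle, h2.edge_mem⟩⟩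
  · rw [← list_prod_map_filter x (· ∈ E(H)) l' fun e he he' ↦
      h1 e (Inc.edge_mem ((hlv' e).mp he)) he']
    exact hx.prod v (hle.vertexSet_mono hv) l' hl' hlv'

/-- A vertex of degree at most one may be deleted. -/
lemma IsSol.commute_of_subsingleton (hx : G.IsSol x) (hE : E(G).Finite) {v : α} (hv : v ∈ V(G))
    (hd : ∀ e f, G.Inc e v → G.Inc f v → e = f)
    (h : CommSols.{u, v, w} (G.deleteVerts {v})) :
    ∀ e ∈ E(G), ∀ f ∈ E(G), Commute (x e) (x f) := by
  have h1 : ∀ e, G.Inc e v → x e = 1 := fun e he ↦ by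
    simpa using hx.prod v hv [e] (List.nodup_singleton e) fun f ↦ by
      rw [List.mem_singleton]
      exact ⟨fun hf ↦ hf ▸ he, fun hf ↦ hd f e hf he⟩
  have h2 : ∀ e ∈ E(G), e ∉ E(G.deleteVerts {v}) → x e = 1 := by
    intro e he he'
    obtain ⟨p, q, hpq⟩ := exists_isLink_of_mem_edgeSet he
    by_cases hp : p = v
    · exact h1 e (hp ▸ hpq.inc_left)
    by_cases hq : q = v
    · exact h1 e (hq ▸ hpq.inc_right)
    · exact absurd ((deleteVerts_isLink G {v}).mpr ⟨hpq, hp, hq⟩).edge_mem he'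
  have h3 := h K x (hx.of_le hE deleteVerts_le h2)
  intro e he f hf
  by_cases he' : e ∈ E(G.deleteVerts {v})
  · by_cases hf' : f ∈ E(G.deleteVerts {v})
    · exact h3 e he' f hf'
    · rw [h2 f hf hf']
      exact Commute.one_right _
  · rw [h2 e he he']
    exact Commute.one_left _

/-- If two edges with different other ends are the only edges at `v`, then a solution takes the same
value on them, and one of them may be contracted. -/
lemma IsSol.commute_of_pair [G.Loopless] (hx : G.IsSol x) (hE : E(G).Finite) {v p q : α} {e f : β}
    (he : G.IsLink e v p) (hf : G.IsLink f v q) (hpq : p ≠ q)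
    (hd : ∀ g, G.Inc g v ↔ g = e ∨ g = f)
    (h : CommSols.{u, v, w} (G.contractPair v p p)) :
    ∀ a ∈ E(G), ∀ b ∈ E(G), Commute (x a) (x b) := by
  classical
  have hne : e ≠ f := fun hef ↦ hpq (IsLink.right_unique he (hef ▸ hf))
  have hu : p ∉ V(G) \ {v, p} := by simp
  have hxef : x e = x f := by
    have h1 : x e * x f = 1 := by
      simpa using hx.prod v he.left_mem [e, f] (by simpa using hne) fun g ↦ by
        rw [hd]
        simp
    exact (eq_inv_of_mul_eq_one_left h1).trans (inv_eq_of_mul_eq_one_left (hx.sq f hf.edge_mem))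
  have hboth : ∀ g, (G.Inc g v ∧ G.Inc g p) ↔ g = e := by
    intro g
    rw [hd]
    constructor
    · rintro ⟨rfl | rfl, h2⟩
      · rfl
      · obtain h3 | h3 := h2.eq_or_eq_of_isLink hf
        exacts [absurd h3 he.ne.symm, absurd h3 hpq]
    · rintro rfl
      exact ⟨Or.inl rfl, he.inc_right⟩
  have hfp : ¬ G.Inc f p := fun h1 ↦ hne ((hboth f).mp ⟨hf.inc_left, h1⟩).symm
  -- in the contracted graph, `f` takes the place of `e` at `p`
  have hnew : ∀ g, (G.contractPair v p p).Inc g p ↔ g = f ∨ (G.Inc g p ∧ g ≠ e) := by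
    intro g
    rw [contractPair_inc_new hu, hboth, hd]
    constructor
    · rintro ⟨(h1 | h1) | h1, h2⟩
      exacts [absurd h1 h2, Or.inl h1, Or.inr ⟨h1, h2⟩]
    · rintro (rfl | h1)
      exacts [⟨Or.inl (Or.inr rfl), hne.symm⟩, ⟨Or.inr h1.1, h1.2⟩]
  have hvV : ∀ {r}, r ∈ V(G.contractPair v p p) → r ∈ V(G) ∧ r ≠ v := by
    intro r hr
    rw [contractPair_vertexSet] at hr
    obtain ⟨s, hs, rfl⟩ := hr
    dsimp only
    split_ifs with h1
    · exact ⟨he.right_mem, he.ne.symm⟩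
    · exact ⟨hs, fun h2 ↦ h1 (Or.inl h2)⟩
  have hold : ∀ r ∈ V(G.contractPair v p p), r ≠ p →
      ∀ g, (G.contractPair v p p).Inc g r ↔ G.Inc g r := by
    intro r hr hrp g
    rw [contractPair_inc_old hu (hvV hr).1 (hvV hr).2 hrp, hboth, and_iff_left_iff_imp]
    rintro h1 rfl
    obtain h2 | h2 := h1.eq_or_eq_of_isLink he
    exacts [(hvV hr).2 h2, hrp h2]
  have hrep : ∀ g, (G.contractPair v p p).Inc g p → ∃ g', G.Inc g' p ∧ x g' = x g := by
    intro g hg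
    obtain rfl | hg := (hnew g).mp hg
    exacts [⟨e, he.inc_right, hxef⟩, ⟨g, hg.1, rfl⟩]
  have hcomm : ∀ r g g', (G.contractPair v p p).Inc g r → (G.contractPair v p p).Inc g' r →
      Commute (x g) (x g') := by
    intro r g g' hg hg'
    by_cases hrp : r = p
    · subst hrp
      obtain ⟨a, ha, hax⟩ := hrep g hg
      obtain ⟨b, hb, hbx⟩ := hrep g' hg'
      rw [← hax, ← hbx]
      exact hx.comm _ a b ha hb
    · exact hx.comm r g g' ((hold r hg.vertex_mem hrp g).mp hg)
        ((hold r hg.vertex_mem hrp g').mp hg')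
  have hsol : (G.contractPair v p p).IsSol x := by
    refine ⟨fun g hg ↦ ?_, hcomm, fun r hr l hl hlr ↦ ?_⟩
    · rw [contractPair_edgeSet] at hg
      exact hx.sq g hg.1
    · by_cases hrp : r = p
      · subst hrp
        obtain ⟨l', hl', hlr'⟩ := exists_enum
          ((finite_setOf_inc hE r).subset fun g (hg : G.Inc g r ∧ g ≠ e) ↦ hg.1)
        refine prod_eq_one_of_enum (hcomm r) (l := f :: l') ?_ (fun g ↦ ?_) ?_ hl hlr
        · exact List.nodup_cons.mpr ⟨fun h1 ↦ hfp ((hlr' f).mp h1).1, hl'⟩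
        · rw [List.mem_cons, hlr', hnew]
          rfl
        · have := hx.prod r he.right_mem (e :: l')
            (List.nodup_cons.mpr ⟨fun h1 ↦ ((hlr' e).mp h1).2 rfl, hl'⟩) fun g ↦ by
              rw [List.mem_cons, hlr']
              constructor
              · rintro (rfl | h1)
                exacts [he.inc_right, h1.1]
              · intro h1
                by_cases hge : g = e
                exacts [Or.inl hge, Or.inr ⟨h1, hge⟩]
          rwa [List.map_cons, ← hxef, ← List.map_cons]
      · exact hx.prod r (hvV hr).1 l hl fun g ↦ (hlr g).trans (hold r hr hrp g)
  have hedge : ∀ a ∈ E(G), ∃ a' ∈ E(G.contractPair v p p), x a' = x a := by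
    intro a ha
    by_cases hae : a = e
    · exact ⟨f, ((hnew f).mpr (Or.inl rfl)).edge_mem, hae ▸ hxef.symm⟩
    · refine ⟨a, ?_, rfl⟩
      rw [contractPair_edgeSet]
      exact ⟨ha, fun h1 ↦ hae ((hboth a).mp h1)⟩
  intro a ha b hb
  obtain ⟨a', ha', hax⟩ := hedge a ha
  obtain ⟨b', hb', hbx⟩ := hedge b hb
  rw [← hax, ← hbx]
  exact h K x hsol a' ha' b' hb'

/-- If `v` has just two edges, both leading to `p`, then without two disjoint cycles all cycles pass
through `p`. -/
lemma isForestPlusVertex_of_pair [DecidableEq α] [G.Loopless] (hV : V(G).Finite) (hE : E(G).Finite)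
    (hm : ¬ (disjUnion twoCycle twoCycle).IsMinor G) {v p : α} {e f : β} (hef : e ≠ f)
    (he : G.IsLink e v p) (hf : G.IsLink f v p) (hd : ∀ g, G.Inc g v ↔ g = e ∨ g = f) :
    IsForestPlusVertex G.mult hV.toFinset := by
  have h2 : 2 ≤ G.mult v p := (Set.one_lt_ncard (finite_isLink hE v p)).mpr ⟨e, he, f, hf, hef⟩
  refine ⟨p, by simpa using he.right_mem, fun S hS hc ↦ hm ?_⟩
  refine isMinor_of_disjoint_isCyc hV hE hc
    (isCyc_pair (mult_self G) (mult_comm G) he.ne h2) ?_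
  have hp : p ∉ S := fun h1 ↦ (mem_erase.mp (hS h1)).1 rfl
  rw [disjoint_right]
  intro r hr hrS
  simp only [mem_insert, mem_singleton] at hr
  obtain rfl | rfl := hr
  · have h3 : degIn G.mult r S = 0 := by
      refine sum_eq_zero fun s hs ↦ (mult_eq_zero_iff hE).mpr fun g hg ↦ ?_
      obtain rfl | rfl := (hd g).mp hg.inc_left
      exacts [hp (IsLink.right_unique hg he ▸ hs), hp (IsLink.right_unique hg hf ▸ hs)]
    have := hc.2 r hrS
    omega
  · exact hp hrS

/-- Solutions commute on a graph of minimum degree at least `3` without the two minors. -/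
lemma commSols_of_three_le [G.Loopless] (hV : V(G).Finite) (hE : E(G).Finite)
    (hm : ¬ (disjUnion twoCycle twoCycle).IsMinor G) (hm' : ¬ (completeBipartite 3 4).IsMinor G)
    (hd : ∀ v ∈ V(G), 3 ≤ {e | G.Inc e v}.ncard) : CommSols.{u, v, w} G := by
  classical
  intro K _ x hx
  have ht : Tame G.mult hV.toFinset :=
    ⟨mult_comm G, mult_self G, fun v hv ↦ by
      rw [degIn_mult_vertexSet hV hE]
      exact hd v (by simpa using hv), fun S _ T _ hS hT hST ↦
      hm (isMinor_of_disjoint_isCyc hV hE hS hT hST)⟩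
  obtain hemp | hne := hV.toFinset.eq_empty_or_nonempty
  · intro e he
    obtain ⟨p, q, hpq⟩ := exists_isLink_of_mem_edgeSet he
    rw [Set.Finite.toFinset_eq_empty] at hemp
    exact absurd hpq.left_mem (hemp ▸ Set.notMem_empty p)
  obtain h | h | h | h := ht.classification hne
  · exact hx.commute_of_isForestPlusVertex hV hE h
  · exact hx.commute_of_isMultiWheel hV hE ht h
  · obtain ⟨a, b, c, W, hW⟩ := isCone_of_isThreeCone hV hE h
    refine hW.commute hE hx ?_
    by_contra! h4
    exact hm' (hW.isMinor hV hE h4)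
  · exact hx.commute_of_isKFive hV h

/-- Solutions commute on a graph without the two minors. Vertices of degree at most two are removed
one by one. -/
theorem commSols_of_not_isMinor [G.Loopless] (hV : V(G).Finite) (hE : E(G).Finite)
    (hm : ¬ (disjUnion twoCycle twoCycle).IsMinor G) (hm' : ¬ (completeBipartite 3 4).IsMinor G) :
    CommSols.{u, v, w} G := by
  classical
  generalize hn : V(G).ncard = n
  induction n using Nat.strong_induction_on generalizing G with
  | _ n ih =>
    have step : ∀ {G'}, MinorStep G G' → V(G') ⊂ V(G) → CommSols.{u, v, w} G' := by
      intro G' hs hlt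
      have := hs.loopless
      exact ih _ (hn ▸ Set.ncard_lt_ncard hlt hV) (hs.vertexSet_finite hV) (hs.edgeSet_finite hE)
        (fun h ↦ hm (h.of_step hs)) (fun h ↦ hm' (h.of_step hs)) rfl
    by_cases hd : ∀ v ∈ V(G), 3 ≤ {e | G.Inc e v}.ncard
    · exact commSols_of_three_le hV hE hm hm' hd
    push Not at hd
    obtain ⟨v, hv, hd⟩ := hd
    intro K _ x hx
    obtain hd | hd : {e | G.Inc e v}.ncard ≤ 1 ∨ {e | G.Inc e v}.ncard = 2 := by omega
    · rw [Set.ncard_le_one (finite_setOf_inc hE v)] at hd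
      refine hx.commute_of_subsingleton hE hv (fun e f he hf ↦ hd e he f hf)
        (step (.deleteVertex G v hv) ?_)
      simpa using hv
    · obtain ⟨e, f, hef, hd⟩ := Set.ncard_eq_two.mp hd
      have hd : ∀ g, G.Inc g v ↔ g = e ∨ g = f := fun g ↦ Set.ext_iff.mp hd g
      obtain ⟨p, he⟩ := (hd e).mpr (Or.inl rfl)
      obtain ⟨q, hf⟩ := (hd f).mpr (Or.inr rfl)
      by_cases hpq : p = q
      · subst hpq
        exact hx.commute_of_isForestPlusVertex hV hE
          (isForestPlusVertex_of_pair hV hE hm hef he hf hd)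
      · refine hx.commute_of_pair hE he hf hpq hd
          (step (.contractEdge G e v p p he (by simp)) ?_)
        refine Set.ssubset_of_subset_of_ssubset (s₂ := V(G) \ {v}) ?_ (by simpa using hv)
        rw [contractPair_vertexSet]
        rintro _ ⟨s, hs, rfl⟩
        dsimp only
        split_ifs with h1
        · exact ⟨he.right_mem, he.ne.symm⟩
        · exact ⟨hs, fun h2 ↦ h1 (Or.inl h2)⟩

end Graph

theorem proposition5p2 {α β : Type*} (G : Graph α β) [G.Loopless]
    (hV : G.vertexSet.Finite) (hE : G.edgeSet.Finite) :
    (∀ a b : G.IncidenceGroup, a * b = b * a) ↔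
      ¬ (Graph.disjUnion Graph.twoCycle Graph.twoCycle).IsMinor G ∧
        ¬ (Graph.completeBipartite 3 4).IsMinor G := by
  refine ⟨fun h ↦ ⟨fun hm ↦ ?_, fun hm ↦ ?_⟩, fun ⟨hm, hm'⟩ ↦ ?_⟩
  · exact Graph.not_commSols_disjUnion_twoCycle (hm.commSols hE (Graph.commSols_of_commutative h))
  · exact Graph.not_commSols_completeBipartite (hm.commSols hE (Graph.commSols_of_commutative h))
  · exact (Graph.commSols_of_not_isMinor hV hE hm hm').commutative
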